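/- Work either in the real $C^\infty$ category ($\mathbb K=\mathbb R$) or in the holomorphic one ($\mathbb K=\mathbb C$). Let $V$ be a manifold of dimension $n$, let $E,F$ be vector bundles over $V$ of ranks $p,q$, let $k\ge 1$, and let $D:J^kE\to F$ be a surjective morphism of vector bundles, i.e. a linear homogeneous differential operator of order $k$. Consider the equation $$(*)\qquad D(j^ks)=0$$ for local sections $s$ of $E$. For $h\ge k$ let $D_h:J^hE\to J^{h-k}F$, $j^h_xs\mapsto j^{h-k}_x(D(j^ks))$, be the prolongation of $D$, let $R_h=\ker D_h$ (and $R_{k-1}=J^{k-1}E$), and let the principal symbol $\sigma_h(D)$ be the restriction of $D_h$ to $\ker(J^hE\to J^{h-1}E)\cong S^hT^*V\otimes E$. Put $c(n,h)=\frac{(n-1+h)!}{(n-1)!\,h!}$. Suppose that $p<q\le p\,c(n,k)$. Then there is a greatest integer $h_0\ge k$ with $p\,c(n,h_0)\ge q\,c(n,h_0-k)$; put $$\pi(n,k,p,q)=p\,c(n+1,h_0)-q\,c(n+1,h_0-k).$$ Suppose that $D$ is ordinary, i.e. $\sigma_h(D)$ has rank $\min\bigl(q\,c(n,h-k),\,p\,c(n,h)\bigr)$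 at every point for every $h\ge k$, and calibrated, i.e. $p\,c(n,h_0)=q\,c(n,h_0-k)$. Then $\mathcal E:=R_{h_0-1}$ is a vector bundle of rank $\pi(n,k,p,q)$; the projection $\pi_0:R_{h_0}\to R_{h_0-1}$ is an isomorphism; and the inclusion $J^{h_0}E\to J^1(J^{h_0-1}E)$ maps $R_{h_0}$ into $J^1(R_{h_0-1})$. Denoting the latter map by $\iota:R_{h_0}\to J^1\mathcal E$ and putting $u=\iota\circ\pi_0^{-1}$, the formula $\nabla\sigma=j^1\sigma-u(\sigma)\in T^*V\otimes\mathcal E=\ker(J^1\mathcal E\to\mathcal E)$ defines a connection $\nabla$ on $\mathcal E$ (the tautological connection). Moreover: (i) A section $s$ of $E$ over an open set $U\subseteq V$ is a solution of $(*)$ if and only if $j^{h_0-1}s$ is a section of $\mathcal E$ and $\nabla(j^{h_0-1}s)=0$; and $s\mapsto j^{h_0-1}s$ is a bijection from the solutions of $(*)$ over $U$ to the sections $\sigma$ of $\mathcal E$ over $U$ with $\nabla\sigma=0$. (ii) For every $m\in V$ the space $\mathcal S_m$ of germs at $m$ of solutions of $(*)$ satisfies $\dim\mathcal S_m\le\pi(n,k,p,q)$,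 and equality holds if and only if the curvature of $\nabla$ vanishes in a neighbourhood of $m$. In particular, equality holds at every $m\in V$ if and only if the curvature of $\nabla$ vanishes identically. -/

import Mathlib

open Bundle Filter
open scoped Manifold ContDiff Topology

noncomputable section

namespace JetPDE

section Sheaves

variable (𝕜 : Type*) [RCLike 𝕜] (n : ℕ) {V : Type*} [TopologicalSpace V]
  [ChartedSpace (EuclideanSpace 𝕜 (Fin n)) V]

/-- `f` is smooth near `x`: real `C^∞` if `𝕜 = ℝ`, holomorphic if `𝕜 = ℂ`.
(Local functions are represented by functions defined on all of `V`, arbitrary away from `x`.) -/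
def SmoothNear (x : V) (f : V → 𝕜) : Prop :=
  ∀ᶠ y in 𝓝 x, ContMDiffAt 𝓘(𝕜, EuclideanSpace 𝕜 (Fin n)) 𝓘(𝕜) ∞ f y

/-- A sheaf of "smooth" sections of a family of vector spaces `W`: for every `x` the module
`Γ_x` of those sections that are smooth near `x`, which is a module over the smooth functions
near `x`; being smooth near `x` is an open condition on `x` and depends only on the germ. -/
structure SmoothStr (W : V → Type*) [∀ y, AddCommGroup (W y)] [∀ y, Module 𝕜 (W y)] where
  /-- the sections that are smooth near `x` -/
  sec : V → Submodule 𝕜 (∀ y, W y)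
  smul_mem : ∀ {x : V} {f : V → 𝕜} {s : ∀ y, W y}, SmoothNear 𝕜 n x f → s ∈ sec x →
    (fun y => f y • s y) ∈ sec x
  eventually_mem : ∀ {x : V} {s : ∀ y, W y}, s ∈ sec x → ∀ᶠ y in 𝓝 x, s ∈ sec y
  congr : ∀ {x : V} {s t : ∀ y, W y}, s ∈ sec x → (∀ᶠ y in 𝓝 x, s y = t y) → t ∈ sec x

/-- The smooth sections of a vector bundle. -/
def bundleStr (F : Type*) [NormedAddCommGroup F] [NormedSpace 𝕜 F]
    (W : V → Type*) [TopologicalSpace (TotalSpace F W)]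
    [∀ y, AddCommGroup (W y)] [∀ y, Module 𝕜 (W y)] [∀ y, TopologicalSpace (W y)]
    [FiberBundle F W] [VectorBundle 𝕜 F W] : SmoothStr 𝕜 n W where
  sec x :=
    { carrier := {s | ∀ᶠ y in 𝓝 x, ContMDiffAt 𝓘(𝕜, EuclideanSpace 𝕜 (Fin n))
        (𝓘(𝕜, EuclideanSpace 𝕜 (Fin n)).prod 𝓘(𝕜, F)) ∞
        (fun z => TotalSpace.mk' F z (s z)) y}
      add_mem' := fun {s t} hs ht => by
        filter_upwards [hs, ht] with y h1 h2
        exact h1.add_section h2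
      zero_mem' := Eventually.of_forall fun y =>
        (contMDiff_zeroSection 𝕜 W).contMDiffAt
      smul_mem' := fun c s hs => by
        filter_upwards [hs] with y h
        exact h.const_smul_section }
  smul_mem {x f s} hf hs := by
    change ∀ᶠ y in 𝓝 x, ContMDiffAt 𝓘(𝕜, EuclideanSpace 𝕜 (Fin n))
        (𝓘(𝕜, EuclideanSpace 𝕜 (Fin n)).prod 𝓘(𝕜, F)) ∞
        (fun z => TotalSpace.mk' F z (s z)) y at hs
    filter_upwards [hf, hs] with y h1 h2
    exact h1.smul_section h2
  eventually_mem {x s} hs := eventually_eventually_nhds.2 hs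
  congr {x s t} hs hst := by
    have hst' : ∀ᶠ y in 𝓝 x, ∀ᶠ z in 𝓝 y, s z = t z := eventually_eventually_nhds.2 hst
    change ∀ᶠ y in 𝓝 x, ContMDiffAt 𝓘(𝕜, EuclideanSpace 𝕜 (Fin n))
        (𝓘(𝕜, EuclideanSpace 𝕜 (Fin n)).prod 𝓘(𝕜, F)) ∞
        (fun z => TotalSpace.mk' F z (s z)) y at hs
    change ∀ᶠ y in 𝓝 x, ContMDiffAt 𝓘(𝕜, EuclideanSpace 𝕜 (Fin n))
        (𝓘(𝕜, EuclideanSpace 𝕜 (Fin n)).prod 𝓘(𝕜, F)) ∞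
        (fun z => TotalSpace.mk' F z (t z)) y
    filter_upwards [hst', hs] with y h1 h2
    refine h2.congr_of_eventuallyEq ?_
    filter_upwards [h1] with z hz
    rw [hz]

end Sheaves

section Jets

variable {𝕜 : Type*} [RCLike 𝕜] {n : ℕ} {V : Type*} [TopologicalSpace V]
  [ChartedSpace (EuclideanSpace 𝕜 (Fin n)) V]
  {W : V → Type*} [∀ y, AddCommGroup (W y)] [∀ y, Module 𝕜 (W y)]
  {W' : V → Type*} [∀ y, AddCommGroup (W' y)] [∀ y, Module 𝕜 (W' y)]

theorem SmoothNear.const (x : V) (c : 𝕜) : SmoothNear 𝕜 n x (fun _ => c) :=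
  Eventually.of_forall fun _ => contMDiffAt_const

theorem SmoothNear.mul {x : V} {f g : V → 𝕜} (hf : SmoothNear 𝕜 n x f)
    (hg : SmoothNear 𝕜 n x g) : SmoothNear 𝕜 n x (fun y => f y * g y) := by
  filter_upwards [hf, hg] with y h1 h2
  exact h1.mul h2

theorem SmoothNear.sub {x : V} {f g : V → 𝕜} (hf : SmoothNear 𝕜 n x f)
    (hg : SmoothNear 𝕜 n x g) : SmoothNear 𝕜 n x (fun y => f y - g y) := by
  filter_upwards [hf, hg] with y h1 h2
  exact h1.sub h2

theorem SmoothNear.eventually {x : V} {f : V → 𝕜} (hf : SmoothNear 𝕜 n x f) :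
    ∀ᶠ y in 𝓝 x, SmoothNear 𝕜 n y f :=
  eventually_eventually_nhds.2 hf

/-- The module `𝔪_x ^ j Γ_x` of the smooth sections vanishing to order `j` at `x`, where `𝔪_x` is
the ideal of the smooth functions near `x` that vanish at `x`. -/
def van (S : SmoothStr 𝕜 n W) : ℕ → ∀ _ : V, Submodule 𝕜 (∀ y, W y)
  | 0, x => S.sec x
  | j + 1, x => Submodule.span 𝕜 {t | ∃ f : V → 𝕜, SmoothNear 𝕜 n x f ∧ f x = 0 ∧
      ∃ s ∈ van S j x, t = fun y => f y • s y}

/-- The space `J^h_x W = Γ_x / 𝔪_x ^ (h + 1) Γ_x` of `h`-jets at `x` of smooth sections. -/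
def Jet (S : SmoothStr 𝕜 n W) (h : ℕ) (x : V) : Type _ :=
  S.sec x ⧸ (van S (h + 1) x).comap (S.sec x).subtype

instance (S : SmoothStr 𝕜 n W) (h : ℕ) (x : V) : AddCommGroup (Jet S h x) :=
  inferInstanceAs (AddCommGroup (S.sec x ⧸ (van S (h + 1) x).comap (S.sec x).subtype))

instance (S : SmoothStr 𝕜 n W) (h : ℕ) (x : V) : Module 𝕜 (Jet S h x) :=
  inferInstanceAs (Module 𝕜 (S.sec x ⧸ (van S (h + 1) x).comap (S.sec x).subtype))

/-- The jet `j^h_x s` of `s ∈ Γ_x`, as a linear map in `s`. -/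
def jetMk (S : SmoothStr 𝕜 n W) (h : ℕ) (x : V) : S.sec x →ₗ[𝕜] Jet S h x :=
  ((van S (h + 1) x).comap (S.sec x).subtype).mkQ

open scoped Classical in
/-- The section `y ↦ j^h_y s` (with value `0` where `s` is not smooth). -/
def jet (S : SmoothStr 𝕜 n W) (h : ℕ) (s : ∀ y, W y) (y : V) : Jet S h y :=
  if hs : s ∈ S.sec y then jetMk S h y ⟨s, hs⟩ else 0

theorem jet_of_mem {S : SmoothStr 𝕜 n W} {h : ℕ} {s : ∀ y, W y} {y : V} (hs : s ∈ S.sec y) :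
    jet S h s y = jetMk S h y ⟨s, hs⟩ := dif_pos hs

theorem jetMk_eq_zero {S : SmoothStr 𝕜 n W} {h : ℕ} {y : V} (s : S.sec y) :
    jetMk S h y s = 0 ↔ (s : ∀ y, W y) ∈ van S (h + 1) y := by
  refine (Submodule.Quotient.mk_eq_zero _).trans ?_
  rfl

theorem jetMk_surjective (S : SmoothStr 𝕜 n W) (h : ℕ) (y : V) :
    Function.Surjective (jetMk S h y) :=
  Submodule.mkQ_surjective _

theorem van_succ_le (S : SmoothStr 𝕜 n W) (j : ℕ) (x : V) : van S (j + 1) x ≤ van S j x := by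
  induction j with
  | zero =>
    refine Submodule.span_le.2 ?_
    rintro t ⟨f, hf, -, s, hs, rfl⟩
    exact S.smul_mem hf hs
  | succ j ih =>
    refine Submodule.span_le.2 ?_
    rintro t ⟨f, hf, hf0, s, hs, rfl⟩
    exact Submodule.subset_span ⟨f, hf, hf0, s, ih hs, rfl⟩

theorem van_anti (S : SmoothStr 𝕜 n W) (x : V) : Antitone fun j => van S j x :=
  antitone_nat_of_succ_le fun j => van_succ_le S j x

theorem van_le_sec (S : SmoothStr 𝕜 n W) (j : ℕ) (x : V) : van S j x ≤ S.sec x :=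
  van_anti S x (Nat.zero_le j)

theorem smul_mem_van (S : SmoothStr 𝕜 n W) {j : ℕ} {x : V} {f : V → 𝕜} {s : ∀ y, W y}
    (hf : SmoothNear 𝕜 n x f) (hs : s ∈ van S j x) : (fun y => f y • s y) ∈ van S j x := by
  induction j generalizing s with
  | zero => exact S.smul_mem hf hs
  | succ j ih =>
    refine Submodule.span_induction (p := fun s _ => (fun y => f y • s y) ∈ van S (j + 1) x)
      ?_ ?_ ?_ ?_ hs
    · rintro t ⟨g, hg, hg0, s, hs, rfl⟩
      refine Submodule.subset_span ⟨g, hg, hg0, _, ih hs, ?_⟩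
      funext y
      exact smul_comm _ _ _
    · convert (van S (j + 1) x).zero_mem using 1
      funext y
      exact smul_zero _
    · intro s t _ _ h1 h2
      convert (van S (j + 1) x).add_mem h1 h2 using 1
      funext y
      exact smul_add _ _ _
    · intro c s _ h1
      have := (van S (j + 1) x).smul_mem c h1
      convert this using 1
      funext y
      exact smul_comm _ _ _

theorem mem_van_of_germ_zero (S : SmoothStr 𝕜 n W) (j : ℕ) {x : V} {s : ∀ y, W y}
    (hs : ∀ᶠ y in 𝓝 x, s y = 0) : s ∈ van S j x := by
  classical
  induction j with
  | zero => exact S.congr (S.sec x).zero_mem (hs.mono fun y h => h.symm)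
  | succ j ih =>
    refine Submodule.subset_span ⟨fun y => if s y = 0 then 0 else 1, ?_, ?_, s, ih, ?_⟩
    · filter_upwards [eventually_eventually_nhds.2 hs] with y hy
      refine (contMDiffAt_const (c := (0 : 𝕜))).congr_of_eventuallyEq ?_
      filter_upwards [hy] with z hz
      simp [hz]
    · simp [hs.self_of_nhds]
    · funext y
      by_cases h : s y = 0 <;> simp [h]

theorem van_congr (S : SmoothStr 𝕜 n W) {j : ℕ} {x : V} {s t : ∀ y, W y}
    (hs : s ∈ van S j x) (hst : ∀ᶠ y in 𝓝 x, s y = t y) : t ∈ van S j x := by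
  have h : t - s ∈ van S j x := mem_van_of_germ_zero S j (hst.mono fun y h => by simp [h])
  simpa using (van S j x).add_mem h hs

/-- The smooth sections of the jet bundle `J^h W`: those which near `x` are finite sums
`∑ f_i • j^h s_i` with `f_i` and `s_i` smooth. -/
def jetStr (S : SmoothStr 𝕜 n W) (h : ℕ) : SmoothStr 𝕜 n (Jet S h) where
  sec x :=
    { carrier := {σ | ∃ τ ∈ Submodule.span 𝕜 {t : ∀ y, Jet S h y | ∃ f : V → 𝕜,
        SmoothNear 𝕜 n x f ∧ ∃ s ∈ S.sec x, t = fun y => f y • jet S h s y},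
        ∀ᶠ y in 𝓝 x, τ y = σ y}
      add_mem' := by
        rintro σ σ' ⟨τ, hτ, h⟩ ⟨τ', hτ', h'⟩
        refine ⟨τ + τ', Submodule.add_mem _ hτ hτ', ?_⟩
        filter_upwards [h, h'] with y h1 h2
        simp [h1, h2]
      zero_mem' := ⟨0, Submodule.zero_mem _, Eventually.of_forall fun _ => rfl⟩
      smul_mem' := by
        rintro c σ ⟨τ, hτ, h⟩
        refine ⟨c • τ, Submodule.smul_mem _ c hτ, ?_⟩
        filter_upwards [h] with y h1
        simp [h1] }
  smul_mem := by
    rintro x g σ hg ⟨τ, hτ, h⟩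
    refine ⟨fun y => g y • τ y, ?_, h.mono fun y hy => by simp [hy]⟩
    refine Submodule.span_induction (p := fun τ _ => (fun y => g y • τ y) ∈ Submodule.span 𝕜
      {t : ∀ y, Jet S _ y | ∃ f : V → 𝕜,
        SmoothNear 𝕜 n x f ∧ ∃ s ∈ S.sec x, t = fun y => f y • jet S _ s y}) ?_ ?_ ?_ ?_ hτ
    · rintro t ⟨f, hf, s, hs, rfl⟩
      refine Submodule.subset_span ⟨_, hg.mul hf, s, hs, ?_⟩
      funext y
      exact smul_smul _ _ _
    · convert Submodule.zero_mem _ using 1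
      funext y
      exact smul_zero _
    · intro s t _ _ h1 h2
      convert Submodule.add_mem _ h1 h2 using 1
      funext y
      exact smul_add _ _ _
    · intro c s _ h1
      have := Submodule.smul_mem _ c h1
      convert this using 1
      funext y
      exact smul_comm (g y) c (s y)
  eventually_mem := by
    rintro x σ ⟨τ, hτ, h⟩
    have key : ∀ᶠ z in 𝓝 x, τ ∈ Submodule.span 𝕜 {t : ∀ y, Jet S _ y | ∃ f : V → 𝕜,
        SmoothNear 𝕜 n z f ∧ ∃ s ∈ S.sec z, t = fun y => f y • jet S _ s y} := by
      refine Submodule.span_induction (p := fun τ _ => ∀ᶠ z in 𝓝 x, τ ∈ Submodule.span 𝕜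
        {t : ∀ y, Jet S _ y | ∃ f : V → 𝕜,
          SmoothNear 𝕜 n z f ∧ ∃ s ∈ S.sec z, t = fun y => f y • jet S _ s y}) ?_ ?_ ?_ ?_ hτ
      · rintro t ⟨f, hf, s, hs, rfl⟩
        filter_upwards [hf.eventually, S.eventually_mem hs] with z h1 h2
        exact Submodule.subset_span ⟨f, h1, s, h2, rfl⟩
      · exact Eventually.of_forall fun _ => Submodule.zero_mem _
      · intro s t _ _ h1 h2
        filter_upwards [h1, h2] with z h1 h2
        exact Submodule.add_mem _ h1 h2
      · intro c s _ h1
        filter_upwards [h1] with z h1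
        exact Submodule.smul_mem _ c h1
    filter_upwards [key, eventually_eventually_nhds.2 h] with z h1 h2
    exact ⟨τ, h1, h2⟩
  congr := by
    rintro x σ σ' ⟨τ, hτ, h⟩ h'
    refine ⟨τ, hτ, ?_⟩
    filter_upwards [h, h'] with y h1 h2
    rw [h1, h2]

/-- The smooth sections of a subfamily `R` of `W`: the smooth sections of `W` with values
in `R`. -/
def subStr (S : SmoothStr 𝕜 n W) (R : ∀ y, Submodule 𝕜 (W y)) :
    SmoothStr 𝕜 n (fun y => R y) where
  sec x :=
    { carrier := {σ | (fun y => (σ y : W y)) ∈ S.sec x}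
      add_mem' := fun {σ τ} h1 h2 => (S.sec x).add_mem h1 h2
      zero_mem' := (S.sec x).zero_mem
      smul_mem' := fun c σ h => (S.sec x).smul_mem c h }
  smul_mem hf hs := S.smul_mem hf hs
  eventually_mem hs := S.eventually_mem hs
  congr hs hst := S.congr hs (hst.mono fun y h => by rw [h])

/-- The projection `J^h W → J^l W`, `l ≤ h`. -/
def jetProj (S : SmoothStr 𝕜 n W) {l h : ℕ} (hl : l ≤ h) (x : V) : Jet S h x →ₗ[𝕜] Jet S l x :=
  Submodule.liftQ _ (jetMk S l x) fun s hs =>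
    (jetMk_eq_zero s).2 (van_anti S x (Nat.succ_le_succ hl) hs)

/-- The map `J^h R → J^h W` induced by the inclusion of a subfamily `R` of `W`. -/
def jetIncl (S : SmoothStr 𝕜 n W) (R : ∀ y, Submodule 𝕜 (W y)) (h : ℕ) (x : V) :
    Jet (subStr S R) h x →ₗ[𝕜] Jet S h x :=
  Submodule.liftQ _
    ((jetMk S h x).comp
      ({ toFun := fun σ => ⟨fun y => ((σ : ∀ y, R y) y : W y), σ.2⟩
         map_add' := fun _ _ => rfl
         map_smul' := fun _ _ => rfl } : (subStr S R).sec x →ₗ[𝕜] S.sec x)) fun σ hσ => by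
    refine (jetMk_eq_zero _).2 ?_
    change (σ : ∀ y, R y) ∈ van (subStr S R) (h + 1) x at hσ
    change (fun y => ((σ : ∀ y, R y) y : W y)) ∈ van S (h + 1) x
    have key : ∀ (j : ℕ) (σ : ∀ y, R y), σ ∈ van (subStr S R) j x →
        (fun y => (σ y : W y)) ∈ van S j x := by
      intro j
      induction j with
      | zero => exact fun σ hσ => hσ
      | succ j ih =>
        intro σ hσ
        refine Submodule.span_induction
          (p := fun (σ : ∀ y, R y) _ => (fun y => (σ y : W y)) ∈ van S (j + 1) x)
          ?_ ?_ ?_ ?_ hσ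
        · rintro t ⟨f, hf, hf0, s, hs, rfl⟩
          exact Submodule.subset_span ⟨f, hf, hf0, _, ih s hs, rfl⟩
        · exact Submodule.zero_mem _
        · intro s t _ _ h1 h2
          exact Submodule.add_mem _ h1 h2
        · intro c s _ h1
          exact Submodule.smul_mem _ c h1
    exact key _ _ hσ

end Jets

section Operators

variable {𝕜 : Type*} [RCLike 𝕜] {n : ℕ} {V : Type*} [TopologicalSpace V]
  [ChartedSpace (EuclideanSpace 𝕜 (Fin n)) V]
  {W : V → Type*} [∀ y, AddCommGroup (W y)] [∀ y, Module 𝕜 (W y)]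
  {W' : V → Type*} [∀ y, AddCommGroup (W' y)] [∀ y, Module 𝕜 (W' y)]

/-- A homogeneous linear differential operator of order `k`: a smooth linear morphism
`D : J^k W → W'`. Smoothness: `x ↦ D (j^k_x s)` is smooth whenever `s` is. -/
structure DiffOp (S : SmoothStr 𝕜 n W) (S' : SmoothStr 𝕜 n W') (k : ℕ) where
  toFun : ∀ x : V, Jet S k x →ₗ[𝕜] W' x
  smooth : ∀ (x : V), ∀ s ∈ S.sec x, (fun y => toFun y (jet S k s y)) ∈ S'.sec x

/-- The section `x ↦ D (j^k_x s)`. -/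
def DiffOp.apply {S : SmoothStr 𝕜 n W} {S' : SmoothStr 𝕜 n W'} {k : ℕ} (D : DiffOp S S' k)
    (s : ∀ y, W y) (y : V) : W' y :=
  D.toFun y (jet S k s y)

/-- The operator `s ↦ j^h s`, i.e. the identity morphism of `J^h W`. -/
def jetOp (S : SmoothStr 𝕜 n W) (h : ℕ) : DiffOp S (jetStr S h) h where
  toFun _ := LinearMap.id
  smooth x s hs := ⟨_, Submodule.subset_span ⟨fun _ => 1, SmoothNear.const x 1, s, hs, rfl⟩,
    Eventually.of_forall fun y => one_smul 𝕜 (jet S h s y)⟩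

/-- An operator on sections which near `x` is linear, maps smooth sections to smooth sections, and
kills at `y` all sections in `𝔪_y ^ j Γ_y`, maps `𝔪_x ^ a Γ_x` to `𝔪_x ^ (a + 1 - j) Γ'_x`. -/
theorem op_mem_van (S : SmoothStr 𝕜 n W) (S' : SmoothStr 𝕜 n W') (x : V) (j : ℕ) :
    ∀ (P : (∀ y, W y) → ∀ y, W' y),
    (∀ s ∈ S.sec x, P s ∈ S'.sec x) →
    (∀ᶠ y in 𝓝 x, ∀ s ∈ S.sec y, ∀ t ∈ S.sec y, P (s + t) y = P s y + P t y) →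
    (∀ᶠ y in 𝓝 x, ∀ c : 𝕜, ∀ s ∈ S.sec y, P (c • s) y = c • P s y) →
    (∀ᶠ y in 𝓝 x, ∀ s ∈ van S j y, P s y = 0) →
    ∀ a : ℕ, ∀ s ∈ van S a x, P s ∈ van S' (a + 1 - j) x := by
  induction j with
  | zero =>
    intro P hP hadd hsmul hvan a s hs
    refine mem_van_of_germ_zero S' _ ?_
    filter_upwards [hvan, S.eventually_mem (van_le_sec S a x hs)] with y h1 h2
    exact h1 s h2
  | succ j ihj =>
    intro P hP hadd hsmul hvan a
    induction a with
    | zero =>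
      intro s hs
      rw [show 0 + 1 - (j + 1) = 0 by omega]
      exact hP s hs
    | succ a iha =>
      intro s hs
      have hle : van S (a + 1) x ≤ S.sec x := van_le_sec S (a + 1) x
      refine Submodule.span_induction
        (p := fun s _ => P s ∈ van S' (a + 1 + 1 - (j + 1)) x) ?_ ?_ ?_ ?_ hs
      · rintro t ⟨f, hf, hf0, s, hs, rfl⟩
        have hsx : s ∈ S.sec x := van_le_sec S a x hs
        have h1 : (fun y => f y • P s y) ∈ van S' (a + 1 + 1 - (j + 1)) x := by
          have h := Submodule.subset_span (R := 𝕜) (s := {t | ∃ f : V → 𝕜, SmoothNear 𝕜 n x f ∧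
            f x = 0 ∧ ∃ s ∈ van S' (a + 1 - (j + 1)) x, t = fun y => f y • s y})
            ⟨f, hf, hf0, _, iha s hs, rfl⟩
          exact van_anti S' x (show a + 1 + 1 - (j + 1) ≤ a + 1 - (j + 1) + 1 by omega) h
        have h2 : (fun y => P (fun z => f z • s z) y - f y • P s y) ∈ van S' (a + 1 - j) x := by
          refine ihj (fun s y => P (fun z => f z • s z) y - f y • P s y) ?_ ?_ ?_ ?_ a s hs
          · intro s hs
            exact Submodule.sub_mem _ (hP _ (S.smul_mem hf hs)) (S'.smul_mem hf (hP s hs))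
          · filter_upwards [hadd, hf.eventually] with y h1 h2 s hs t ht
            have e : (fun z => f z • (s + t) z) = (fun z => f z • s z) + fun z => f z • t z := by
              funext z
              simp [smul_add]
            rw [e, h1 _ (S.smul_mem h2 hs) _ (S.smul_mem h2 ht), h1 s hs t ht, smul_add]
            abel
          · filter_upwards [hsmul, hf.eventually] with y h1 h2 c s hs
            have e : (fun z => f z • (c • s) z) = c • fun z => f z • s z := by
              funext z
              exact smul_comm _ _ _
            rw [e, h1 c _ (S.smul_mem h2 hs), h1 c s hs, smul_sub, smul_comm (f y) c]
          · filter_upwards [hvan, hadd, hsmul, hf.eventually] with y h1 h2 h3 h4 s hs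
            have hsy : s ∈ S.sec y := van_le_sec S j y hs
            have h5 : (fun z => (f z - f y) • s z) ∈ van S (j + 1) y :=
              Submodule.subset_span ⟨fun z => f z - f y, h4.sub (SmoothNear.const y (f y)),
                sub_self _, s, hs, rfl⟩
            have e : (fun z => f z • s z) = (fun z => (f z - f y) • s z) + f y • s := by
              funext z
              simp [sub_smul]
            rw [e, h2 _ (van_le_sec S _ y h5) _ ((S.sec y).smul_mem _ hsy), h1 _ h5,
              h3 _ s hsy, zero_add, sub_self]
        rw [show a + 1 + 1 - (j + 1) = a + 1 - j by omega] at h1 ⊢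
        have h3 := Submodule.add_mem _ h2 h1
        refine van_congr S' h3 (Eventually.of_forall fun y => ?_)
        simp
      · refine mem_van_of_germ_zero S' _ ?_
        filter_upwards [hsmul] with y h1
        simpa using h1 0 0 (S.sec y).zero_mem
      · intro s t hs ht h1 h2
        refine van_congr S' (Submodule.add_mem _ h1 h2) ?_
        filter_upwards [hadd, S.eventually_mem (hle hs), S.eventually_mem (hle ht)] with y h3 h4 h5
        exact (h3 s h4 t h5).symm
      · intro c s hs h1
        refine van_congr S' (Submodule.smul_mem _ c h1) ?_
        filter_upwards [hsmul, S.eventually_mem (hle hs)] with y h3 h4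
        exact (h3 c s h4).symm

variable {S : SmoothStr 𝕜 n W} {S' : SmoothStr 𝕜 n W'} {k : ℕ}

theorem DiffOp.apply_add (D : DiffOp S S' k) {y : V} {s t : ∀ y, W y} (hs : s ∈ S.sec y)
    (ht : t ∈ S.sec y) : D.apply (s + t) y = D.apply s y + D.apply t y := by
  unfold DiffOp.apply
  rw [jet_of_mem hs, jet_of_mem ht, jet_of_mem ((S.sec y).add_mem hs ht), ← map_add, ← map_add]
  rfl

theorem DiffOp.apply_smul (D : DiffOp S S' k) {y : V} (c : 𝕜) {s : ∀ y, W y}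
    (hs : s ∈ S.sec y) : D.apply (c • s) y = c • D.apply s y := by
  unfold DiffOp.apply
  rw [jet_of_mem hs, jet_of_mem ((S.sec y).smul_mem c hs), ← map_smul, ← map_smul]
  rfl

theorem DiffOp.apply_mem_van (D : DiffOp S S' k) {x : V} {a : ℕ} {s : ∀ y, W y}
    (hs : s ∈ van S a x) : D.apply s ∈ van S' (a - k) x := by
  have h := op_mem_van S S' x (k + 1) D.apply (fun s hs => D.smooth x s hs)
    (Eventually.of_forall fun y s hs t ht => D.apply_add hs ht)
    (Eventually.of_forall fun y c s hs => D.apply_smul c hs)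
    (Eventually.of_forall fun y s hs => by
      unfold DiffOp.apply
      rw [jet_of_mem (van_le_sec S _ y hs), (jetMk_eq_zero _).2 hs, map_zero]) a s hs
  rwa [show a + 1 - (k + 1) = a - k by omega] at h

theorem jetMk_congr {h : ℕ} {x : V} {s t : S.sec x}
    (hst : ∀ᶠ y in 𝓝 x, (s : ∀ y, W y) y = (t : ∀ y, W y) y) :
    jetMk S h x s = jetMk S h x t := by
  rw [← sub_eq_zero, ← map_sub, jetMk_eq_zero]
  refine mem_van_of_germ_zero S _ (hst.mono fun y hy => ?_)
  simp [hy]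

/-- The prolongation `J^h W → J^l W'`, `j^h_x s ↦ j^l_x (D (j^k s))`, of `D`, for `k + l ≤ h`. -/
def DiffOp.prolong (D : DiffOp S S' k) {h l : ℕ} (hl : k + l ≤ h) (x : V) :
    Jet S h x →ₗ[𝕜] Jet S' l x :=
  Submodule.liftQ _
    ({ toFun := fun s => jetMk S' l x ⟨D.apply s, D.smooth x s s.2⟩
       map_add' := fun s t => by
        rw [← map_add]
        refine jetMk_congr ?_
        filter_upwards [S.eventually_mem s.2, S.eventually_mem t.2] with y h1 h2
        exact D.apply_add h1 h2
       map_smul' := fun c s => by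
        rw [RingHom.id_apply, ← map_smul]
        refine jetMk_congr ?_
        filter_upwards [S.eventually_mem s.2] with y h1
        exact D.apply_smul c h1 } : S.sec x →ₗ[𝕜] Jet S' l x) fun s hs =>
    (jetMk_eq_zero _).2 (van_anti S' x (show l + 1 ≤ h + 1 - k by omega) (D.apply_mem_van hs))

theorem DiffOp.prolong_jetMk (D : DiffOp S S' k) {h l : ℕ} (hl : k + l ≤ h) (x : V)
    (s : S.sec x) :
    D.prolong hl x (jetMk S h x s) = jetMk S' l x ⟨D.apply s, D.smooth x s s.2⟩ := rfl

/-- The inclusion `J^(h+1) W → J^1 (J^h W)`, `j^(h+1)_x s ↦ j^1_x (j^h s)`. -/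
def jetJet (S : SmoothStr 𝕜 n W) (h : ℕ) (x : V) : Jet S (h + 1) x →ₗ[𝕜] Jet (jetStr S h) 1 x :=
  (jetOp S h).prolong le_rfl x

/-- The principal symbol `σ_h(D)`, `h ≥ k`: the restriction of the prolongation
`D_h : J^h W → J^(h-k) W'` to the kernel (`≃ S^h T^*V ⊗ W`) of the projection
`J^h W → J^(h-1) W`. -/
def DiffOp.symbol (D : DiffOp S S' k) {h : ℕ} (hk : k ≤ h) (x : V) :
    LinearMap.ker (jetProj S (Nat.sub_le h 1) x) →ₗ[𝕜] Jet S' (h - k) x :=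
  (D.prolong (Nat.add_sub_of_le hk).le x).domRestrict _

/-- The space `(R_h)_x` of formal solutions of order `h` at `x`: the kernel of
`D_h : J^h W → J^(h-k) W'` if `h ≥ k`, and all of `J^h W` if `h < k`. -/
def DiffOp.formalSol (D : DiffOp S S' k) (h : ℕ) (x : V) : Submodule 𝕜 (Jet S h x) :=
  if hk : k ≤ h then LinearMap.ker (D.prolong (Nat.add_sub_of_le hk).le x) else ⊤

end Operators

section Connections

variable {𝕜 : Type*} [RCLike 𝕜] {n : ℕ} {V : Type*} [TopologicalSpace V]
  [ChartedSpace (EuclideanSpace 𝕜 (Fin n)) V]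
  {W : V → Type*} [∀ y, AddCommGroup (W y)] [∀ y, Module 𝕜 (W y)]

/-- `S` is the sheaf of sections of a smooth vector bundle of rank `r`: near every point there are
`r` smooth sections forming a basis of every fibre, and every smooth section is a combination
of them with smooth coefficients. -/
def IsVectorBundle (S : SmoothStr 𝕜 n W) (r : ℕ) : Prop :=
  ∀ x : V, ∃ e : Fin r → ∀ y, W y, ∀ᶠ y in 𝓝 x,
    (∀ i, e i ∈ S.sec y) ∧
    LinearIndependent 𝕜 (fun i => e i y) ∧
    Submodule.span 𝕜 (Set.range fun i => e i y) = ⊤ ∧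
    ∀ σ ∈ S.sec y, ∃ f : Fin r → V → 𝕜, (∀ i, SmoothNear 𝕜 n y (f i)) ∧
      ∀ᶠ z in 𝓝 y, σ z = ∑ i, f i z • e i z

/-- The differential `df_x : T_xV → 𝕜` of a function. -/
def diff (f : V → 𝕜) (x : V) : TangentSpace 𝓘(𝕜, EuclideanSpace 𝕜 (Fin n)) x →ₗ[𝕜] 𝕜 :=
  (mfderiv 𝓘(𝕜, EuclideanSpace 𝕜 (Fin n)) 𝓘(𝕜) f x).toLinearMap

/-- The jet `v ∈ J^1_x W` is the image of `α ∈ Hom(T_xV, W_x) = T_x^*V ⊗ W_x` under the inclusion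
`T^*V ⊗ W → J^1 W`, `df_x ⊗ τ(x) ↦ j^1_x (f τ)` for `f(x) = 0`, of the kernel of `J^1 W → W`. -/
def IsImageOfHom (S : SmoothStr 𝕜 n W) (x : V)
    (α : TangentSpace 𝓘(𝕜, EuclideanSpace 𝕜 (Fin n)) x →ₗ[𝕜] W x) (v : Jet S 1 x) : Prop :=
  ∃ (m : ℕ) (f : Fin m → V → 𝕜) (τ : Fin m → ∀ y, W y),
    (∀ i, SmoothNear 𝕜 n x (f i) ∧ f i x = 0 ∧ τ i ∈ S.sec x) ∧
    (∀ X, α X = ∑ i, diff (f i) x X • τ i x) ∧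
    v = jet S 1 (fun y => ∑ i, f i y • τ i y) x

variable [IsManifold 𝓘(𝕜, EuclideanSpace 𝕜 (Fin n)) ∞ V]

variable (𝕜 n V) in
/-- The smooth vector fields. -/
def vectorFields :
    SmoothStr 𝕜 n (TangentSpace 𝓘(𝕜, EuclideanSpace 𝕜 (Fin n)) : V → Type _) :=
  bundleStr 𝕜 n (EuclideanSpace 𝕜 (Fin n)) (TangentSpace 𝓘(𝕜, EuclideanSpace 𝕜 (Fin n)))

/-- A (smooth, linear) connection, as a covariant derivative: `∇ σ x X` is `(∇_X σ)(x)`. Its values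
`∇ σ x` are arbitrary when `σ` is not smooth near `x`. -/
structure Connection (S : SmoothStr 𝕜 n W) where
  toFun : (∀ y, W y) → ∀ x : V, TangentSpace 𝓘(𝕜, EuclideanSpace 𝕜 (Fin n)) x →ₗ[𝕜] W x
  add : ∀ (x : V), ∀ σ ∈ S.sec x, ∀ τ ∈ S.sec x, toFun (σ + τ) x = toFun σ x + toFun τ x
  leibniz : ∀ (x : V) (f : V → 𝕜), SmoothNear 𝕜 n x f → ∀ σ ∈ S.sec x, ∀ X,
    toFun (fun y => f y • σ y) x X = f x • toFun σ x X + diff f x X • σ x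
  smooth : ∀ (x : V), ∀ σ ∈ S.sec x, ∀ X ∈ (vectorFields 𝕜 n V).sec x,
    (fun y => toFun σ y (X y)) ∈ S.sec x

/-- The curvature `K(X, Y) σ = ∇_X ∇_Y σ - ∇_Y ∇_X σ - ∇_[X, Y] σ` at `x`. -/
def Connection.curvature {S : SmoothStr 𝕜 n W} (nabla : Connection S)
    (X Y : ∀ y : V, TangentSpace 𝓘(𝕜, EuclideanSpace 𝕜 (Fin n)) y) (σ : ∀ y, W y) (x : V) : W x :=
  nabla.toFun (fun y => nabla.toFun σ y (Y y)) x (X x)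
    - nabla.toFun (fun y => nabla.toFun σ y (X y)) x (Y x)
    - nabla.toFun σ x (VectorField.mlieBracket 𝓘(𝕜, EuclideanSpace 𝕜 (Fin n)) X Y x)

/-- The curvature vanishes at the point `x`. -/
def Connection.CurvatureVanishesAt {S : SmoothStr 𝕜 n W} (nabla : Connection S) (x : V) : Prop :=
  ∀ X ∈ (vectorFields 𝕜 n V).sec x, ∀ Y ∈ (vectorFields 𝕜 n V).sec x, ∀ σ ∈ S.sec x,
    nabla.curvature X Y σ x = 0

/-- The connection attached to a linear splitting `u` of `J^1 W → W`:
`∇ σ = j^1 σ - u(σ)`, an element of the kernel `T^*V ⊗ W` of `J^1 W → W`. -/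
def Connection.IsInducedBy {S : SmoothStr 𝕜 n W} (nabla : Connection S)
    (u : ∀ x, W x →ₗ[𝕜] Jet S 1 x) : Prop :=
  ∀ (x : V), ∀ σ ∈ S.sec x, IsImageOfHom S x (nabla.toFun σ x) (jet S 1 σ x - u x (σ x))

end Connections

section Calibrated

/-- `c(n, h) = (n - 1 + h)! / ((n - 1)! h!)`, the number of multi-indices of order `h` in `n`
variables. -/
def c (n h : ℕ) : ℕ := (n - 1 + h).choose h

/-- `h₀`: the biggest `h ≥ k` such that `p c(n, h) ≥ q c(n, h - k)`. -/
def hZero (n k p q : ℕ) : ℕ := sSup {h | k ≤ h ∧ q * c n (h - k) ≤ p * c n h}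

/-- `π(n, k, p, q) = p c(n + 1, h₀) - q c(n + 1, h₀ - k)`, as an integer. -/
def rankBound (n k p q : ℕ) : ℤ :=
  (p : ℤ) * c (n + 1) (hZero n k p q) - (q : ℤ) * c (n + 1) (hZero n k p q - k)

variable {𝕜 : Type*} [RCLike 𝕜] {n : ℕ} {V : Type*} [TopologicalSpace V]
  [ChartedSpace (EuclideanSpace 𝕜 (Fin n)) V]
  {W : V → Type*} [∀ y, AddCommGroup (W y)] [∀ y, Module 𝕜 (W y)]
  {W' : V → Type*} [∀ y, AddCommGroup (W' y)] [∀ y, Module 𝕜 (W' y)]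
  {S : SmoothStr 𝕜 n W} {S' : SmoothStr 𝕜 n W'} {k : ℕ}

/-- `D` (between bundles of ranks `p` and `q`) is ordinary: all principal symbols `σ_h(D)`,
`h ≥ k`, have maximal rank at every point. -/
def DiffOp.IsOrdinary (D : DiffOp S S' k) (p q : ℕ) : Prop :=
  ∀ (h : ℕ) (hk : k ≤ h) (x : V),
    Module.finrank 𝕜 (LinearMap.range (D.symbol hk x)) = min (q * c n (h - k)) (p * c n h)

/-- `D` is calibrated: it is ordinary and `p c(n, h₀) = q c(n, h₀ - k)`. -/
def DiffOp.IsCalibrated (D : DiffOp S S' k) (p q : ℕ) : Prop :=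
  D.IsOrdinary p q ∧ p * c n (hZero n k p q) = q * c n (hZero n k p q - k)

/-- The smooth sections of `R_h ⊆ J^h W`. -/
def DiffOp.solStr (D : DiffOp S S' k) (h : ℕ) :
    SmoothStr 𝕜 n (fun y => D.formalSol h y) :=
  subStr (jetStr S h) (D.formalSol h)

/-- `u : R_h → J^1 (R_h)` is the tautological splitting `ι ∘ π⁻¹`, where
`π : R_(h+1) → R_h` is the projection and `ι : R_(h+1) → J^1 (R_h)` is the inclusion, i.e. `ι` is
induced by the inclusion of `J^(h+1) W` in `J^1 (J^h W)`. -/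
def DiffOp.IsTautologicalSplitting (D : DiffOp S S' k) (h : ℕ)
    (u : ∀ x, D.formalSol h x →ₗ[𝕜] Jet (D.solStr h) 1 x) : Prop :=
  ∀ (x : V), ∀ r ∈ D.formalSol (h + 1) x, ∀ e : D.formalSol h x,
    jetProj S (Nat.le_succ h) x r = e →
    jetIncl (jetStr S h) (D.formalSol h) 1 x (u x e) = jetJet S h x r

/-- The sections that are solutions of `D (j^k s) = 0` near `m`. -/
def DiffOp.solNear (D : DiffOp S S' k) (m : V) : Submodule 𝕜 (∀ y, W y) where
  carrier := {s | s ∈ S.sec m ∧ ∀ᶠ y in 𝓝 m, D.apply s y = 0}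
  add_mem' := by
    rintro s t ⟨hs, h1⟩ ⟨ht, h2⟩
    refine ⟨(S.sec m).add_mem hs ht, ?_⟩
    filter_upwards [h1, h2, S.eventually_mem hs, S.eventually_mem ht] with y h1 h2 h3 h4
    rw [D.apply_add h3 h4, h1, h2, add_zero]
  zero_mem' := ⟨(S.sec m).zero_mem, Eventually.of_forall fun y => by
    simpa using D.apply_smul (y := y) 0 (S.sec y).zero_mem⟩
  smul_mem' := by
    rintro a s ⟨hs, h1⟩
    refine ⟨(S.sec m).smul_mem a hs, ?_⟩
    filter_upwards [h1, S.eventually_mem hs] with y h1 h3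
    rw [D.apply_smul a h3, h1, smul_zero]

variable (𝕜 W) in
/-- The sections that vanish identically near `m`. -/
def germZero (m : V) : Submodule 𝕜 (∀ y, W y) where
  carrier := {s | ∀ᶠ y in 𝓝 m, s y = 0}
  add_mem' := by
    intro s t hs ht
    filter_upwards [hs, ht] with y h1 h2
    simp [h1, h2]
  zero_mem' := Eventually.of_forall fun _ => rfl
  smul_mem' := by
    intro a s hs
    filter_upwards [hs] with y h1
    simp [h1]

/-- The space `𝓢_m` of germs at `m` of solutions. -/
abbrev DiffOp.SolGerm (D : DiffOp S S' k) (m : V) : Type _ :=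
  D.solNear m ⧸ (germZero 𝕜 W m).comap (D.solNear m).subtype

end Calibrated

end JetPDE

end

noncomputable section

set_option linter.unusedSectionVars false

/-! Write `H = h₀ - 1`. Calibration makes the symbol of order `h₀` a bijection, so a formal solution
of order `H` determines its derivatives of order `h₀`: the equation becomes a total linear system of
first order for the `H`-jet, that is, a connection. The quotient `c n h / c n (h - k)` does not
increase with `h`, so the inequality that defines `h₀` holds in all orders from `k` to `h₀`, and
there an ordinary operator has surjective symbols. Correcting jets in their top degree then shows
that `D_h` is onto in these orders and that `R_(H+1) → R_H` is bijective
(`DiffOp.IsOrdinary.isRigid`). This gives the ranks, and the later arguments use the resulting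
package `DiffOp.IsRigid`. If `j^(H+1) s` is a formal solution at `x`, then `D (j^k s)` vanishes at
`x` to one order more than `R_H` requires. Hence `j^H s` satisfies the equations of `R_H` up to
order two at `x`, and its 1-jet is that of a section of `R_H` (`exists_adapted`,
`exists_jetIncl_eq`). This is the map `ι`; composed with `π₀⁻¹` it is the splitting `u`. If `∑ f_i
j^(H+1) s_i` lifts `σ`, then `∇_X σ = ∑ X(f_i) j^H s_i`, which shows that `∇` is smooth
(`covDeriv_smooth`). For (i), `σ` is flat at `x` when it agrees there to first order with `j^H t`,
where `j^(H+1) t` is the lift of `σ x`. Jets of solutions have this property. Conversely, induction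
on the order of jets shows that a flat section is `j^H` of its own values (`jet_eval_eq`), and these
values then solve the equation (`nabla_eq_zero_iff_jet_mem`). For (ii), a germ of a solution is sent
to its `H`-jet at `m`. This is injective because a flat section is determined by one value, and
surjective exactly when flat sections near `m` pass through all vectors at `m`, that is, when the
curvature vanishes near `m` (Frobenius). The Frobenius theorem is proved for both ground fields at
once (`exists_parallel`): the system is solved along rays, smoothness in the direction comes from
inverting `1 - volterra z A u` on the Banach space `C(unitInterval, Y)`, and flatness shows that the
radial solution solves the whole system. Jets are quotients by powers of the maximal ideal; they are
compared with Taylor coefficients by means of the Euler vector field (`mem_van_succ_iff`). -/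

namespace JetPDE

/-! ### Restriction to the rays from a point, with values in `C(unitInterval, Y)`. -/

section RayMap

variable {𝕜 : Type*} [RCLike 𝕜]

/-- Pointwise application of a family of operators to a family of vectors. -/
def mulC (𝕜 : Type*) [RCLike 𝕜] (Y Z : Type*) [NormedAddCommGroup Y] [NormedSpace 𝕜 Y]
    [NormedAddCommGroup Z] [NormedSpace 𝕜 Z] :
    C(unitInterval, Y →L[𝕜] Z) →L[𝕜] C(unitInterval, Y) →L[𝕜] C(unitInterval, Z) :=
  LinearMap.mkContinuous₂
    (LinearMap.mk₂ 𝕜 (fun (ψ : C(unitInterval, Y →L[𝕜] Z)) (φ : C(unitInterval, Y)) => (⟨fun s => ψ s (φ s), by fun_prop⟩ : C(unitInterval, Z)))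
      (fun ψ ψ' φ => by ext s; rfl) (fun c ψ φ => by ext s; rfl)
      (fun ψ φ φ' => by ext s; exact (ψ s).map_add _ _) (fun c ψ φ => by ext s; exact (ψ s).map_smul _ _)) 1
    (fun ψ φ => by
      rw [one_mul]
      refine (ContinuousMap.norm_le _ (by positivity)).2 fun s => ?_
      exact (ψ s).le_of_opNorm_le_of_le (ψ.norm_coe_le_norm s) (φ.norm_coe_le_norm s))

@[simp] theorem mulC_apply {Y Z : Type*} [NormedAddCommGroup Y] [NormedSpace 𝕜 Y]
    [NormedAddCommGroup Z] [NormedSpace 𝕜 Z] (ψ : C(unitInterval, Y →L[𝕜] Z))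
    (φ : C(unitInterval, Y)) (s : unitInterval) : mulC 𝕜 Y Z ψ φ s = ψ s (φ s) := rfl

/-- Application of a family of operators to a constant vector. -/
def evalC (𝕜 : Type*) [RCLike 𝕜] (Y Z : Type*) [NormedAddCommGroup Y] [NormedSpace 𝕜 Y]
    [NormedAddCommGroup Z] [NormedSpace 𝕜 Z] :
    C(unitInterval, Y →L[𝕜] Z) →L[𝕜] Y →L[𝕜] C(unitInterval, Z) :=
  LinearMap.mkContinuous₂
    (LinearMap.mk₂ 𝕜 (fun (ψ : C(unitInterval, Y →L[𝕜] Z)) (y : Y) => (⟨fun s => ψ s y, by fun_prop⟩ : C(unitInterval, Z)))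
      (fun ψ ψ' φ => by ext s; rfl) (fun c ψ φ => by ext s; rfl)
      (fun ψ φ φ' => by ext s; exact (ψ s).map_add _ _) (fun c ψ φ => by ext s; exact (ψ s).map_smul _ _)) 1
    (fun ψ y => by
      rw [one_mul]
      refine (ContinuousMap.norm_le _ (by positivity)).2 fun s => ?_
      exact (ψ s).le_of_opNorm_le_of_le (ψ.norm_coe_le_norm s) le_rfl)

@[simp] theorem evalC_apply {Y Z : Type*} [NormedAddCommGroup Y] [NormedSpace 𝕜 Y]
    [NormedAddCommGroup Z] [NormedSpace 𝕜 Z] (ψ : C(unitInterval, Y →L[𝕜] Z))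
    (y : Y) (s : unitInterval) : evalC 𝕜 Y Z ψ y s = ψ s y := rfl

/-- Multiplication by the parameter. -/
def scaleC (𝕜 : Type*) [RCLike 𝕜] (Y : Type*) [NormedAddCommGroup Y] [NormedSpace 𝕜 Y] :
    C(unitInterval, Y) →L[𝕜] C(unitInterval, Y) :=
  LinearMap.mkContinuous
    { toFun := fun φ => ⟨fun s => ((s : ℝ) : 𝕜) • φ s, by
        have : Continuous fun s : unitInterval => ((s : ℝ) : 𝕜) :=
          RCLike.continuous_ofReal.comp continuous_subtype_val
        fun_prop⟩
      map_add' := fun φ φ' => by ext s; exact smul_add _ _ _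
      map_smul' := fun c φ => by ext s; exact smul_comm _ _ _ } 1
    (fun φ => by
      rw [one_mul]
      refine (ContinuousMap.norm_le _ (by positivity)).2 fun s => ?_
      change ‖((s : ℝ) : 𝕜) • φ s‖ ≤ _
      rw [norm_smul, RCLike.norm_ofReal, abs_of_nonneg s.2.1]
      exact (mul_le_of_le_one_left (norm_nonneg _) s.2.2).trans (φ.norm_coe_le_norm s))

@[simp] theorem scaleC_apply {Y : Type*} [NormedAddCommGroup Y] [NormedSpace 𝕜 Y]
    (φ : C(unitInterval, Y)) (s : unitInterval) : scaleC 𝕜 Y φ s = ((s : ℝ) : 𝕜) • φ s := rfl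

open scoped Classical in
/-- The restriction of `g` to the segment from `z` to `z + u`. -/
def rayMap {X Y : Type*} [NormedAddCommGroup X] [NormedSpace 𝕜 X] [TopologicalSpace Y] [Zero Y]
    (z : X) (g : X → Y) (u : X) : C(unitInterval, Y) :=
  -- The value 0 is a dummy: directions in a ball on which `g` is continuous give the true
  -- restriction, by `rayMap_apply`.
  if h : Continuous fun s : unitInterval => g (z + ((s : ℝ) : 𝕜) • u) then ⟨_, h⟩ else 0

variable {X : Type*} [NormedAddCommGroup X] [NormedSpace 𝕜 X]

theorem ray_mem_ball {z u : X} {δ : ℝ} (hu : u ∈ Metric.ball (0 : X) δ) (s : unitInterval) :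
    z + ((s : ℝ) : 𝕜) • u ∈ Metric.ball z δ := by
  rw [mem_ball_iff_norm, add_sub_cancel_left, norm_smul, RCLike.norm_ofReal, abs_of_nonneg s.2.1]
  rw [mem_ball_zero_iff] at hu
  exact (mul_le_of_le_one_left (norm_nonneg _) s.2.2).trans_lt hu

theorem continuous_ray (z u : X) : Continuous fun s : unitInterval => z + ((s : ℝ) : 𝕜) • u := by
  have : Continuous fun s : unitInterval => ((s : ℝ) : 𝕜) :=
    RCLike.continuous_ofReal.comp continuous_subtype_val
  fun_prop

theorem rayMap_apply {Y : Type*} [TopologicalSpace Y] [Zero Y] {z : X} {g : X → Y} {δ : ℝ}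
    (hg : ContinuousOn g (Metric.ball z δ)) {u : X} (hu : u ∈ Metric.ball (0 : X) δ)
    (s : unitInterval) : rayMap (𝕜 := 𝕜) z g u s = g (z + ((s : ℝ) : 𝕜) • u) := by
  have h : Continuous fun s : unitInterval => g (z + ((s : ℝ) : 𝕜) • u) :=
    hg.comp_continuous (continuous_ray z u) fun s => ray_mem_ball hu s
  unfold rayMap
  rw [dif_pos h]
  rfl

/-- For a fixed parameter `s` this is the chain rule; the point is uniformity in `s`, since the
target carries the supremum norm. Near the compact segment the derivative of `g` is uniformly close
to its values on the segment, and the mean value inequality on small balls gives one `ε` for all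
`s`. -/
theorem hasFDerivAt_rayMap {Y : Type*} [NormedAddCommGroup Y] [NormedSpace 𝕜 Y] {z : X} {g : X → Y}
    {δ : ℝ} (hg : DifferentiableOn 𝕜 g (Metric.ball z δ))
    (hg' : ContinuousOn (fderiv 𝕜 g) (Metric.ball z δ)) {u : X} (hu : u ∈ Metric.ball (0 : X) δ) :
    HasFDerivAt (rayMap (𝕜 := 𝕜) z g)
      (evalC 𝕜 X Y (scaleC 𝕜 (X →L[𝕜] Y) (rayMap (𝕜 := 𝕜) z (fderiv 𝕜 g) u))) u := by
  let _ : NormedSpace ℝ X := NormedSpace.restrictScalars ℝ 𝕜 X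
  have hK : IsCompact (Set.range fun s : unitInterval => z + ((s : ℝ) : 𝕜) • u) :=
    isCompact_range (continuous_ray z u)
  rw [hasFDerivAt_iff_isLittleO_nhds_zero, Asymptotics.isLittleO_iff]
  intro ε hε
  have hu0 := mem_ball_zero_iff.1 hu
  have h1 := hK.uniformContinuousAt_of_continuousAt (fderiv 𝕜 g) (by
    rintro _ ⟨s, rfl⟩
    exact hg'.continuousAt (Metric.isOpen_ball.mem_nhds (ray_mem_ball hu s)))
    (Metric.dist_mem_uniformity hε)
  obtain ⟨η, hη, h2⟩ := Metric.mem_uniformity_dist.1 h1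
  -- The radius `η` keeps `fderiv 𝕜 g` within `ε` of its value at the centre; `δ - ‖u‖` keeps the
  -- balls about the points of the segment inside the domain.
  have hpos : 0 < min η (δ - ‖u‖) := lt_min hη (by linarith)
  filter_upwards [Metric.ball_mem_nhds (0 : X) hpos] with h hh
  rw [mem_ball_zero_iff, lt_min_iff] at hh
  have huh : u + h ∈ Metric.ball (0 : X) δ := by
    rw [mem_ball_zero_iff]
    linarith [norm_add_le u h]
  refine (ContinuousMap.norm_le _ (by positivity)).2 fun s => ?_
  simp only [ContinuousMap.sub_apply, evalC_apply, scaleC_apply]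
  rw [rayMap_apply hg.continuousOn huh, rayMap_apply hg.continuousOn hu, rayMap_apply hg' hu]
  have hsh : ‖((s : ℝ) : 𝕜) • h‖ ≤ ‖h‖ := by
    rw [norm_smul, RCLike.norm_ofReal, abs_of_nonneg s.2.1]
    exact mul_le_of_le_one_left (norm_nonneg _) s.2.2
  have hsu : ‖((s : ℝ) : 𝕜) • u‖ ≤ ‖u‖ := by
    rw [norm_smul, RCLike.norm_ofReal, abs_of_nonneg s.2.1]
    exact mul_le_of_le_one_left (norm_nonneg _) s.2.2
  have key := (convex_ball (z + ((s : ℝ) : 𝕜) • u)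
    (min η (δ - ‖u‖))).norm_image_sub_le_of_norm_hasFDerivWithin_le' (𝕜 := 𝕜) (f := g)
    (f' := fderiv 𝕜 g) (φ := fderiv 𝕜 g (z + ((s : ℝ) : 𝕜) • u)) (C := ε)
    (x := z + ((s : ℝ) : 𝕜) • u) (y := z + ((s : ℝ) : 𝕜) • (u + h)) ?_ ?_ ?_ ?_
  · rw [smul_add, ← add_assoc, add_sub_cancel_left] at key
    rw [smul_add, ← add_assoc, _root_.smul_apply, ← map_smul]
    exact key.trans (by gcongr)
  · intro x hx
    rw [mem_ball_iff_norm, lt_min_iff] at hx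
    refine ((hg.differentiableAt ?_).hasFDerivAt).hasFDerivWithinAt
    refine Metric.isOpen_ball.mem_nhds ?_
    rw [mem_ball_iff_norm]
    have e : x - z = (x - (z + ((s : ℝ) : 𝕜) • u)) + ((s : ℝ) : 𝕜) • u := by abel
    rw [e]
    linarith [norm_add_le (x - (z + ((s : ℝ) : 𝕜) • u)) (((s : ℝ) : 𝕜) • u)]
  · intro x hx
    rw [mem_ball_iff_norm, lt_min_iff] at hx
    have := @h2 (z + ((s : ℝ) : 𝕜) • u) x (by rw [dist_comm, dist_eq_norm]; exact hx.1) ⟨s, rfl⟩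
    change dist _ _ < ε at this
    rw [dist_comm, dist_eq_norm] at this
    exact this.le
  · exact Metric.mem_ball_self hpos
  · rw [mem_ball_iff_norm, smul_add, ← add_assoc, add_sub_cancel_left, lt_min_iff]
    exact ⟨hsh.trans_lt hh.1, hsh.trans_lt hh.2⟩

end RayMap

/-! ### Smoothness of the ray restriction in the direction of the ray. -/

section RayMapSmooth

universe u

variable {𝕜 : Type u} [RCLike 𝕜] {X : Type u} [NormedAddCommGroup X] [NormedSpace 𝕜 X]

/-- The derivative is the ray restriction of `fderiv 𝕜 g` followed by the continuous linear maps
`scaleC` and `evalC`, so the induction passes from `Y` to `X →L[𝕜] Y`; hence the single universe.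
One order is given up because `hasFDerivAt_rayMap`, which needs a continuous derivative, also serves
the base case. -/
theorem contDiffOn_rayMap_nat (m : ℕ) : ∀ {Y : Type u} [NormedAddCommGroup Y] [NormedSpace 𝕜 Y]
    {z : X} {g : X → Y} {δ : ℝ}, ContDiffOn 𝕜 (m + 1 : ℕ) g (Metric.ball z δ) →
    ContDiffOn 𝕜 m (rayMap (𝕜 := 𝕜) z g) (Metric.ball 0 δ) := by
  induction m with
  | zero =>
    intro Y _ _ z g δ hg
    have hg1 : ContDiffOn 𝕜 ((0 : ℕ) + 1) g (Metric.ball z δ) := by exact_mod_cast hg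
    obtain ⟨h1, -, h2⟩ := (contDiffOn_succ_iff_fderiv_of_isOpen Metric.isOpen_ball).1 hg1
    exact contDiffOn_zero.2 fun u hu =>
      (hasFDerivAt_rayMap h1 h2.continuousOn hu).continuousAt.continuousWithinAt
  | succ m ih =>
    intro Y _ _ z g δ hg
    have hg1 : ContDiffOn 𝕜 ((m + 1 : ℕ) + 1) g (Metric.ball z δ) := by exact_mod_cast hg
    obtain ⟨h1, -, h2⟩ := (contDiffOn_succ_iff_fderiv_of_isOpen Metric.isOpen_ball).1 hg1
    have h3 : ∀ u ∈ Metric.ball (0 : X) δ, HasFDerivAt (rayMap (𝕜 := 𝕜) z g)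
      (evalC 𝕜 X Y (scaleC 𝕜 (X →L[𝕜] Y) (rayMap (𝕜 := 𝕜) z (fderiv 𝕜 g) u))) u :=
      fun u hu => hasFDerivAt_rayMap h1 h2.continuousOn hu
    push_cast
    refine (contDiffOn_succ_iff_fderiv_of_isOpen Metric.isOpen_ball).2
      ⟨fun u hu => (h3 u hu).differentiableAt.differentiableWithinAt, by simp, ?_⟩
    refine ContDiffOn.congr ?_ fun u hu => (h3 u hu).fderiv
    have e1 : ContDiff 𝕜 m (fun φ => evalC 𝕜 X Y φ) := ContinuousLinearMap.contDiff _
    have e2 : ContDiff 𝕜 m (fun φ => scaleC 𝕜 (X →L[𝕜] Y) φ) := ContinuousLinearMap.contDiff _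
    exact e1.comp_contDiffOn (e2.comp_contDiffOn (ih h2))

theorem contDiffOn_rayMap {Y : Type u} [NormedAddCommGroup Y] [NormedSpace 𝕜 Y]
    {z : X} {g : X → Y} {δ : ℝ} (hg : ContDiffOn 𝕜 ∞ g (Metric.ball z δ)) :
    ContDiffOn 𝕜 ∞ (rayMap (𝕜 := 𝕜) z g) (Metric.ball 0 δ) :=
  contDiffOn_infty.2 fun m => contDiffOn_rayMap_nat m (hg.of_le (by exact_mod_cast le_top))

end RayMapSmooth

/-! ### The primitive as a bounded operator. -/

section Primitive

variable {𝕜 : Type*} [RCLike 𝕜] (Y : Type*) [NormedAddCommGroup Y] [NormedSpace 𝕜 Y]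
  [NormedSpace ℝ Y] [IsScalarTower ℝ 𝕜 Y]

theorem continuous_iccExtend {Y : Type*} [TopologicalSpace Y] (φ : C(unitInterval, Y)) :
    Continuous (Set.IccExtend zero_le_one φ : ℝ → Y) :=
  φ.continuous.Icc_extend'

/-- The primitive, vanishing at `0`, of a function on the unit interval. -/
def primC (𝕜 : Type*) [RCLike 𝕜] (Y : Type*) [NormedAddCommGroup Y] [NormedSpace 𝕜 Y]
    [NormedSpace ℝ Y] [IsScalarTower ℝ 𝕜 Y] [CompleteSpace Y] :
    C(unitInterval, Y) →L[𝕜] C(unitInterval, Y) :=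
  LinearMap.mkContinuous
    { toFun := fun φ => ⟨fun t => ∫ s in (0 : ℝ)..t, Set.IccExtend zero_le_one φ s,
        (intervalIntegral.continuous_primitive
          (fun a b => (continuous_iccExtend φ).intervalIntegrable a b) 0).comp
          continuous_subtype_val⟩
      map_add' := fun φ φ' => by
        ext t
        refine Eq.trans ?_ (intervalIntegral.integral_add
          ((continuous_iccExtend φ).intervalIntegrable _ _)
          ((continuous_iccExtend φ').intervalIntegrable _ _))
        rfl
      map_smul' := fun c φ => by
        ext t
        exact intervalIntegral.integral_smul c _ } 1
    (fun φ => by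
      rw [one_mul]
      refine (ContinuousMap.norm_le _ (by positivity)).2 fun t => ?_
      have := intervalIntegral.norm_integral_le_of_norm_le_const (a := 0) (b := (t : ℝ))
        (f := Set.IccExtend zero_le_one φ) (C := ‖φ‖) fun s _ => φ.norm_coe_le_norm _
      refine this.trans ?_
      rw [sub_zero, abs_of_nonneg t.2.1]
      exact mul_le_of_le_one_right (norm_nonneg _) t.2.2)

theorem primC_apply {Y : Type*} [NormedAddCommGroup Y] [NormedSpace 𝕜 Y]
    [NormedSpace ℝ Y] [IsScalarTower ℝ 𝕜 Y] [CompleteSpace Y] (φ : C(unitInterval, Y))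
    (t : unitInterval) :
    primC 𝕜 Y φ t = ∫ s in (0 : ℝ)..t, Set.IccExtend zero_le_one φ s := rfl

end Primitive

section

set_option synthInstance.maxHeartbeats 200000

/-! ### Linear equations along a ray: uniqueness. -/

section Rays

variable {𝕜 : Type*} [RCLike 𝕜] {X : Type*} [NormedAddCommGroup X] [NormedSpace 𝕜 X]
  {Y : Type*} [NormedAddCommGroup Y] [NormedSpace 𝕜 Y] [NormedSpace ℝ Y] [IsScalarTower ℝ 𝕜 Y]

/-- The parameter is real even over the complex numbers, so that interval integrals and Gronwall's
inequality are available over both fields. -/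
theorem hasDerivAt_ray {z u : X} {g : X → Y} {g' : X →L[𝕜] Y} {t : ℝ}
    (hg : HasFDerivAt g g' (z + (t : 𝕜) • u)) :
    HasDerivAt (fun t : ℝ => g (z + (t : 𝕜) • u)) (g' u) t := by
  have h1 : HasFDerivAt (fun c : 𝕜 => g (z + c • u))
      (g'.comp ((ContinuousLinearMap.id 𝕜 𝕜).smulRight u)) ((t : ℝ) : 𝕜) :=
    HasFDerivAt.comp (f := fun c : 𝕜 => z + c • u) _ hg
      (((hasFDerivAt_id _).smul_const u).const_add z)
  have h2 : HasDerivAt (fun t : ℝ => (t : 𝕜)) 1 t := by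
    simpa using (RCLike.ofRealCLM (K := 𝕜)).hasFDerivAt.hasDerivAt (x := t)
  have h3 := (h1.restrictScalars ℝ).comp_hasDerivAt t h2
  simpa [Function.comp_def] using h3

theorem norm_ofReal_smul_le {t : ℝ} (ht : t ∈ Set.Icc (0 : ℝ) 1) (u : X) :
    ‖(t : 𝕜) • u‖ ≤ ‖u‖ := by
  rw [norm_smul, RCLike.norm_ofReal, abs_of_nonneg ht.1]
  exact mul_le_of_le_one_left (norm_nonneg _) ht.2

theorem ofReal_smul_mem_ball {δ : ℝ} {u : X} (hu : u ∈ Metric.ball (0 : X) δ) {t : ℝ}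
    (ht : t ∈ Set.Icc (0 : ℝ) 1) : (t : 𝕜) • u ∈ Metric.ball (0 : X) δ := by
  rw [mem_ball_zero_iff] at *
  exact (norm_ofReal_smul_le ht u).trans_lt hu

theorem exists_ray_bound {Z : Type*} [NormedAddCommGroup Z] {A : X → Z} {z u : X} {δ : ℝ}
    (hA : ContinuousOn A (Metric.ball z δ)) (hu : u ∈ Metric.ball (0 : X) δ) :
    ∃ C : ℝ, ∀ s : unitInterval, ‖A (z + ((s : ℝ) : 𝕜) • u)‖ ≤ C := by
  have hc : Continuous fun s : unitInterval => ‖A (z + ((s : ℝ) : 𝕜) • u)‖ :=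
    continuous_norm.comp (hA.comp_continuous (continuous_ray (𝕜 := 𝕜) z _)
      fun s => ray_mem_ball hu s)
  obtain ⟨C, hC⟩ := (isCompact_range hc).bddAbove
  exact ⟨C, fun s => hC ⟨s, rfl⟩⟩

/-- A solution of `f' = A f` with `f(z) = 0` vanishes. -/
theorem eq_zero_of_fderiv_eq {Y : Type*} [NormedAddCommGroup Y] [NormedSpace 𝕜 Y] {z : X} {δ : ℝ} {A : X → X →L[𝕜] Y →L[𝕜] Y}
    (hA : ContDiffOn 𝕜 ∞ A (Metric.ball z δ)) {f : X → Y}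
    (hf : DifferentiableOn 𝕜 f (Metric.ball z δ))
    (hfA : ∀ x ∈ Metric.ball z δ, ∀ v, fderiv 𝕜 f x v = A x v (f x)) (h0 : f z = 0) :
    ∀ x ∈ Metric.ball z δ, f x = 0 := by
  intro x hx
  let _ : NormedSpace ℝ Y := NormedSpace.restrictScalars ℝ 𝕜 Y
  have _ : IsScalarTower ℝ 𝕜 Y := IsScalarTower.of_algebraMap_smul fun _ _ => rfl
  have hu : x - z ∈ Metric.ball (0 : X) δ := by
    rw [mem_ball_zero_iff]; exact mem_ball_iff_norm.1 hx
  obtain ⟨C, hC⟩ := exists_ray_bound (𝕜 := 𝕜) hA.continuousOn hu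
  have hd : ∀ t ∈ Set.Icc (0 : ℝ) 1, HasDerivAt (fun t : ℝ => f (z + (t : 𝕜) • (x - z)))
      (A (z + (t : 𝕜) • (x - z)) (x - z) (f (z + (t : 𝕜) • (x - z)))) t := by
    intro t ht
    have hm := ray_mem_ball (𝕜 := 𝕜) (z := z) hu ⟨t, ht⟩
    rw [← hfA _ hm]
    exact hasDerivAt_ray (hf.differentiableAt (Metric.isOpen_ball.mem_nhds hm)).hasFDerivAt
  -- Gronwall's inequality on the segment; `C * ‖x - z‖` bounds the coefficient of the equation that
  -- `f` satisfies there.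
  have := eq_zero_of_abs_deriv_le_mul_abs_self_of_eq_zero_right (a := 0) (b := 1)
    (K := C * ‖x - z‖) (fun t ht => (hd t ht).continuousAt.continuousWithinAt)
    (fun t ht => (hd t ⟨ht.1, ht.2.le⟩).hasDerivWithinAt) (by simpa using h0) (by
      intro t ht
      have h1 := hC ⟨t, ht.1, ht.2.le⟩
      dsimp only at h1
      refine (ContinuousLinearMap.le_opNorm _ _).trans ?_
      gcongr
      exact (ContinuousLinearMap.le_opNorm _ _).trans (by gcongr)) 1 ⟨zero_le_one, le_rfl⟩
  simpa using this

end Rays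

/-! ### Hadamard's lemma, radial solutions and the Frobenius theorem. -/

section Hadamard

universe u

variable {𝕜 : Type u} [RCLike 𝕜] {X : Type u} [NormedAddCommGroup X] [NormedSpace 𝕜 X]
  {Y : Type u} [NormedAddCommGroup Y] [NormedSpace 𝕜 Y] [NormedSpace ℝ Y] [IsScalarTower ℝ 𝕜 Y]
  [CompleteSpace Y]

/-- Hadamard's lemma. -/
theorem exists_hadamard {z : X} {δ : ℝ} {g : X → Y} (hg : ContDiffOn 𝕜 ∞ g (Metric.ball z δ)) :
    ∃ G : X → X →L[𝕜] Y, ContDiffOn 𝕜 ∞ G (Metric.ball z δ) ∧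
      ∀ x ∈ Metric.ball z δ, g x = g z + G x (x - z) := by
  obtain ⟨h1, h2⟩ := (contDiffOn_infty_iff_fderiv_of_isOpen Metric.isOpen_ball).1 hg
  have hsub : Set.MapsTo (fun x => x - z) (Metric.ball z δ) (Metric.ball (0 : X) δ) := by
    intro x hx
    rw [mem_ball_zero_iff]; exact mem_ball_iff_norm.1 hx
  -- `G x` is the integral over `[0, 1]` of the derivative of `g` along the segment from `z` to `x`;
  -- it is smooth in `x` because the ray restriction is.
  refine ⟨fun x => ((ContinuousMap.evalCLM 𝕜 (1 : unitInterval)).comp (primC 𝕜 Y)).comp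
    (evalC 𝕜 X Y (rayMap (𝕜 := 𝕜) z (fderiv 𝕜 g) (x - z))), ?_, ?_⟩
  · refine contDiffOn_const.clm_comp ?_
    have e1 : ContDiff 𝕜 ∞ (fun φ => evalC 𝕜 X Y φ) := ContinuousLinearMap.contDiff _
    exact e1.comp_contDiffOn ((contDiffOn_rayMap h2).comp
      (contDiff_id.sub contDiff_const).contDiffOn hsub)
  · intro x hx
    have hu := hsub hx
    change g x = g z + primC 𝕜 Y (evalC 𝕜 X Y (rayMap (𝕜 := 𝕜) z (fderiv 𝕜 g) (x - z))
      (x - z)) 1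
    rw [primC_apply]
    have := intervalIntegral.integral_eq_sub_of_hasDerivAt (a := 0) (b := 1)
      (f := fun t : ℝ => g (z + (t : 𝕜) • (x - z)))
      (f' := Set.IccExtend zero_le_one (evalC 𝕜 X Y (rayMap (𝕜 := 𝕜) z (fderiv 𝕜 g) (x - z))
        (x - z)))
      (fun t ht => ?_) ((continuous_iccExtend _).intervalIntegrable _ _)
    · rw [Set.Icc.coe_one, this]
      simp
    · rw [Set.uIcc_of_le zero_le_one] at ht
      rw [Set.IccExtend_of_mem _ _ ht, evalC_apply, rayMap_apply h2.continuousOn hu]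
      exact hasDerivAt_ray ((h1.differentiableAt (Metric.isOpen_ball.mem_nhds
        (ray_mem_ball hu ⟨t, ht⟩))).hasFDerivAt)

/-- The Volterra operator of the equation `f' = A f` along the ray in the direction `u`. -/
def volterra (z : X) (A : X → X →L[𝕜] Y →L[𝕜] Y) (u : X) :
    C(unitInterval, Y) →L[𝕜] C(unitInterval, Y) :=
  (primC 𝕜 Y).comp (mulC 𝕜 Y Y (evalC 𝕜 X (Y →L[𝕜] Y) (rayMap (𝕜 := 𝕜) z A u) u))

theorem contDiffOn_volterra {z : X} {δ : ℝ} {A : X → X →L[𝕜] Y →L[𝕜] Y}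
    (hA : ContDiffOn 𝕜 ∞ A (Metric.ball z δ)) :
    ContDiffOn 𝕜 ∞ (volterra z A) (Metric.ball 0 δ) := by
  refine contDiffOn_const.clm_comp ?_
  have e1 : ContDiff 𝕜 ∞ (fun φ => evalC 𝕜 X (Y →L[𝕜] Y) φ) := ContinuousLinearMap.contDiff _
  have e2 : ContDiff 𝕜 ∞ (fun φ => mulC 𝕜 Y Y φ) := ContinuousLinearMap.contDiff _
  exact e2.comp_contDiffOn ((e1.comp_contDiffOn (contDiffOn_rayMap hA)).clm_apply contDiffOn_id)

theorem volterra_apply {z : X} {δ : ℝ} {A : X → X →L[𝕜] Y →L[𝕜] Y}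
    (hA : ContinuousOn A (Metric.ball z δ)) {u : X} (hu : u ∈ Metric.ball (0 : X) δ)
    (φ : C(unitInterval, Y)) (t : unitInterval) :
    volterra z A u φ t = ∫ s in (0 : ℝ)..t, A (z + (s : 𝕜) • u) u
      (Set.IccExtend zero_le_one φ s) := by
  refine intervalIntegral.integral_congr fun s hs => ?_
  rw [Set.uIcc_of_le t.2.1] at hs
  have hs' : s ∈ Set.Icc (0 : ℝ) 1 := ⟨hs.1, hs.2.trans t.2.2⟩
  rw [Set.IccExtend_of_mem _ _ hs', Set.IccExtend_of_mem _ _ hs']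
  refine (mulC_apply _ _ _).trans ?_
  rw [evalC_apply, rayMap_apply hA hu]

/-- Contraction of the parameter by `t`. -/
def contract {Z : Type*} [TopologicalSpace Z] (t : unitInterval) (φ : C(unitInterval, Z)) :
    C(unitInterval, Z) :=
  φ.comp ⟨fun s => t * s, by fun_prop⟩

/-- The substitution `s ↦ t * s` in the integral. It makes the solution in the direction `t u` a
reparametrisation of the one in the direction `u`, so that the solutions along all rays form one
function of the endpoint. -/
theorem volterra_contract {z : X} {δ : ℝ} {A : X → X →L[𝕜] Y →L[𝕜] Y}
    (hA : ContinuousOn A (Metric.ball z δ)) {u : X} (hu : u ∈ Metric.ball (0 : X) δ)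
    (φ : C(unitInterval, Y)) (t : unitInterval) :
    volterra z A (((t : ℝ) : 𝕜) • u) (contract t φ) = contract t (volterra z A u φ) := by
  ext r
  change _ = volterra z A u φ (t * r)
  rw [volterra_apply hA hu, volterra_apply hA (ofReal_smul_mem_ball hu t.2)]
  have := intervalIntegral.smul_integral_comp_mul_left (a := 0) (b := (r : ℝ))
    (fun s : ℝ => A (z + (s : 𝕜) • u) u (Set.IccExtend zero_le_one φ s)) (t : ℝ)
  rw [mul_zero] at this
  change _ = ∫ s in (0 : ℝ)..((t : ℝ) * (r : ℝ)), _
  rw [← this, ← intervalIntegral.integral_smul]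
  refine intervalIntegral.integral_congr fun s hs => ?_
  rw [Set.uIcc_of_le r.2.1] at hs
  have hs' : s ∈ Set.Icc (0 : ℝ) 1 := ⟨hs.1, hs.2.trans r.2.2⟩
  have hts : (t : ℝ) * s ∈ Set.Icc (0 : ℝ) 1 := (t * ⟨s, hs'⟩ : unitInterval).2
  rw [Set.IccExtend_of_mem _ _ hs', Set.IccExtend_of_mem _ _ hts, smul_smul, map_smul,
    _root_.smul_apply, RCLike.ofReal_mul, mul_comm (s : 𝕜), RCLike.real_smul_eq_coe_smul (K := 𝕜)]
  rfl

/-- The equation `f' = A f` can be solved along all rays from `z` simultaneously. -/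
theorem exists_radial_solution {z : X} {δ : ℝ} (hδ : 0 < δ) {A : X → X →L[𝕜] Y →L[𝕜] Y}
    (hA : ContDiffOn 𝕜 ∞ A (Metric.ball z δ)) (y : Y) :
    ∃ ε > 0, ε ≤ δ ∧ ∃ f : X → Y, ContDiffOn 𝕜 ∞ f (Metric.ball z ε) ∧ f z = y ∧
      ∀ x ∈ Metric.ball z ε, fderiv 𝕜 f x (x - z) = A x (x - z) (f x) := by
  -- Along the ray in the direction `u` the equation reads `(1 - volterra z A u) φ = y`. The
  -- operator depends smoothly on `u` and `volterra z A 0 = 0`, so it is invertible for small `u`;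
  -- since inversion is smooth, so is the solution `F u`. The function sought is `x ↦ F (x - z) 1`.
  have hK := contDiffOn_volterra hA
  have hK0 : volterra z A 0 = 0 := by
    ext φ t
    rw [volterra_apply hA.continuousOn (Metric.mem_ball_self hδ)]
    simp
  have hcont : ContinuousAt (fun u => 1 - volterra z A u) 0 :=
    continuousAt_const.sub (hK.continuousOn.continuousAt (Metric.ball_mem_nhds _ hδ))
  have hev : ∀ᶠ u in 𝓝 (0 : X), IsUnit (1 - volterra z A u) := by
    have h1 : IsUnit (1 - volterra z A 0) := by
      rw [hK0, sub_zero]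
      exact isUnit_one
    have h2 : {T | IsUnit T} ∈ 𝓝 (1 - volterra z A 0) :=
      (Units.isOpen (R := C(unitInterval, Y) →L[𝕜] C(unitInterval, Y))).mem_nhds h1
    exact hcont.preimage_mem_nhds h2
  obtain ⟨η, hη, hunit⟩ := Metric.eventually_nhds_iff_ball.1 hev
  set ρ := min η δ with hρ
  have hρ0 : 0 < ρ := lt_min hη hδ
  have hKA := hA.continuousOn
  let F : X → C(unitInterval, Y) := fun u =>
    Ring.inverse (1 - volterra z A u) (ContinuousMap.const _ y)
  have hF : ContDiffOn 𝕜 ∞ F (Metric.ball 0 ρ) := by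
    refine ContDiffOn.clm_apply ?_ contDiffOn_const
    intro u hu
    obtain ⟨T, hT⟩ := hunit u (Metric.ball_subset_ball (min_le_left _ _) hu)
    have h1 := contDiffAt_ringInverse 𝕜 (n := ∞)
      (R := C(unitInterval, Y) →L[𝕜] C(unitInterval, Y)) T
    rw [hT] at h1
    exact h1.comp_contDiffWithinAt u (contDiffWithinAt_const.sub
      ((hK u (Metric.ball_subset_ball (min_le_right _ _) hu)).mono
        (Metric.ball_subset_ball (min_le_right _ _))))
  have hFeq : ∀ u ∈ Metric.ball (0 : X) ρ, (1 - volterra z A u) (F u) = ContinuousMap.const _ y := by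
    intro u hu
    have h1 := Ring.mul_inverse_cancel _ (hunit u (Metric.ball_subset_ball (min_le_left _ _) hu))
    exact DFunLike.congr_fun h1 _
  have hFuniq : ∀ u ∈ Metric.ball (0 : X) ρ, ∀ φ,
      (1 - volterra z A u) φ = ContinuousMap.const _ y → φ = F u := by
    intro u hu φ hφ
    have h1 := Ring.inverse_mul_cancel _ (hunit u (Metric.ball_subset_ball (min_le_left _ _) hu))
    have h2 := DFunLike.congr_fun h1 φ
    change φ = Ring.inverse (1 - volterra z A u) _
    rw [← hφ]
    exact h2.symm
  -- By uniqueness: `F u` contracted by `t` solves the equation in the direction `t u`.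
  have hscale : ∀ u ∈ Metric.ball (0 : X) ρ, ∀ t : unitInterval,
      F (((t : ℝ) : 𝕜) • u) 1 = F u t := by
    intro u hu t
    have h1 : contract t (F u) = F (((t : ℝ) : 𝕜) • u) := by
      refine hFuniq _ (ofReal_smul_mem_ball hu t.2) _ ?_
      have h2 := congrArg (contract t) (hFeq u hu)
      have h3 := volterra_contract hKA (Metric.ball_subset_ball (min_le_right _ _) hu) (F u) t
      change contract t (F u) - volterra z A _ _ = _
      rw [h3]
      exact h2
    rw [← h1]
    change F u (t * 1) = _
    rw [mul_one]
  have hderiv : ∀ u ∈ Metric.ball (0 : X) ρ, ∀ t : ℝ, t ∈ Set.Ioo (0 : ℝ) 1 →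
      HasDerivAt (fun t : ℝ => F ((t : 𝕜) • u) 1)
        (A (z + (t : 𝕜) • u) u (F ((t : 𝕜) • u) 1)) t := by
    intro u hu t ht
    have hu' := Metric.ball_subset_ball (min_le_right _ _) hu
    have ht' : t ∈ Set.Icc (0 : ℝ) 1 := ⟨ht.1.le, ht.2.le⟩
    set ψ : C(unitInterval, Y) :=
      mulC 𝕜 Y Y (evalC 𝕜 X (Y →L[𝕜] Y) (rayMap (𝕜 := 𝕜) z A u) u) (F u) with hψ
    have h1 : HasDerivAt (fun t : ℝ => y + ∫ s in (0 : ℝ)..t, Set.IccExtend zero_le_one ψ s)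
        (Set.IccExtend zero_le_one ψ t) t :=
      (intervalIntegral.integral_hasDerivAt_right
        ((continuous_iccExtend ψ).intervalIntegrable _ _)
        ((continuous_iccExtend ψ).stronglyMeasurableAtFilter _ _)
        (continuous_iccExtend ψ).continuousAt).const_add y
    have h0 : ψ ⟨t, ht'⟩ = A (z + (t : 𝕜) • u) u (F ((t : 𝕜) • u) 1) := by
      rw [hψ, mulC_apply, evalC_apply, rayMap_apply hKA hu', ← hscale u hu ⟨t, ht'⟩]
    rw [Set.IccExtend_of_mem _ _ ht', h0] at h1
    refine h1.congr_of_eventuallyEq ?_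
    filter_upwards [Ioo_mem_nhds ht.1 ht.2] with s hs
    have hs' : s ∈ Set.Icc (0 : ℝ) 1 := ⟨hs.1.le, hs.2.le⟩
    have h2 := DFunLike.congr_fun (hFeq u hu) ⟨s, hs'⟩
    have h3 : F u ⟨s, hs'⟩ - primC 𝕜 Y ψ ⟨s, hs'⟩ = y := h2
    rw [hscale u hu ⟨s, hs'⟩]
    rw [primC_apply] at h3
    rw [← h3]
    simp
  have hsub : Set.MapsTo (fun x => x - z) (Metric.ball z ρ) (Metric.ball (0 : X) ρ) := by
    intro x hx
    rw [mem_ball_zero_iff]; exact mem_ball_iff_norm.1 hx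
  have hf : ContDiffOn 𝕜 ∞ (fun x => F (x - z) 1) (Metric.ball z ρ) :=
    (ContinuousMap.evalCLM 𝕜 (M := Y) (1 : unitInterval)).contDiff.comp_contDiffOn
      (hF.comp (contDiff_id.sub contDiff_const).contDiffOn hsub)
  -- `hderiv` holds at interior parameters only. Hence the radius is halved, and `x` is reached at
  -- the time `1 / 2` in the direction `2 (x - z)`.
  refine ⟨ρ / 2, by positivity, (half_le_self hρ0.le).trans (min_le_right _ _),
    fun x => F (x - z) 1, hf.mono (Metric.ball_subset_ball (half_le_self hρ0.le)), ?_, ?_⟩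
  · have h2 := DFunLike.congr_fun (hFeq 0 (Metric.mem_ball_self hρ0)) 1
    rw [hK0, sub_zero] at h2
    change F (z - z) 1 = y
    rw [sub_self]
    exact h2
  · intro x hx
    have hu : (2 : 𝕜) • (x - z) ∈ Metric.ball (0 : X) ρ := by
      rw [mem_ball_zero_iff, norm_smul, RCLike.norm_ofNat]
      have := mem_ball_iff_norm.1 hx
      linarith
    have e : (((1 / 2 : ℝ) : ℝ) : 𝕜) • (2 : 𝕜) • (x - z) = x - z := by
      rw [smul_smul]
      have : (((1 / 2 : ℝ) : ℝ) : 𝕜) * 2 = 1 := by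
        rw [RCLike.ofReal_div, RCLike.ofReal_one, RCLike.ofReal_ofNat]
        norm_num
      rw [this, one_smul]
    have h1 := hderiv _ hu (1 / 2) (by norm_num)
    rw [e] at h1
    have hxb := Metric.ball_subset_ball (half_le_self hρ0.le) hx
    have h2 : HasDerivAt (fun t : ℝ => F (z + (t : 𝕜) • (2 : 𝕜) • (x - z) - z) 1)
        (fderiv 𝕜 (fun x => F (x - z) 1) x ((2 : 𝕜) • (x - z))) (1 / 2) := by
      refine hasDerivAt_ray (g := fun x => F (x - z) 1) ?_
      rw [e, add_sub_cancel]
      exact ((hf.contDiffAt (Metric.isOpen_ball.mem_nhds hxb)).differentiableAt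
        (by simp)).hasFDerivAt
    simp only [add_sub_cancel_left] at h2
    have h3 := h2.unique h1
    rw [add_sub_cancel, map_smul, map_smul, _root_.smul_apply] at h3
    exact smul_right_injective Y (two_ne_zero' 𝕜) h3

/-- The Frobenius theorem for linear equations: the equation `f' = A f` can be solved with
arbitrary initial values if the connection form `A` is flat. -/
theorem exists_parallel {z : X} {δ : ℝ} (hδ : 0 < δ) {A : X → X →L[𝕜] Y →L[𝕜] Y}
    (hA : ContDiffOn 𝕜 ∞ A (Metric.ball z δ))
    (hflat : ∀ x ∈ Metric.ball z δ, ∀ u v y,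
      fderiv 𝕜 A x u v y + A x v (A x u y) = fderiv 𝕜 A x v u y + A x u (A x v y)) (y : Y) :
    ∃ ε > 0, ∃ f : X → Y, ContDiffOn 𝕜 ∞ f (Metric.ball z ε) ∧ f z = y ∧
      ∀ x ∈ Metric.ball z ε, ∀ v, fderiv 𝕜 f x v = A x v (f x) := by
  obtain ⟨ε, hε, hεδ, f, hf, hfz, hrad⟩ := exists_radial_solution hδ hA y
  refine ⟨ε, hε, f, hf, hfz, ?_⟩
  have hAε := hA.mono (Metric.ball_subset_ball hεδ)
  obtain ⟨hf1, hf2⟩ := (contDiffOn_infty_iff_fderiv_of_isOpen Metric.isOpen_ball).1 hf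
  have hnhds : ∀ x ∈ Metric.ball z ε, Metric.ball z ε ∈ 𝓝 x :=
    fun x hx => Metric.isOpen_ball.mem_nhds hx
  have hAd : ∀ x ∈ Metric.ball z ε, HasFDerivAt A (fderiv 𝕜 A x) x := fun x hx =>
    ((hAε.contDiffAt (hnhds x hx)).differentiableAt (by simp)).hasFDerivAt
  have hfd : ∀ x ∈ Metric.ball z ε, HasFDerivAt f (fderiv 𝕜 f x) x := fun x hx =>
    (hf1.differentiableAt (hnhds x hx)).hasFDerivAt
  have hfdd : ∀ x ∈ Metric.ball z ε, HasFDerivAt (fderiv 𝕜 f) (fderiv 𝕜 (fderiv 𝕜 f) x) x :=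
    fun x hx => ((hf2.contDiffAt (hnhds x hx)).differentiableAt (by simp)).hasFDerivAt
  have hsymm : ∀ x ∈ Metric.ball z ε, ∀ u v,
      fderiv 𝕜 (fderiv 𝕜 f) x u v = fderiv 𝕜 (fderiv 𝕜 f) x v u := fun x hx u v =>
    ((hf.contDiffAt (hnhds x hx)).isSymmSndFDerivAt
      (by simpa using (WithTop.coe_le_coe.2 le_top : ((2 : ℕ∞) : WithTop ℕ∞) ≤ ∞))) u v
  -- The derivative of the radial equation in the direction `v`.
  have hderivRad : ∀ x ∈ Metric.ball z ε, ∀ v,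
      fderiv 𝕜 (fderiv 𝕜 f) x v (x - z) + fderiv 𝕜 f x v -
        ((fderiv 𝕜 A x v (x - z) + A x v) (f x) + A x (x - z) (fderiv 𝕜 f x v)) = 0 := by
    intro x hx v
    have hid : HasFDerivAt (fun x : X => x - z) (ContinuousLinearMap.id 𝕜 X) x :=
      (hasFDerivAt_id x).sub_const z
    have h1 := ((hfdd x hx).clm_apply hid).sub (((hAd x hx).clm_apply hid).clm_apply (hfd x hx))
    have h2 : (fun x => fderiv 𝕜 f x (x - z) - A x (x - z) (f x)) =ᶠ[𝓝 x] fun _ => (0 : Y) := by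
      filter_upwards [hnhds x hx] with y hy
      rw [hrad y hy, sub_self]
    have h3 := (h1.congr_of_eventuallyEq h2.symm).unique (hasFDerivAt_const (0 : Y) x)
    have h4 := DFunLike.congr_fun h3 v
    simp at h4
    rw [← h4]
    simp
    abel
  intro x hx v
  have hu : x - z ∈ Metric.ball (0 : X) ε := by
    rw [mem_ball_zero_iff]; exact mem_ball_iff_norm.1 hx
  set u := x - z with hudef
  obtain ⟨C, hC⟩ := exists_ray_bound (𝕜 := 𝕜) hAε.continuousOn hu
  -- Let `w = f' v - A v f` be the defect on the ray. Then `(t w)' = A u (t w)`, by the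
  -- differentiated radial equation, the symmetry of the second derivative and flatness. The factor
  -- `t` enters because the radial vector at `z + t u` is `t u`; it also provides the initial value
  -- 0, so that Gronwall's inequality gives `w = 0` at `t = 1`.
  have hd : ∀ t ∈ Set.Icc (0 : ℝ) 1, HasDerivAt
      (fun t : ℝ => (t : 𝕜) • (fderiv 𝕜 f (z + (t : 𝕜) • u) v
        - A (z + (t : 𝕜) • u) v (f (z + (t : 𝕜) • u))))
      (A (z + (t : 𝕜) • u) u ((t : 𝕜) • (fderiv 𝕜 f (z + (t : 𝕜) • u) v
        - A (z + (t : 𝕜) • u) v (f (z + (t : 𝕜) • u))))) t := by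
    intro t ht
    have hm := ray_mem_ball (𝕜 := 𝕜) (z := z) hu ⟨t, ht⟩
    dsimp only at hm
    have h1 := hderivRad _ hm v
    have h5 := hrad _ hm
    rw [add_sub_cancel_left] at h1 h5
    set y := z + (t : 𝕜) • u with hy
    have hw : HasFDerivAt (fun x => fderiv 𝕜 f x v - A x v (f x)) _ y :=
      ((hfdd y hm).clm_apply (hasFDerivAt_const v y)).sub
        (((hAd y hm).clm_apply (hasFDerivAt_const v y)).clm_apply (hfd y hm))
    have h2 := hasDerivAt_ray hw
    have h3 : HasDerivAt (fun t : ℝ => (t : 𝕜)) 1 t := by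
      simpa using (RCLike.ofRealCLM (K := 𝕜)).hasFDerivAt.hasDerivAt (x := t)
    have h4 : HasDerivAt (fun t : ℝ => (t : 𝕜) • (fderiv 𝕜 f (z + (t : 𝕜) • u) v
        - A (z + (t : 𝕜) • u) v (f (z + (t : 𝕜) • u)))) _ t := h3.smul h2
    refine h4.congr_deriv ?_
    have h6 := hflat y (Metric.ball_subset_ball hεδ hm) u v (f y)
    have h7 := hsymm y hm u v
    have h8 := congrArg (A y v) h5
    simp only [map_smul, _root_.smul_apply, one_smul, _root_.sub_apply,
      _root_.add_apply, ContinuousLinearMap.comp_apply,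
      ContinuousLinearMap.flip_apply, map_sub, map_zero, zero_add,
      _root_.zero_apply, ← hy] at h1 h8 ⊢
    rw [h7]
    linear_combination (norm := module) h1 - h8 - (t : 𝕜) • h6
  have := eq_zero_of_abs_deriv_le_mul_abs_self_of_eq_zero_right (a := 0) (b := 1)
    (K := C * ‖u‖) (fun t ht => (hd t ht).continuousAt.continuousWithinAt)
    (fun t ht => (hd t ⟨ht.1, ht.2.le⟩).hasDerivWithinAt) (by simp) (by
      intro t ht
      have h1 := hC ⟨t, ht.1, ht.2.le⟩
      dsimp only at h1
      refine (ContinuousLinearMap.le_opNorm _ _).trans ?_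
      gcongr
      exact (ContinuousLinearMap.le_opNorm _ _).trans (by gcongr)) 1 ⟨zero_le_one, le_rfl⟩
  rw [RCLike.ofReal_one, one_smul, one_smul, hudef, add_sub_cancel] at this
  exact sub_eq_zero.1 this

end Hadamard

end

/-! ### The ring of functions that are smooth near a point. -/

section SmoothNearAlgebra

variable {𝕜 : Type*} [RCLike 𝕜] {n : ℕ} {V : Type*} [TopologicalSpace V]
  [ChartedSpace (EuclideanSpace 𝕜 (Fin n)) V]

theorem SmoothNear.congr {x : V} {f g : V → 𝕜} (hf : SmoothNear 𝕜 n x f) (h : f =ᶠ[𝓝 x] g) :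
    SmoothNear 𝕜 n x g := by
  filter_upwards [hf, h.eventuallyEq_nhds] with y h1 h2
  exact h1.congr_of_eventuallyEq h2.symm

theorem SmoothNear.add {x : V} {f g : V → 𝕜} (hf : SmoothNear 𝕜 n x f)
    (hg : SmoothNear 𝕜 n x g) : SmoothNear 𝕜 n x (fun y => f y + g y) := by
  filter_upwards [hf, hg] with y h1 h2
  exact h1.add h2

variable (𝕜 n) in
/-- The ring of functions that are smooth near `x`. -/
def smoothNearAlg (x : V) : Subalgebra 𝕜 (V → 𝕜) where
  carrier := {f | SmoothNear 𝕜 n x f}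
  mul_mem' := SmoothNear.mul
  add_mem' := SmoothNear.add
  algebraMap_mem' := SmoothNear.const x

theorem mem_smoothNearAlg {x : V} {f : V → 𝕜} : f ∈ smoothNearAlg 𝕜 n x ↔ SmoothNear 𝕜 n x f :=
  Iff.rfl

theorem SmoothNear.sum {x : V} {ι : Type*} (s : Finset ι) {f : ι → V → 𝕜}
    (hf : ∀ i ∈ s, SmoothNear 𝕜 n x (f i)) : SmoothNear 𝕜 n x (fun y => ∑ i ∈ s, f i y) := by
  have := (smoothNearAlg 𝕜 n x).sum_mem (t := s) (f := f) hf
  rw [mem_smoothNearAlg] at this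
  convert this using 1
  funext y
  simp

theorem SmoothNear.neg {x : V} {f : V → 𝕜} (hf : SmoothNear 𝕜 n x f) :
    SmoothNear 𝕜 n x (fun y => - f y) :=
  (smoothNearAlg 𝕜 n x).neg_mem hf

theorem SmoothNear.inv {x : V} {f : V → 𝕜} (hf : SmoothNear 𝕜 n x f) (h0 : f x ≠ 0) :
    SmoothNear 𝕜 n x (fun y => (f y)⁻¹) := by
  have hc : ContinuousAt f x := hf.self_of_nhds.continuousAt
  filter_upwards [hf, hc.eventually_ne h0] with y h1 h2
  exact (contDiffAt_inv 𝕜 h2).contMDiffAt.comp y h1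

end SmoothNearAlgebra

/-! ### Coordinates and partial derivatives in a chart. -/

section Chart

variable {𝕜 : Type*} [RCLike 𝕜] {n : ℕ} {V : Type*} [TopologicalSpace V]
  [ChartedSpace (EuclideanSpace 𝕜 (Fin n)) V]

variable (𝕜 n) in
/-- The `i`-th coordinate in the chart at `m`. -/
def crd (m : V) (i : Fin n) (y : V) : 𝕜 := chartAt (EuclideanSpace 𝕜 (Fin n)) m y i

/-- The function `f` in the chart at `m`. -/
def loc (m : V) (f : V → 𝕜) : EuclideanSpace 𝕜 (Fin n) → 𝕜 :=
  f ∘ (chartAt (EuclideanSpace 𝕜 (Fin n)) m).symm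

variable (n) in
/-- The `i`-th partial derivative in the chart at `m`. -/
def pd (m : V) (i : Fin n) (f : V → 𝕜) (y : V) : 𝕜 :=
  fderiv 𝕜 (loc m f) (chartAt (EuclideanSpace 𝕜 (Fin n)) m y) (EuclideanSpace.single i 1)

theorem loc_eventuallyEq {m y : V} (hy : y ∈ (chartAt (EuclideanSpace 𝕜 (Fin n)) m).source)
    {f g : V → 𝕜} (h : f =ᶠ[𝓝 y] g) :
    loc m f =ᶠ[𝓝 (chartAt (EuclideanSpace 𝕜 (Fin n)) m y)] loc m g :=
  (OpenPartialHomeomorph.eventually_nhds' (chartAt (EuclideanSpace 𝕜 (Fin n)) m)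
    (fun z => f z = g z) hy).2 h

theorem pd_congr {m y : V} (hy : y ∈ (chartAt (EuclideanSpace 𝕜 (Fin n)) m).source) {i : Fin n}
    {f g : V → 𝕜} (h : f =ᶠ[𝓝 y] g) : pd n m i f y = pd n m i g y := by
  unfold pd
  rw [(loc_eventuallyEq hy h).fderiv_eq]

theorem eventually_source {m y : V} (hy : y ∈ (chartAt (EuclideanSpace 𝕜 (Fin n)) m).source) :
    ∀ᶠ z in 𝓝 y, z ∈ (chartAt (EuclideanSpace 𝕜 (Fin n)) m).source :=
  (chartAt (EuclideanSpace 𝕜 (Fin n)) m).open_source.mem_nhds hy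

theorem pd_eventuallyEq {m y : V} (hy : y ∈ (chartAt (EuclideanSpace 𝕜 (Fin n)) m).source)
    {i : Fin n} {f g : V → 𝕜} (h : f =ᶠ[𝓝 y] g) : pd n m i f =ᶠ[𝓝 y] pd n m i g := by
  filter_upwards [h.eventuallyEq_nhds, eventually_source hy] with z h1 h2
  exact pd_congr h2 h1

theorem pd_const {m y : V} {i : Fin n} (c : 𝕜) : pd n m i (fun _ => c) y = 0 := by
  have : loc (n := n) m (fun _ => c) = fun _ => c := rfl
  simp [pd, this]

variable [IsManifold 𝓘(𝕜, EuclideanSpace 𝕜 (Fin n)) ∞ V]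

theorem contMDiffAt_iff_loc {m y : V} (hy : y ∈ (chartAt (EuclideanSpace 𝕜 (Fin n)) m).source)
    {f : V → 𝕜} : ContMDiffAt 𝓘(𝕜, EuclideanSpace 𝕜 (Fin n)) 𝓘(𝕜) ∞ f y ↔
      ContDiffAt 𝕜 ∞ (loc m f) (chartAt (EuclideanSpace 𝕜 (Fin n)) m y) := by
  rw [contMDiffAt_iff_source_of_mem_source hy]
  simp [contMDiffAt_iff_contDiffAt, loc, contMDiffWithinAt_univ, extChartAt,
    OpenPartialHomeomorph.extend]

theorem smoothNear_iff_loc {m y : V} (hy : y ∈ (chartAt (EuclideanSpace 𝕜 (Fin n)) m).source)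
    {f : V → 𝕜} : SmoothNear 𝕜 n y f ↔
      ∀ᶠ z in 𝓝 (chartAt (EuclideanSpace 𝕜 (Fin n)) m y), ContDiffAt 𝕜 ∞ (loc m f) z := by
  rw [(chartAt (EuclideanSpace 𝕜 (Fin n)) m).eventually_nhds _ hy]
  refine eventually_congr ?_
  filter_upwards [eventually_source hy] with z hz
  exact contMDiffAt_iff_loc hz

/-- A function on the model space, read in the chart at `m`. -/
theorem smoothNear_comp_chart {m y : V}
    (hy : y ∈ (chartAt (EuclideanSpace 𝕜 (Fin n)) m).source) {g : EuclideanSpace 𝕜 (Fin n) → 𝕜}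
    (hg : ∀ᶠ z in 𝓝 (chartAt (EuclideanSpace 𝕜 (Fin n)) m y), ContDiffAt 𝕜 ∞ g z) :
    SmoothNear 𝕜 n y (fun z => g (chartAt (EuclideanSpace 𝕜 (Fin n)) m z)) := by
  have h1 := (chartAt (EuclideanSpace 𝕜 (Fin n)) m).open_target.mem_nhds
    ((chartAt (EuclideanSpace 𝕜 (Fin n)) m).map_source hy)
  rw [smoothNear_iff_loc hy]
  filter_upwards [hg, eventually_eventually_nhds.2 h1] with z h2 h3
  refine h2.congr_of_eventuallyEq ?_
  filter_upwards [h3] with w h4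
  change g _ = g _
  rw [(chartAt (EuclideanSpace 𝕜 (Fin n)) m).right_inv h4]

theorem loc_comp_chart (m y : V) (hy : y ∈ (chartAt (EuclideanSpace 𝕜 (Fin n)) m).source)
    (g : EuclideanSpace 𝕜 (Fin n) → 𝕜) :
    loc m (fun z => g (chartAt (EuclideanSpace 𝕜 (Fin n)) m z)) =ᶠ[𝓝
      (chartAt (EuclideanSpace 𝕜 (Fin n)) m y)] g := by
  have h1 := (chartAt (EuclideanSpace 𝕜 (Fin n)) m).open_target.mem_nhds
    ((chartAt (EuclideanSpace 𝕜 (Fin n)) m).map_source hy)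
  filter_upwards [h1] with w h4
  change g _ = g _
  rw [(chartAt (EuclideanSpace 𝕜 (Fin n)) m).right_inv h4]

theorem SmoothNear.differentiableAt_loc {m y : V}
    (hy : y ∈ (chartAt (EuclideanSpace 𝕜 (Fin n)) m).source) {f : V → 𝕜}
    (hf : SmoothNear 𝕜 n y f) :
    DifferentiableAt 𝕜 (loc m f) (chartAt (EuclideanSpace 𝕜 (Fin n)) m y) :=
  ((contMDiffAt_iff_loc hy).1 hf.self_of_nhds).differentiableAt (by simp)

theorem smoothNear_crd {m y : V} (hy : y ∈ (chartAt (EuclideanSpace 𝕜 (Fin n)) m).source)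
    (i : Fin n) : SmoothNear 𝕜 n y (crd 𝕜 n m i) :=
  smoothNear_comp_chart hy (g := fun z => z i) (Eventually.of_forall fun _ =>
    (EuclideanSpace.proj i : EuclideanSpace 𝕜 (Fin n) →L[𝕜] 𝕜).contDiff.contDiffAt)

theorem SmoothNear.pd {m y : V} (hy : y ∈ (chartAt (EuclideanSpace 𝕜 (Fin n)) m).source)
    {f : V → 𝕜} (hf : SmoothNear 𝕜 n y f) (i : Fin n) : SmoothNear 𝕜 n y (pd n m i f) := by
  refine smoothNear_comp_chart hy
    (g := fun z => fderiv 𝕜 (loc m f) z (EuclideanSpace.single i 1)) ?_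
  filter_upwards [(smoothNear_iff_loc hy).1 hf] with z hz
  exact (hz.fderiv_right (m := ∞) (by simp)).clm_apply contDiffAt_const

theorem pd_add {m y : V} (hy : y ∈ (chartAt (EuclideanSpace 𝕜 (Fin n)) m).source)
    {f g : V → 𝕜} (hf : SmoothNear 𝕜 n y f) (hg : SmoothNear 𝕜 n y g) (i : Fin n) :
    pd n m i (fun z => f z + g z) y = pd n m i f y + pd n m i g y := by
  have : loc (n := n) m (fun z => f z + g z) = loc m f + loc m g := rfl
  rw [JetPDE.pd, this, fderiv_add (hf.differentiableAt_loc hy) (hg.differentiableAt_loc hy)]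
  rfl

theorem pd_mul {m y : V} (hy : y ∈ (chartAt (EuclideanSpace 𝕜 (Fin n)) m).source)
    {f g : V → 𝕜} (hf : SmoothNear 𝕜 n y f) (hg : SmoothNear 𝕜 n y g) (i : Fin n) :
    pd n m i (fun z => f z * g z) y = f y * pd n m i g y + pd n m i f y * g y := by
  have : loc (n := n) m (fun z => f z * g z) = loc m f * loc m g := rfl
  rw [JetPDE.pd, this, fderiv_mul (hf.differentiableAt_loc hy) (hg.differentiableAt_loc hy)]
  have e : ∀ f : V → 𝕜, loc m f (chartAt (EuclideanSpace 𝕜 (Fin n)) m y) = f y := fun f => by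
    change f _ = f y
    rw [(chartAt (EuclideanSpace 𝕜 (Fin n)) m).left_inv hy]
  simp only [_root_.add_apply, _root_.smul_apply, e, smul_eq_mul, JetPDE.pd]
  ring

theorem pd_crd {m y : V} (hy : y ∈ (chartAt (EuclideanSpace 𝕜 (Fin n)) m).source)
    (i j : Fin n) : pd n m i (crd 𝕜 n m j) y = if i = j then 1 else 0 := by
  have := (loc_comp_chart m y hy 
    (fun z => (EuclideanSpace.proj j : EuclideanSpace 𝕜 (Fin n) →L[𝕜] 𝕜) z)).fderiv_eq (𝕜 := 𝕜)
  rw [ContinuousLinearMap.fderiv] at this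
  change fderiv 𝕜 (loc m (fun z => (EuclideanSpace.proj j : EuclideanSpace 𝕜 (Fin n) →L[𝕜] 𝕜)
    (chartAt (EuclideanSpace 𝕜 (Fin n)) m z))) _ _ = _
  rw [this]
  simp [eq_comm]

theorem pd_comm {m y : V} (hy : y ∈ (chartAt (EuclideanSpace 𝕜 (Fin n)) m).source)
    {f : V → 𝕜} (hf : SmoothNear 𝕜 n y f) (i j : Fin n) :
    pd n m i (pd n m j f) y = pd n m j (pd n m i f) y := by
  have h0 := (contMDiffAt_iff_loc hy).1 hf.self_of_nhds
  have h1 : DifferentiableAt 𝕜 (fderiv 𝕜 (loc m f)) (chartAt (EuclideanSpace 𝕜 (Fin n)) m y) :=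
    (h0.fderiv_right (m := ∞) (by simp)).differentiableAt (by simp)
  have key : ∀ i j, pd n m i (pd n m j f) y =
      fderiv 𝕜 (fderiv 𝕜 (loc m f)) (chartAt (EuclideanSpace 𝕜 (Fin n)) m y)
        (EuclideanSpace.single i 1) (EuclideanSpace.single j 1) := by
    intro i j
    have h2 := (loc_comp_chart m y hy
      (fun z => fderiv 𝕜 (loc m f) z (EuclideanSpace.single j 1))).fderiv_eq (𝕜 := 𝕜)
    change fderiv 𝕜 (loc m (fun z => fderiv 𝕜 (loc m f)
      (chartAt (EuclideanSpace 𝕜 (Fin n)) m z) (EuclideanSpace.single j 1))) _ _ = _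
    rw [h2, fderiv_clm_apply h1 (differentiableAt_const _)]
    simp
  rw [key, key]
  exact (h0.isSymmSndFDerivAt
    (by simpa using (WithTop.coe_le_coe.2 le_top : ((2 : ℕ∞) : WithTop ℕ∞) ≤ ∞))) _ _

end Chart

/-! ### Hadamard's lemma on the manifold. -/

section ChartHadamard

universe u

variable {𝕜 : Type u} [RCLike 𝕜] {n : ℕ} {V : Type*} [TopologicalSpace V]
  [ChartedSpace (EuclideanSpace 𝕜 (Fin n)) V] [IsManifold 𝓘(𝕜, EuclideanSpace 𝕜 (Fin n)) ∞ V]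

theorem SmoothNear.exists_ball {m y : V}
    (hy : y ∈ (chartAt (EuclideanSpace 𝕜 (Fin n)) m).source) {f : V → 𝕜}
    (hf : SmoothNear 𝕜 n y f) : ∃ δ > 0, ContDiffOn 𝕜 ∞ (loc m f)
      (Metric.ball (chartAt (EuclideanSpace 𝕜 (Fin n)) m y) δ) := by
  obtain ⟨δ, hδ, h⟩ := Metric.eventually_nhds_iff_ball.1 ((smoothNear_iff_loc hy).1 hf)
  exact ⟨δ, hδ, fun z hz => (h z hz).contDiffWithinAt⟩

/-- Consequently the centred coordinates generate the ideal of the point `y`, which is how it is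
used in `euler_sub_self_mem_van`. -/
theorem SmoothNear.hadamard {m y : V}
    (hy : y ∈ (chartAt (EuclideanSpace 𝕜 (Fin n)) m).source) {f : V → 𝕜}
    (hf : SmoothNear 𝕜 n y f) : ∃ g : Fin n → V → 𝕜, (∀ i, SmoothNear 𝕜 n y (g i)) ∧
      ∀ᶠ z in 𝓝 y, f z = f y + ∑ i, (crd 𝕜 n m i z - crd 𝕜 n m i y) * g i z := by
  obtain ⟨δ, hδ, h⟩ := hf.exists_ball hy
  obtain ⟨G, hG, hGf⟩ := exists_hadamard h
  have hb := Metric.ball_mem_nhds (chartAt (EuclideanSpace 𝕜 (Fin n)) m y) hδ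
  refine ⟨fun i z => G (chartAt (EuclideanSpace 𝕜 (Fin n)) m z) (EuclideanSpace.single i 1),
    fun i => ?_, ?_⟩
  · refine smoothNear_comp_chart hy (g := fun z => G z (EuclideanSpace.single i 1)) ?_
    filter_upwards [hb] with z hz
    exact (hG.contDiffAt (Metric.isOpen_ball.mem_nhds hz)).clm_apply contDiffAt_const
  · have h1 := (chartAt (EuclideanSpace 𝕜 (Fin n)) m).continuousAt hy hb
    filter_upwards [h1, eventually_source hy] with z hz hzs
    have h2 := hGf _ hz
    have e : ∀ y ∈ (chartAt (EuclideanSpace 𝕜 (Fin n)) m).source,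
        loc m f (chartAt (EuclideanSpace 𝕜 (Fin n)) m y) = f y := fun y hy => by
      change f _ = f y
      rw [(chartAt (EuclideanSpace 𝕜 (Fin n)) m).left_inv hy]
    rw [e z hzs, e y hy] at h2
    rw [h2]
    congr 1
    conv_lhs => rw [← (EuclideanSpace.basisFun (Fin n) 𝕜).sum_repr
      (chartAt (EuclideanSpace 𝕜 (Fin n)) m z - chartAt (EuclideanSpace 𝕜 (Fin n)) m y)]
    simp [crd]

end ChartHadamard

/-! ### Differentials and coordinate vector fields. -/

section Diff

variable {𝕜 : Type*} [RCLike 𝕜] {n : ℕ} {V : Type*} [TopologicalSpace V]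
  [ChartedSpace (EuclideanSpace 𝕜 (Fin n)) V] [IsManifold 𝓘(𝕜, EuclideanSpace 𝕜 (Fin n)) ∞ V]

theorem diff_eq_fderiv_loc {m y : V} (hy : y ∈ (chartAt (EuclideanSpace 𝕜 (Fin n)) m).source)
    {f : V → 𝕜} (hf : SmoothNear 𝕜 n y f)
    (X : TangentSpace 𝓘(𝕜, EuclideanSpace 𝕜 (Fin n)) y) :
    diff f y X = fderiv 𝕜 (loc m f) (chartAt (EuclideanSpace 𝕜 (Fin n)) m y)
      (mfderiv 𝓘(𝕜, EuclideanSpace 𝕜 (Fin n)) 𝓘(𝕜, EuclideanSpace 𝕜 (Fin n))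
        (extChartAt 𝓘(𝕜, EuclideanSpace 𝕜 (Fin n)) m) y X) := by
  have h1 : MDifferentiableAt 𝓘(𝕜, EuclideanSpace 𝕜 (Fin n)) 𝓘(𝕜, EuclideanSpace 𝕜 (Fin n))
    (extChartAt 𝓘(𝕜, EuclideanSpace 𝕜 (Fin n)) m) y := mdifferentiableAt_extChartAt hy
  have h2 : MDifferentiableAt 𝓘(𝕜, EuclideanSpace 𝕜 (Fin n)) 𝓘(𝕜) (loc m f)
      (extChartAt 𝓘(𝕜, EuclideanSpace 𝕜 (Fin n)) m y) :=
    (hf.differentiableAt_loc hy).mdifferentiableAt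
  have h3 : f =ᶠ[𝓝 y] loc m f ∘ (extChartAt 𝓘(𝕜, EuclideanSpace 𝕜 (Fin n)) m) := by
    filter_upwards [eventually_source hy] with z hz
    change f z = f _
    congr 1
    exact ((chartAt (EuclideanSpace 𝕜 (Fin n)) m).left_inv hz).symm
  unfold diff
  rw [h3.mfderiv_eq, mfderiv_comp y h2 h1, mfderiv_eq_fderiv]
  rfl

theorem diff_crd {m y : V} (hy : y ∈ (chartAt (EuclideanSpace 𝕜 (Fin n)) m).source)
    (i : Fin n) (X : TangentSpace 𝓘(𝕜, EuclideanSpace 𝕜 (Fin n)) y) :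
    diff (crd 𝕜 n m i) y X = (EuclideanSpace.proj i : EuclideanSpace 𝕜 (Fin n) →L[𝕜] 𝕜)
      (mfderiv 𝓘(𝕜, EuclideanSpace 𝕜 (Fin n)) 𝓘(𝕜, EuclideanSpace 𝕜 (Fin n))
        (extChartAt 𝓘(𝕜, EuclideanSpace 𝕜 (Fin n)) m) y X) := by
  rw [diff_eq_fderiv_loc hy (smoothNear_crd hy i)]
  have := (loc_comp_chart m y hy
    (fun z => (EuclideanSpace.proj i : EuclideanSpace 𝕜 (Fin n) →L[𝕜] 𝕜) z)).fderiv_eq (𝕜 := 𝕜)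
  rw [ContinuousLinearMap.fderiv] at this
  change fderiv 𝕜 (loc m (fun z => (EuclideanSpace.proj i : EuclideanSpace 𝕜 (Fin n) →L[𝕜] 𝕜)
    (chartAt (EuclideanSpace 𝕜 (Fin n)) m z))) _ _ = _
  rw [this]

theorem diff_eq_sum {m y : V} (hy : y ∈ (chartAt (EuclideanSpace 𝕜 (Fin n)) m).source)
    {f : V → 𝕜} (hf : SmoothNear 𝕜 n y f)
    (X : TangentSpace 𝓘(𝕜, EuclideanSpace 𝕜 (Fin n)) y) :
    diff f y X = ∑ i, diff (crd 𝕜 n m i) y X * pd n m i f y := by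
  simp only [diff_crd hy]
  rw [diff_eq_fderiv_loc hy hf]
  generalize mfderiv 𝓘(𝕜, EuclideanSpace 𝕜 (Fin n)) 𝓘(𝕜, EuclideanSpace 𝕜 (Fin n))
        (extChartAt 𝓘(𝕜, EuclideanSpace 𝕜 (Fin n)) m) y X = w
  change EuclideanSpace 𝕜 (Fin n) at w
  conv_lhs => rw [← (EuclideanSpace.basisFun (Fin n) 𝕜).sum_repr w]
  simp [pd]

theorem diff_congr {y : V} {f g : V → 𝕜} (h : f =ᶠ[𝓝 y] g) : diff (n := n) f y = diff g y := by
  unfold diff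
  rw [h.mfderiv_eq]

variable (𝕜 n) in
/-- The `i`-th coordinate vector field of the chart at `m`. -/
def coordField (m : V) (i : Fin n) : ∀ y : V, TangentSpace 𝓘(𝕜, EuclideanSpace 𝕜 (Fin n)) y :=
  (trivializationAt (EuclideanSpace 𝕜 (Fin n))
    (TangentSpace 𝓘(𝕜, EuclideanSpace 𝕜 (Fin n)) : V → Type _) m).localFrame
    (EuclideanSpace.basisFun (Fin n) 𝕜).toBasis i

theorem coordField_mem {m y : V} (hy : y ∈ (chartAt (EuclideanSpace 𝕜 (Fin n)) m).source)
    (i : Fin n) : coordField 𝕜 n m i ∈ (vectorFields 𝕜 n V).sec y := by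
  change ∀ᶠ z in 𝓝 y, ContMDiffAt _ _ _ _ z
  filter_upwards [eventually_source hy] with z hz
  exact contMDiffAt_localFrame_of_mem (I := 𝓘(𝕜, EuclideanSpace 𝕜 (Fin n))) (n := ∞) _ _ i hz

/-- The trivialization of the tangent bundle at `m` is the derivative of the chart at `m`, so the
frame that it induces from the standard basis is dual to the differentials of the coordinates. -/
theorem diff_crd_coordField {m y : V}
    (hy : y ∈ (chartAt (EuclideanSpace 𝕜 (Fin n)) m).source) (i j : Fin n) :
    diff (crd 𝕜 n m i) y (coordField 𝕜 n m j y) = if i = j then 1 else 0 := by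
  rw [diff_crd hy]
  set e := trivializationAt (EuclideanSpace 𝕜 (Fin n))
    (TangentSpace 𝓘(𝕜, EuclideanSpace 𝕜 (Fin n)) : V → Type _) m
  have hye : y ∈ e.baseSet := hy
  have h1 : coordField 𝕜 n m j y = e.symmL 𝕜 y (EuclideanSpace.single j 1) := by
    unfold coordField
    rw [Trivialization.localFrame_apply_of_mem_baseSet _ _ hye]
    rw [e.symmL_apply hye]
    simp [Trivialization.basisAt]
  have h2 := e.continuousLinearMapAt_symmL hye (R := 𝕜) (EuclideanSpace.single j 1)
  have h3 := TangentBundle.continuousLinearMapAt_trivializationAt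
    (I := 𝓘(𝕜, EuclideanSpace 𝕜 (Fin n))) hy
  rw [h1, ← h3]
  refine (congrArg (EuclideanSpace.proj i : EuclideanSpace 𝕜 (Fin n) →L[𝕜] 𝕜) h2).trans ?_
  simp

theorem diff_coordField {m y : V} (hy : y ∈ (chartAt (EuclideanSpace 𝕜 (Fin n)) m).source)
    {f : V → 𝕜} (hf : SmoothNear 𝕜 n y f) (j : Fin n) :
    diff f y (coordField 𝕜 n m j y) = pd n m j f y := by
  rw [diff_eq_sum hy hf]
  simp [diff_crd_coordField hy]

theorem smoothNear_diff_crd {m y : V} (hy : y ∈ (chartAt (EuclideanSpace 𝕜 (Fin n)) m).source)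
    (i : Fin n) {X : ∀ y : V, TangentSpace 𝓘(𝕜, EuclideanSpace 𝕜 (Fin n)) y}
    (hX : X ∈ (vectorFields 𝕜 n V).sec y) :
    SmoothNear 𝕜 n y (fun z => diff (crd 𝕜 n m i) z (X z)) := by
  change ∀ᶠ z in 𝓝 y, ContMDiffAt _ _ _ _ z at hX
  have hev := eventually_source hy
  filter_upwards [hX, hev, eventually_eventually_nhds.2 hev] with z hz hzs hzs'
  set e := trivializationAt (EuclideanSpace 𝕜 (Fin n))
    (TangentSpace 𝓘(𝕜, EuclideanSpace 𝕜 (Fin n)) : V → Type _) m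
  have h1 := (e.contMDiffAt_section_iff (show z ∈ e.baseSet from hzs)).1 hz
  have h2 := ((EuclideanSpace.proj i : EuclideanSpace 𝕜 (Fin n) →L[𝕜] 𝕜).contDiff.contMDiff
    (n := ∞)).contMDiffAt.comp z h1
  refine h2.congr_of_eventuallyEq ?_
  filter_upwards [hzs'] with w hw
  rw [diff_crd hw, ← TangentBundle.continuousLinearMapAt_trivializationAt hw]
  have h3 := e.continuousLinearMapAt_apply_of_mem 𝕜 (show w ∈ e.baseSet from hw) (X w)
  exact congrArg (EuclideanSpace.proj i : EuclideanSpace 𝕜 (Fin n) →L[𝕜] 𝕜) h3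

theorem SmoothNear.diff {y : V} {f : V → 𝕜} (hf : SmoothNear 𝕜 n y f)
    {X : ∀ y : V, TangentSpace 𝓘(𝕜, EuclideanSpace 𝕜 (Fin n)) y}
    (hX : X ∈ (vectorFields 𝕜 n V).sec y) : SmoothNear 𝕜 n y (fun z => diff f z (X z)) := by
  have hy := mem_chart_source (EuclideanSpace 𝕜 (Fin n)) y
  refine SmoothNear.congr (SmoothNear.sum Finset.univ fun i _ =>
    (smoothNear_diff_crd hy i hX).mul (hf.pd hy i)) ?_
  filter_upwards [hf.eventually, eventually_source hy] with z h1 h2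
  exact (diff_eq_sum h2 h1 _).symm

theorem diff_mul {y : V} {f g : V → 𝕜} (hf : SmoothNear 𝕜 n y f) (hg : SmoothNear 𝕜 n y g)
    (X : TangentSpace 𝓘(𝕜, EuclideanSpace 𝕜 (Fin n)) y) :
    JetPDE.diff (fun z => f z * g z) y X = f y * JetPDE.diff g y X + JetPDE.diff f y X * g y := by
  have hy := mem_chart_source (EuclideanSpace 𝕜 (Fin n)) y
  rw [diff_eq_sum hy (hf.mul hg), diff_eq_sum hy hf, diff_eq_sum hy hg, Finset.mul_sum,
    Finset.sum_mul, ← Finset.sum_add_distrib]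
  refine Finset.sum_congr rfl fun i _ => ?_
  rw [pd_mul hy hf hg]
  ring

theorem diff_add {y : V} {f g : V → 𝕜} (hf : SmoothNear 𝕜 n y f) (hg : SmoothNear 𝕜 n y g)
    (X : TangentSpace 𝓘(𝕜, EuclideanSpace 𝕜 (Fin n)) y) :
    JetPDE.diff (fun z => f z + g z) y X = JetPDE.diff f y X + JetPDE.diff g y X := by
  have hy := mem_chart_source (EuclideanSpace 𝕜 (Fin n)) y
  rw [diff_eq_sum hy (hf.add hg), diff_eq_sum hy hf, diff_eq_sum hy hg,
    ← Finset.sum_add_distrib]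
  refine Finset.sum_congr rfl fun i _ => ?_
  rw [pd_add hy hf hg]
  ring

theorem diff_const {y : V} (c : 𝕜) (X : TangentSpace 𝓘(𝕜, EuclideanSpace 𝕜 (Fin n)) y) :
    JetPDE.diff (fun _ : V => c) y X = 0 := by
  rw [diff_eq_sum (mem_chart_source (EuclideanSpace 𝕜 (Fin n)) y) (SmoothNear.const y c)]
  simp [pd_const]

end Diff

/-! ### Local frames and coframes of a sheaf of sections. -/

section Frames

variable {𝕜 : Type*} [RCLike 𝕜] {n : ℕ} {V : Type*} [TopologicalSpace V]
  [ChartedSpace (EuclideanSpace 𝕜 (Fin n)) V]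
  {W : V → Type*} [∀ y, AddCommGroup (W y)] [∀ y, Module 𝕜 (W y)]
  {W' : V → Type*} [∀ y, AddCommGroup (W' y)] [∀ y, Module 𝕜 (W' y)]

variable (𝕜 n V) in
/-- The smooth functions, as the sections of the trivial line bundle. -/
def fnStr : SmoothStr 𝕜 n (fun _ : V => 𝕜) where
  sec x := (smoothNearAlg 𝕜 n x).toSubmodule
  smul_mem hf hs := SmoothNear.mul hf hs
  eventually_mem hs := SmoothNear.eventually hs
  congr hs h := SmoothNear.congr hs h

theorem smul_mem_van_succ (S : SmoothStr 𝕜 n W) {j : ℕ} {x : V} {f : V → 𝕜} {s : ∀ y, W y}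
    (hf : SmoothNear 𝕜 n x f) (h0 : f x = 0) (hs : s ∈ van S j x) :
    (fun y => f y • s y) ∈ van S (j + 1) x :=
  Submodule.subset_span ⟨f, hf, h0, s, hs, rfl⟩

theorem eq_zero_of_mem_van_succ {S : SmoothStr 𝕜 n W} {j : ℕ} {x : V} {s : ∀ y, W y}
    (hs : s ∈ van S (j + 1) x) : s x = 0 := by
  refine Submodule.span_induction (p := fun (s : ∀ y, W y) _ => s x = 0) ?_ ?_ ?_ ?_ hs
  · rintro t ⟨f, -, hf0, s, -, rfl⟩
    simp [hf0]
  · rfl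
  · intro s t _ _ h1 h2
    simp [h1, h2]
  · intro c s _ h1
    simp [h1]

theorem map_mem_van {S : SmoothStr 𝕜 n W} {S' : SmoothStr 𝕜 n W'} {x : V}
    (L : ∀ y, W y →ₗ[𝕜] W' y) (hL : ∀ s ∈ S.sec x, (fun y => L y (s y)) ∈ S'.sec x) (j : ℕ) :
    ∀ s ∈ van S j x, (fun y => L y (s y)) ∈ van S' j x := by
  induction j with
  | zero => exact hL
  | succ j ih =>
    intro s hs
    refine Submodule.span_induction
      (p := fun (s : ∀ y, W y) _ => (fun y => L y (s y)) ∈ van S' (j + 1) x) ?_ ?_ ?_ ?_ hs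
    · rintro t ⟨f, hf, hf0, s, hs, rfl⟩
      refine van_congr S' (smul_mem_van_succ S' hf hf0 (ih s hs)) (Eventually.of_forall fun y => ?_)
      simp
    · exact mem_van_of_germ_zero S' _ (Eventually.of_forall fun y => by simp)
    · intro s t _ _ h1 h2
      exact van_congr S' (Submodule.add_mem _ h1 h2) (Eventually.of_forall fun y => by simp)
    · intro c s _ h1
      exact van_congr S' (Submodule.smul_mem _ c h1) (Eventually.of_forall fun y => by simp)

theorem mul_mem_van_add (S : SmoothStr 𝕜 n W) {a b : ℕ} {x : V} {f : V → 𝕜} {s : ∀ y, W y}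
    (hf : f ∈ van (fnStr 𝕜 n V) a x) (hs : s ∈ van S b x) :
    (fun y => f y • s y) ∈ van S (a + b) x := by
  induction a generalizing f with
  | zero =>
    rw [zero_add]
    exact smul_mem_van S hf hs
  | succ a ih =>
    rw [show a + 1 + b = a + b + 1 by omega]
    refine Submodule.span_induction
      (p := fun (f : V → 𝕜) _ => (fun y => f y • s y) ∈ van S (a + b + 1) x) ?_ ?_ ?_ ?_ hf
    · rintro t ⟨f, hf, hf0, g, hg, rfl⟩
      refine van_congr S (smul_mem_van_succ S hf hf0 (ih hg)) (Eventually.of_forall fun y => ?_)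
      simp [smul_smul]
    · exact mem_van_of_germ_zero S _ (Eventually.of_forall fun y => by simp)
    · intro s t _ _ h1 h2
      exact van_congr S (Submodule.add_mem _ h1 h2)
        (Eventually.of_forall fun y => by simp [add_smul])
    · intro c s _ h1
      exact van_congr S (Submodule.smul_mem _ c h1)
        (Eventually.of_forall fun y => by simp [smul_smul])

theorem mem_van_one_fn {x : V} {f : V → 𝕜} (hf : SmoothNear 𝕜 n x f) (h0 : f x = 0) :
    f ∈ van (fnStr 𝕜 n V) 1 x := by
  have := smul_mem_van_succ (fnStr 𝕜 n V) (j := 0) (s := fun _ => (1 : 𝕜)) hf h0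
    (SmoothNear.const x 1)
  simpa using this

theorem SmoothNear.det {ι : Type*} [Fintype ι] [DecidableEq ι] {N : ι → ι → V → 𝕜} {m : V}
    (hN : ∀ i j, SmoothNear 𝕜 n m (N i j)) :
    SmoothNear 𝕜 n m fun y => (Matrix.of fun i j => N i j y).det := by
  have : (∑ s : Equiv.Perm ι, Equiv.Perm.sign s • ∏ i, N (s i) i) ∈ smoothNearAlg 𝕜 n m :=
    Subalgebra.sum_mem _ fun s _ => by
      rw [Units.smul_def]
      exact zsmul_mem (Subalgebra.prod_mem _ fun i _ => hN _ _) _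
  refine SmoothNear.congr (n := n) this (Eventually.of_forall fun y => ?_)
  change _ = (Matrix.of fun i j => N i j y).det
  rw [Matrix.det_apply, Finset.sum_apply]
  refine Finset.sum_congr rfl fun s _ => ?_
  rw [Units.smul_def, Units.smul_def, Pi.smul_apply, Finset.prod_apply]
  rfl

/-- Cramer's rule: the determinant and the entries of the adjugate, themselves determinants with one
row replaced, are smooth, and one divides where the determinant is nonzero. -/
theorem exists_inverse_matrix {ι : Type*} [Fintype ι] [DecidableEq ι] {N : ι → ι → V → 𝕜} {m : V}
    (hN : ∀ i j, SmoothNear 𝕜 n m (N i j)) (hdet : (Matrix.of fun i j => N i j m).det ≠ 0) :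
    ∃ B : ι → ι → V → 𝕜, (∀ i j, SmoothNear 𝕜 n m (B i j)) ∧ ∀ᶠ y in 𝓝 m,
      (∀ i k, ∑ j, B i j y * N j k y = if i = k then 1 else 0) ∧
      ∀ i k, ∑ j, N i j y * B j k y = if i = k then 1 else 0 := by
  have h1 := SmoothNear.det hN
  have h2 : ∀ᶠ y in 𝓝 m, (Matrix.of fun i j => N i j y).det ≠ 0 :=
    (ContMDiffAt.continuousAt h1.self_of_nhds).eventually_ne hdet
  refine ⟨fun i j y => (Matrix.of fun i j => N i j y).det⁻¹ *
    (Matrix.of fun i j => N i j y).adjugate i j, fun i j => (h1.inv hdet).mul ?_, ?_⟩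
  · have := SmoothNear.det (n := n) (m := m)
      (N := fun a b => if a = j then (fun _ => if b = i then 1 else 0) else N a b) (by
        intro a b
        split_ifs
        · exact SmoothNear.const _ _
        · exact SmoothNear.const _ _
        · exact hN a b)
    refine SmoothNear.congr this (Eventually.of_forall fun y => ?_)
    change Matrix.det _ = (Matrix.of fun i j => N i j y).adjugate i j
    rw [Matrix.adjugate_apply]
    congr 1
    ext a b
    simp only [Matrix.of_apply, Matrix.updateRow_apply, Pi.single_apply]
    split_ifs <;> rfl
  · filter_upwards [h2] with y hy
    let M := Matrix.of fun i j => N i j y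
    constructor
    · intro i k
      have := congrFun (congrFun (Matrix.adjugate_mul M) i) k
      rw [Matrix.mul_apply, Matrix.smul_apply, Matrix.one_apply] at this
      change ∑ j, M.det⁻¹ * M.adjugate i j * M j k = _
      simp only [mul_assoc, ← Finset.mul_sum]
      rw [this]
      split_ifs
      · simpa using inv_mul_cancel₀ hy
      · simp
    · intro i k
      have := congrFun (congrFun (Matrix.mul_adjugate M) i) k
      rw [Matrix.mul_apply, Matrix.smul_apply, Matrix.one_apply] at this
      have e : ∑ j, M i j * (M.det⁻¹ * M.adjugate j k) =
          M.det⁻¹ * ∑ j, M i j * M.adjugate j k := by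
        rw [Finset.mul_sum]
        exact Finset.sum_congr rfl fun j _ => by ring
      refine e.trans ?_
      rw [this]
      split_ifs
      · simpa using inv_mul_cancel₀ hy
      · simp

/-- `e` is a frame, with dual coframe `lam`, for the sections of `S` near `m`. -/
structure IsFrame (S : SmoothStr 𝕜 n W) {ι : Type*} [Fintype ι] (e : ι → ∀ y, W y)
    (lam : ι → ∀ y, W y →ₗ[𝕜] 𝕜) (m : V) : Prop where
  mem : ∀ i, e i ∈ S.sec m
  dual : ∀ᶠ y in 𝓝 m, ∀ (c : ι → 𝕜) (i : ι), lam i y (∑ j, c j • e j y) = c i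
  repr : ∀ᶠ y in 𝓝 m, ∀ w : W y, ∑ i, lam i y w • e i y = w
  smooth : ∀ᶠ y in 𝓝 m, ∀ σ ∈ S.sec y, ∀ i, SmoothNear 𝕜 n y (fun z => lam i z (σ z))

namespace IsFrame

variable {S : SmoothStr 𝕜 n W} {ι : Type*} [Fintype ι] {e : ι → ∀ y, W y}
    {lam : ι → ∀ y, W y →ₗ[𝕜] 𝕜} {m : V}

theorem eventually (h : IsFrame S e lam m) : ∀ᶠ y in 𝓝 m, IsFrame S e lam y := by
  have h0 : ∀ᶠ y in 𝓝 m, ∀ i, e i ∈ S.sec y :=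
    eventually_all.2 fun i => S.eventually_mem (h.mem i)
  filter_upwards [h0, eventually_eventually_nhds.2 h.dual, eventually_eventually_nhds.2 h.repr,
    eventually_eventually_nhds.2 h.smooth] with y h1 h2 h3 h4
  exact ⟨h1, h2, h3, h4⟩

theorem coeff_smooth (h : IsFrame S e lam m) {σ : ∀ y, W y} (hσ : σ ∈ S.sec m) (i : ι) :
    SmoothNear 𝕜 n m (fun z => lam i z (σ z)) :=
  h.smooth.self_of_nhds σ hσ i

/-- The value of the frame at the base point, as a basis. -/
def basis (h : IsFrame S e lam m) : Module.Basis ι 𝕜 (W m) :=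
  Module.Basis.ofEquivFun
    { toFun := fun w i => lam i m w
      map_add' := fun v w => by funext i; simp
      map_smul' := fun c w => by funext i; simp
      invFun := fun c => ∑ i, c i • e i m
      left_inv := fun w => h.repr.self_of_nhds w
      right_inv := fun c => funext fun i => h.dual.self_of_nhds c i }

theorem basis_apply (h : IsFrame S e lam m) (i : ι) : h.basis i = e i m := by
  classical
  change ∑ j, (Pi.single i 1 : ι → 𝕜) j • e j m = e i m
  simp [Pi.single_apply]

theorem finiteDimensional (h : IsFrame S e lam m) : FiniteDimensional 𝕜 (W m) :=
  Module.Basis.finiteDimensional_of_finite h.basis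

theorem finrank_eq (h : IsFrame S e lam m) : Module.finrank 𝕜 (W m) = Fintype.card ι :=
  Module.finrank_eq_card_basis h.basis

theorem linearIndependent (h : IsFrame S e lam m) : LinearIndependent 𝕜 fun i => e i m := by
  have := h.basis.linearIndependent
  rwa [show (h.basis : ι → W m) = fun i => e i m from funext h.basis_apply] at this

theorem span_eq_top (h : IsFrame S e lam m) :
    Submodule.span 𝕜 (Set.range fun i => e i m) = ⊤ := by
  have := h.basis.span_eq
  rwa [show (h.basis : ι → W m) = fun i => e i m from funext h.basis_apply] at this

theorem combination_mem (h : IsFrame S e lam m) {f : ι → V → 𝕜}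
    (hf : ∀ i, SmoothNear 𝕜 n m (f i)) : (fun y => ∑ i, f i y • e i y) ∈ S.sec m := by
  have := (S.sec m).sum_mem (t := Finset.univ) (f := fun i y => f i y • e i y)
    fun i _ => S.smul_mem (hf i) (h.mem i)
  convert this using 1
  funext y
  simp

theorem exists_section (h : IsFrame S e lam m) (w : W m) : ∃ σ ∈ S.sec m, σ m = w :=
  ⟨_, h.combination_mem (f := fun i _ => lam i m w) fun _ => SmoothNear.const m _,
    h.repr.self_of_nhds w⟩

theorem combination_mem_van (h : IsFrame S e lam m) {f : ι → V → 𝕜} {j : ℕ}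
    (hf : ∀ i, f i ∈ van (fnStr 𝕜 n V) j m) : (fun y => ∑ i, f i y • e i y) ∈ van S j m := by
  have := (van S j m).sum_mem (t := Finset.univ) (f := fun i y => f i y • e i y)
    fun i _ => mul_mem_van_add S (b := 0) (hf i) (h.mem i)
  convert this using 1
  funext y
  simp

/-- Taking coefficients and forming combinations are linear over the functions, so both respect
powers of the maximal ideal. Orders of vanishing of sections thereby reduce to those of functions.
-/
theorem mem_van_iff (h : IsFrame S e lam m) {j : ℕ} {σ : ∀ y, W y} :
    σ ∈ van S j m ↔ ∀ i, (fun z => lam i z (σ z)) ∈ van (fnStr 𝕜 n V) j m := by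
  refine ⟨fun hσ i => ?_, fun hσ => ?_⟩
  · exact map_mem_van (S' := fnStr 𝕜 n V) (lam i)
      (fun s hs => h.smooth.self_of_nhds s hs i) j σ hσ
  · exact van_congr S (h.combination_mem_van hσ) (h.repr.mono fun y hy => hy (σ y))

theorem mem_van_one (h : IsFrame S e lam m) {σ : ∀ y, W y} (hσ : σ ∈ S.sec m) (h0 : σ m = 0) :
    σ ∈ van S 1 m :=
  h.mem_van_iff.2 fun i => mem_van_one_fn (h.coeff_smooth hσ i) (by simp [h0])

/-- The matrix `T i (e j)` is invertible near `m` with a smooth inverse, and this inverse applied to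
the functionals `T` is the coframe dual to `e`. That `e` spans follows because the `T i` separate
vectors. -/
theorem of_functionals {e : ι → ∀ y, W y} {T : ι → ∀ y, W y →ₗ[𝕜] 𝕜} [DecidableEq ι]
    (he : ∀ i, e i ∈ S.sec m)
    (hT : ∀ᶠ y in 𝓝 m, ∀ σ ∈ S.sec y, ∀ i, SmoothNear 𝕜 n y (fun z => T i z (σ z)))
    (inj : ∀ᶠ y in 𝓝 m, ∀ w : W y, (∀ i, T i y w = 0) → w = 0)
    (hdet : (Matrix.of fun i j => T i m (e j m)).det ≠ 0) : ∃ lam, IsFrame S e lam m := by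
  obtain ⟨B, hB, hinv⟩ := exists_inverse_matrix (N := fun i j y => T i y (e j y))
    (fun i j => hT.self_of_nhds _ (he j) i) hdet
  refine ⟨fun i y => ∑ j, B i j y • T j y, he, ?_, ?_, ?_⟩
  · filter_upwards [hinv] with y hy c i
    simp only [LinearMap.sum_apply, LinearMap.smul_apply, map_sum, map_smul, smul_eq_mul,
      Finset.mul_sum]
    simp [← Finset.mul_sum, hy.1]
  · filter_upwards [hinv, inj] with y hy hinj w
    rw [← sub_eq_zero]
    refine hinj _ fun k => ?_
    rw [map_sub, sub_eq_zero, map_sum]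
    simp only [LinearMap.sum_apply, LinearMap.smul_apply, map_smul, smul_eq_mul, Finset.sum_mul]
    rw [Finset.sum_comm]
    have : ∀ j, ∑ i, B i j y * T j y w * T k y (e i y) =
        T j y w * ∑ i, T k y (e i y) * B i j y := by
      intro j
      rw [Finset.mul_sum]
      exact Finset.sum_congr rfl fun i _ => by ring
    simp [this, hy.2]
  · filter_upwards [hT, eventually_all.2 fun i => eventually_all.2 fun j => (hB i j).eventually]
      with y h1 h2 σ hσ i
    have := SmoothNear.sum (n := n) (x := y) Finset.univ (f := fun j z =>
      B i j z * T j z (σ z)) fun j _ => (h2 i j).mul (h1 σ hσ j)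
    refine SmoothNear.congr this (Eventually.of_forall fun z => ?_)
    change _ = (∑ j, B i j z • T j z) (σ z)
    simp

/-- The coefficients in the old frame serve as the functionals of `of_functionals`; independence at
`m` is the nonvanishing of the determinant. -/
theorem of_basis (h : IsFrame S e lam m) {ι' : Type*} [Fintype ι'] {e' : ι' → ∀ y, W y}
    (he' : ∀ i, e' i ∈ S.sec m) (hli : LinearIndependent 𝕜 fun i => e' i m)
    (hcard : Fintype.card ι' = Fintype.card ι) : ∃ lam', IsFrame S e' lam' m := by
  classical
  let σ : ι' ≃ ι := Fintype.equivOfCardEq hcard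
  refine of_functionals (T := fun i => lam (σ i)) he' ?_ ?_ ?_
  · filter_upwards [h.smooth] with y hy s hs i
    exact hy s hs (σ i)
  · filter_upwards [h.repr] with y hy w hw
    rw [← hy w]
    exact Finset.sum_eq_zero fun i _ => by
      have := hw (σ.symm i)
      rw [σ.apply_symm_apply] at this
      rw [this, zero_smul]
  · intro h0
    obtain ⟨v, hv0, hv⟩ := Matrix.exists_mulVec_eq_zero_iff.2 h0
    refine hv0 ?_
    have h1 : ∑ j, v j • e' j m = 0 := by
      rw [← h.repr.self_of_nhds (∑ j, v j • e' j m)]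
      refine Finset.sum_eq_zero fun i _ => ?_
      have h2 := congrFun hv (σ.symm i)
      simp only [Matrix.mulVec, dotProduct, Matrix.of_apply, σ.apply_symm_apply,
        Pi.zero_apply] at h2
      have : lam i m (∑ j, v j • e' j m) = 0 := by
        rw [map_sum, ← h2]
        exact Finset.sum_congr rfl fun j _ => by simp [mul_comm]
      rw [this, zero_smul]
    funext j
    exact Fintype.linearIndependent_iff.1 hli v h1 j

end IsFrame

end Frames

/-! ### Order of vanishing of functions in terms of partial derivatives. -/

section Functions

variable {𝕜 : Type*} [RCLike 𝕜] {n : ℕ} {V : Type*} [TopologicalSpace V]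
  [ChartedSpace (EuclideanSpace 𝕜 (Fin n)) V]
  [IsManifold 𝓘(𝕜, EuclideanSpace 𝕜 (Fin n)) ∞ V] {m y : V}

theorem smoothNear_of_mem_van {j : ℕ} {f : V → 𝕜} (hf : f ∈ van (fnStr 𝕜 n V) j y) :
    SmoothNear 𝕜 n y f :=
  van_le_sec _ j y hf

theorem pd_mul_eventuallyEq (hy : y ∈ (chartAt (EuclideanSpace 𝕜 (Fin n)) m).source)
    {f g : V → 𝕜} (hf : SmoothNear 𝕜 n y f) (hg : SmoothNear 𝕜 n y g) (i : Fin n) :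
    pd n m i (fun z => f z * g z) =ᶠ[𝓝 y] fun z => f z * pd n m i g z + pd n m i f z * g z := by
  filter_upwards [eventually_source hy, hf.eventually, hg.eventually] with z h1 h2 h3
  exact pd_mul h1 h2 h3 i

theorem pd_add_eventuallyEq (hy : y ∈ (chartAt (EuclideanSpace 𝕜 (Fin n)) m).source)
    {f g : V → 𝕜} (hf : SmoothNear 𝕜 n y f) (hg : SmoothNear 𝕜 n y g) (i : Fin n) :
    pd n m i (fun z => f z + g z) =ᶠ[𝓝 y] fun z => pd n m i f z + pd n m i g z := by
  filter_upwards [eventually_source hy, hf.eventually, hg.eventually] with z h1 h2 h3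
  exact pd_add h1 h2 h3 i

theorem pd_const_mul (hy : y ∈ (chartAt (EuclideanSpace 𝕜 (Fin n)) m).source)
    {f : V → 𝕜} (hf : SmoothNear 𝕜 n y f) (c : 𝕜) (i : Fin n) :
    pd n m i (fun z => c * f z) y = c * pd n m i f y := by
  rw [pd_mul hy (SmoothNear.const y c) hf, pd_const, zero_mul, add_zero]

theorem pd_const_mul_eventuallyEq (hy : y ∈ (chartAt (EuclideanSpace 𝕜 (Fin n)) m).source)
    {f : V → 𝕜} (hf : SmoothNear 𝕜 n y f) (c : 𝕜) (i : Fin n) :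
    pd n m i (fun z => c * f z) =ᶠ[𝓝 y] fun z => c * pd n m i f z := by
  filter_upwards [eventually_source hy, hf.eventually] with z h1 h2
  exact pd_const_mul h1 h2 c i

theorem pd_mem_van (hy : y ∈ (chartAt (EuclideanSpace 𝕜 (Fin n)) m).source) (i : Fin n) {j : ℕ}
    {f : V → 𝕜} (hf : f ∈ van (fnStr 𝕜 n V) (j + 1) y) :
    pd n m i f ∈ van (fnStr 𝕜 n V) j y := by
  induction j generalizing f with
  | zero => exact (smoothNear_of_mem_van hf).pd hy i
  | succ j ih =>
    refine Submodule.span_induction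
      (p := fun f _ => pd n m i f ∈ van (fnStr 𝕜 n V) (j + 1) y) ?_ ?_ ?_ ?_ hf
    · rintro t ⟨f, hf, hf0, g, hg, rfl⟩
      have h1 : (fun z => f z * pd n m i g z) ∈ van (fnStr 𝕜 n V) (j + 1) y :=
        smul_mem_van_succ (fnStr 𝕜 n V) hf hf0 (ih hg)
      have h2 : (fun z => pd n m i f z * g z) ∈ van (fnStr 𝕜 n V) (j + 1) y :=
        smul_mem_van (fnStr 𝕜 n V) (hf.pd hy i) hg
      exact van_congr _ (Submodule.add_mem _ h1 h2)
        (pd_mul_eventuallyEq hy hf (smoothNear_of_mem_van hg) i).symm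
    · exact mem_van_of_germ_zero _ _ (Eventually.of_forall fun z => pd_const 0)
    · intro f g hf hg h1 h2
      exact van_congr _ (Submodule.add_mem _ h1 h2)
        (pd_add_eventuallyEq hy (smoothNear_of_mem_van (j := j + 2) hf)
          (smoothNear_of_mem_van (j := j + 2) hg) i).symm
    · intro c f hf h1
      exact van_congr _ (Submodule.smul_mem _ c h1)
        (pd_const_mul_eventuallyEq hy (smoothNear_of_mem_van (j := j + 2) hf) c i).symm

variable (n) in
/-- The Euler vector field of the chart at `m`, centred at `y`. -/
def euler (m y : V) (f : V → 𝕜) (z : V) : 𝕜 :=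
  ∑ i, (crd 𝕜 n m i z - crd 𝕜 n m i y) * pd n m i f z

theorem smoothNear_crd_sub (hy : y ∈ (chartAt (EuclideanSpace 𝕜 (Fin n)) m).source)
    (i : Fin n) : SmoothNear 𝕜 n y fun z => crd 𝕜 n m i z - crd 𝕜 n m i y :=
  (smoothNear_crd hy i).sub (SmoothNear.const y _)

theorem pd_crd_sub (hy : y ∈ (chartAt (EuclideanSpace 𝕜 (Fin n)) m).source) (a : 𝕜)
    (i j : Fin n) : pd n m i (fun z => crd 𝕜 n m j z - a) y = if i = j then 1 else 0 := by
  have := pd_add hy (smoothNear_crd hy j) (SmoothNear.const y (-a)) i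
  rw [pd_const, add_zero, pd_crd hy] at this
  simpa only [sub_eq_add_neg] using this

theorem euler_mem_van (hy : y ∈ (chartAt (EuclideanSpace 𝕜 (Fin n)) m).source) {j : ℕ}
    {f : V → 𝕜} (hf : ∀ i, pd n m i f ∈ van (fnStr 𝕜 n V) j y) :
    euler n m y f ∈ van (fnStr 𝕜 n V) (j + 1) y := by
  have := Submodule.sum_mem (van (fnStr 𝕜 n V) (j + 1) y) (t := Finset.univ)
    (f := fun i z => (crd 𝕜 n m i z - crd 𝕜 n m i y) * pd n m i f z) fun i _ =>
      smul_mem_van_succ (fnStr 𝕜 n V) (smoothNear_crd_sub hy i) (sub_self _) (hf i)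
  convert this using 1
  funext z
  simp [euler]

theorem euler_add (hy : y ∈ (chartAt (EuclideanSpace 𝕜 (Fin n)) m).source)
    {f g : V → 𝕜} (hf : SmoothNear 𝕜 n y f) (hg : SmoothNear 𝕜 n y g) :
    euler n m y (fun z => f z + g z) =ᶠ[𝓝 y] fun z => euler n m y f z + euler n m y g z := by
  filter_upwards [eventually_source hy, hf.eventually, hg.eventually] with z h1 h2 h3
  simp only [euler, ← Finset.sum_add_distrib, ← mul_add, pd_add h1 h2 h3]

theorem euler_mul (hy : y ∈ (chartAt (EuclideanSpace 𝕜 (Fin n)) m).source)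
    {f g : V → 𝕜} (hf : SmoothNear 𝕜 n y f) (hg : SmoothNear 𝕜 n y g) :
    euler n m y (fun z => f z * g z) =ᶠ[𝓝 y]
      fun z => f z * euler n m y g z + euler n m y f z * g z := by
  filter_upwards [eventually_source hy, hf.eventually, hg.eventually] with z h1 h2 h3
  simp only [euler, pd_mul h1 h2 h3, Finset.mul_sum, Finset.sum_mul, ← Finset.sum_add_distrib]
  exact Finset.sum_congr rfl fun i _ => by ring

theorem euler_crd_sub (hy : y ∈ (chartAt (EuclideanSpace 𝕜 (Fin n)) m).source) (j : Fin n) :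
    euler n m y (fun z => crd 𝕜 n m j z - crd 𝕜 n m j y) =ᶠ[𝓝 y]
      fun z => crd 𝕜 n m j z - crd 𝕜 n m j y := by
  filter_upwards [eventually_source hy] with z h1
  simp [euler, pd_crd_sub h1]

/-- The Euler field fixes the centred coordinates. Writing `f` by Hadamard's lemma as a combination
of these with coefficients `g i`, the Leibniz rule leaves the products of the coordinates with the
Euler derivatives of the `g i`, and the latter vanish at `y`. -/
theorem euler_sub_self_mem_van (hy : y ∈ (chartAt (EuclideanSpace 𝕜 (Fin n)) m).source)
    {f : V → 𝕜} (hf : SmoothNear 𝕜 n y f) (h0 : f y = 0) :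
    (fun z => euler n m y f z - f z) ∈ van (fnStr 𝕜 n V) 2 y := by
  obtain ⟨g, hg, hfg⟩ := hf.hadamard hy
  have key := Finset.sum_induction
    (f := fun i z => (crd 𝕜 n m i z - crd 𝕜 n m i y) * g i z) (s := Finset.univ)
    (p := fun f => SmoothNear 𝕜 n y f ∧
      (fun z => euler n m y f z - f z) ∈ van (fnStr 𝕜 n V) 2 y) ?_ ?_ ?_
  · refine van_congr _ key.2 ?_
    have e : f =ᶠ[𝓝 y] ∑ i, fun z => (crd 𝕜 n m i z - crd 𝕜 n m i y) * g i z := by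
      filter_upwards [hfg] with z hz
      rw [hz, h0, zero_add, Finset.sum_apply]
    filter_upwards [e, e.eventuallyEq_nhds, eventually_source hy] with z h1 h2 h3
    simp only [euler, h1, pd_congr h3 h2]
  · rintro f g ⟨hf, hf2⟩ ⟨hg, hg2⟩
    refine ⟨hf.add hg, van_congr _ (Submodule.add_mem _ hf2 hg2) ?_⟩
    filter_upwards [euler_add hy hf hg] with z hz
    change _ = euler n m y (fun z => f z + g z) z - _
    rw [hz]
    simp only [Pi.add_apply]
    ring
  · refine ⟨SmoothNear.const y 0, mem_van_of_germ_zero _ _ (Eventually.of_forall fun z => ?_)⟩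
    change euler n m y (fun _ => 0) z - 0 = 0
    simp [euler, pd_const]
  · intro i _
    refine ⟨(smoothNear_crd_sub hy i).mul (hg i), ?_⟩
    have : (fun z => (crd 𝕜 n m i z - crd 𝕜 n m i y) * euler n m y (g i) z) ∈
        van (fnStr 𝕜 n V) 2 y :=
      smul_mem_van_succ (fnStr 𝕜 n V) (smoothNear_crd_sub hy i) (sub_self _)
        (euler_mem_van hy (j := 0) fun l => (hg i).pd hy l)
    refine van_congr _ this ?_
    filter_upwards [euler_mul hy (smoothNear_crd_sub hy i) (hg i), euler_crd_sub hy i]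
      with z h1 h2
    rw [h1, h2]
    ring

/-- The Euler field multiplies each homogeneous part by its degree. By the Leibniz rule this passes
from factors to products. -/
theorem euler_sub_mem_van (hy : y ∈ (chartAt (EuclideanSpace 𝕜 (Fin n)) m).source) {j : ℕ}
    {f : V → 𝕜} (hf : f ∈ van (fnStr 𝕜 n V) j y) :
    (fun z => euler n m y f z - j * f z) ∈ van (fnStr 𝕜 n V) (j + 1) y := by
  induction j generalizing f with
  | zero =>
    refine van_congr _ (euler_mem_van hy (j := 0) fun i => SmoothNear.pd hy hf i) ?_
    exact Eventually.of_forall fun z => by simp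
  | succ j ih =>
    refine Submodule.span_induction (p := fun f _ =>
      (fun z => euler n m y f z - ((j + 1 : ℕ) : 𝕜) * f z) ∈ van (fnStr 𝕜 n V) (j + 1 + 1) y)
      ?_ ?_ ?_ ?_ hf
    · rintro t ⟨f, hf, hf0, g, hg, rfl⟩
      have h1 := smul_mem_van_succ (fnStr 𝕜 n V) hf hf0 (ih hg)
      have h2 := mul_mem_van_add (fnStr 𝕜 n V) (euler_sub_self_mem_van hy hf hf0) hg
      rw [show 2 + j = j + 1 + 1 by omega] at h2
      refine van_congr _ (Submodule.add_mem _ h1 h2) ?_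
      filter_upwards [euler_mul hy hf (smoothNear_of_mem_van hg)] with z h
      simp only [Pi.add_apply, smul_eq_mul, h]
      push_cast
      ring
    · refine mem_van_of_germ_zero _ _ (Eventually.of_forall fun z => ?_)
      change euler n m y (fun _ => 0) z - _ * 0 = 0
      simp [euler, pd_const]
    · intro f g hf hg h1 h2
      refine van_congr _ (Submodule.add_mem _ h1 h2) ?_
      filter_upwards [euler_add hy (smoothNear_of_mem_van (j := j + 1) hf)
        (smoothNear_of_mem_van (j := j + 1) hg)] with z h
      change _ = euler n m y (fun z => f z + g z) z - _ * (f z + g z)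
      rw [h]
      simp only [Pi.add_apply]
      ring
    · intro c f hf h1
      refine van_congr _ (Submodule.smul_mem _ c h1) ?_
      filter_upwards [euler_mul hy (SmoothNear.const y c)
        (smoothNear_of_mem_van (j := j + 1) hf)] with z h
      change _ = euler n m y (fun z => c * f z) z - _ * (c * f z)
      rw [h]
      have : euler n m y (fun _ => c) z = 0 := by simp [euler, pd_const]
      rw [this]
      simp only [Pi.smul_apply, smul_eq_mul]
      ring

/-- If `f` is already known to vanish to order `j`, then both `euler f` and `euler f - j f` vanish
to order `j + 1`; subtract and divide by `j`, which is possible in characteristic zero. -/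
theorem mem_van_succ_of_pd (hy : y ∈ (chartAt (EuclideanSpace 𝕜 (Fin n)) m).source) {j : ℕ}
    {f : V → 𝕜} (hf : SmoothNear 𝕜 n y f) (h0 : f y = 0)
    (h : ∀ i, pd n m i f ∈ van (fnStr 𝕜 n V) j y) : f ∈ van (fnStr 𝕜 n V) (j + 1) y := by
  induction j with
  | zero => exact mem_van_one_fn hf h0
  | succ j ih =>
    have h1 := ih fun i => van_succ_le _ _ _ (h i)
    have h2 := Submodule.sub_mem _ (euler_mem_van hy h) (euler_sub_mem_van hy h1)
    refine van_congr _ (Submodule.smul_mem _ ((j + 1 : ℕ) : 𝕜)⁻¹ h2) ?_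
    refine Eventually.of_forall fun z => ?_
    have : ((j + 1 : ℕ) : 𝕜) ≠ 0 := by exact_mod_cast Nat.succ_ne_zero j
    simp only [Pi.smul_apply, Pi.sub_apply, smul_eq_mul, sub_sub_cancel]
    rw [inv_mul_cancel_left₀ this]

variable (n) in
/-- The iterated partial derivative in the chart at `m` along a word of indices. -/
def pdw (m : V) : List (Fin n) → (V → 𝕜) → V → 𝕜
  | [], f => f
  | i :: w, f => pdw m w (pd n m i f)

theorem pdw_eventuallyEq (hy : y ∈ (chartAt (EuclideanSpace 𝕜 (Fin n)) m).source)
    (w : List (Fin n)) {f g : V → 𝕜} (h : f =ᶠ[𝓝 y] g) : pdw n m w f =ᶠ[𝓝 y] pdw n m w g := by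
  induction w generalizing f g with
  | nil => exact h
  | cons i w ih => exact ih (pd_eventuallyEq hy h)

theorem SmoothNear.pdw (hy : y ∈ (chartAt (EuclideanSpace 𝕜 (Fin n)) m).source)
    (w : List (Fin n)) {f : V → 𝕜} (h : SmoothNear 𝕜 n y f) : SmoothNear 𝕜 n y (pdw n m w f) := by
  induction w generalizing f with
  | nil => exact h
  | cons i w ih => exact ih (h.pd hy i)

theorem pdw_add (hy : y ∈ (chartAt (EuclideanSpace 𝕜 (Fin n)) m).source)
    (w : List (Fin n)) {f g : V → 𝕜} (hf : SmoothNear 𝕜 n y f) (hg : SmoothNear 𝕜 n y g) :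
    pdw n m w (fun z => f z + g z) =ᶠ[𝓝 y] fun z => pdw n m w f z + pdw n m w g z := by
  induction w generalizing f g with
  | nil => exact EventuallyEq.rfl
  | cons i w ih =>
    exact (pdw_eventuallyEq hy w (pd_add_eventuallyEq hy hf hg i)).trans
      (ih (hf.pd hy i) (hg.pd hy i))

theorem pdw_const_mul (hy : y ∈ (chartAt (EuclideanSpace 𝕜 (Fin n)) m).source)
    (w : List (Fin n)) {f : V → 𝕜} (hf : SmoothNear 𝕜 n y f) (c : 𝕜) :
    pdw n m w (fun z => c * f z) =ᶠ[𝓝 y] fun z => c * pdw n m w f z := by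
  induction w generalizing f with
  | nil => exact EventuallyEq.rfl
  | cons i w ih =>
    exact (pdw_eventuallyEq hy w (pd_const_mul_eventuallyEq hy hf c i)).trans
      (ih (hf.pd hy i))

theorem pdw_perm {w w' : List (Fin n)} (h : w.Perm w')
    (hy : y ∈ (chartAt (EuclideanSpace 𝕜 (Fin n)) m).source)
    {f : V → 𝕜} (hf : SmoothNear 𝕜 n y f) : pdw n m w f y = pdw n m w' f y := by
  induction h generalizing f with
  | nil => rfl
  | cons i _ ih => exact ih (hf.pd hy i)
  | swap i j w =>
    refine (pdw_eventuallyEq hy w ?_).self_of_nhds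
    filter_upwards [eventually_source hy, hf.eventually] with z h1 h2
    exact pd_comm h1 h2 i j
  | trans _ _ h1 h2 => exact (h1 hf).trans (h2 hf)

/-- The bridge between jets as quotients by powers of the maximal ideal and Taylor coefficients:
`pd_mem_van` in one direction, `mem_van_succ_of_pd` in the other. -/
theorem mem_van_succ_iff (hy : y ∈ (chartAt (EuclideanSpace 𝕜 (Fin n)) m).source) {j : ℕ}
    {f : V → 𝕜} (hf : SmoothNear 𝕜 n y f) : f ∈ van (fnStr 𝕜 n V) (j + 1) y ↔
      ∀ w : List (Fin n), w.length ≤ j → pdw n m w f y = 0 := by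
  induction j generalizing f with
  | zero =>
    refine ⟨fun h w hw => ?_, fun h => mem_van_one_fn hf (h [] le_rfl)⟩
    rw [List.length_eq_zero_iff.1 (Nat.le_zero.1 hw)]
    exact eq_zero_of_mem_van_succ h
  | succ j ih =>
    refine ⟨fun h w hw => ?_, fun h => mem_van_succ_of_pd hy hf (h [] (Nat.zero_le _)) fun i =>
      (ih (hf.pd hy i)).2 fun w hw => h (i :: w) (by simpa using hw)⟩
    cases w with
    | nil => exact eq_zero_of_mem_van_succ h
    | cons i w => exact (ih (hf.pd hy i)).1 (pd_mem_van hy i h) w (by simpa using hw)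

variable (𝕜 n) in
/-- The monomials in the coordinates centred at `m`. -/
def mono (m : V) (s : Multiset (Fin n)) (z : V) : 𝕜 :=
  (s.map fun i => crd 𝕜 n m i z - crd 𝕜 n m i m).prod

theorem smoothNear_mono (hy : y ∈ (chartAt (EuclideanSpace 𝕜 (Fin n)) m).source)
    (s : Multiset (Fin n)) : SmoothNear 𝕜 n y (mono 𝕜 n m s) := by
  induction s using Multiset.induction with
  | empty => exact (SmoothNear.const y 1).congr (Eventually.of_forall fun z => by simp [mono])
  | cons i s ih =>
    refine (((smoothNear_crd hy i).sub (SmoothNear.const y (crd 𝕜 n m i m))).mul ih).congr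
      (Eventually.of_forall fun z => by simp [mono])

theorem pd_mono (hy : y ∈ (chartAt (EuclideanSpace 𝕜 (Fin n)) m).source) (j : Fin n)
    (s : Multiset (Fin n)) :
    pd n m j (mono 𝕜 n m s) y = s.count j * mono 𝕜 n m (s.erase j) y := by
  induction s using Multiset.induction with
  | empty =>
    have : mono 𝕜 n m 0 = fun _ => 1 := by funext z; simp [mono]
    rw [this, pd_const]
    simp
  | cons i s ih =>
    have e : ∀ i s, mono 𝕜 n m (i ::ₘ s) = fun z =>
        (crd 𝕜 n m i z - crd 𝕜 n m i m) * mono 𝕜 n m s z := by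
      intro i s; funext z; simp [mono]
    rw [e, pd_mul hy ((smoothNear_crd hy i).sub (SmoothNear.const y _)) (smoothNear_mono hy s),
      ih, pd_crd_sub hy]
    by_cases hij : j = i
    · subst hij
      rw [Multiset.erase_cons_head, Multiset.count_cons_self, if_pos rfl]
      by_cases hj : j ∈ s
      · conv_rhs => rw [← Multiset.cons_erase hj, e]
        rw [Multiset.count_cons_self, Multiset.count_erase_self]
        have := Multiset.one_le_count_iff_mem.2 hj
        conv_lhs => rw [← Multiset.cons_erase hj, e]
        rw [Multiset.count_cons_self, Multiset.count_erase_self, Multiset.erase_cons_head]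
        push_cast [Nat.sub_add_cancel this]
        ring
      · simp [Multiset.count_eq_zero_of_notMem hj]
    · rw [Multiset.erase_cons_tail _ (Ne.symm hij), Multiset.count_cons_of_ne hij, if_neg hij, e]
      ring

/-- Differentiating a centred monomial removes one letter up to a positive factor, and at `m` only
the constant monomial survives. Hence the Taylor coefficients of monomials form a diagonal matrix
without zeros on the diagonal. -/
theorem pdw_mono (w : List (Fin n)) (s : Multiset (Fin n)) :
    pdw n m w (mono 𝕜 n m s) m ≠ 0 ↔ s = w := by
  have hm := mem_chart_source (EuclideanSpace 𝕜 (Fin n)) m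
  induction w generalizing s with
  | nil =>
    induction s using Multiset.induction with
    | empty => simp [pdw, mono]
    | cons i s _ => simp [pdw, mono]
  | cons i w ih =>
    have h1 : pdw n m (i :: w) (mono 𝕜 n m s) m =
        s.count i * pdw n m w (mono 𝕜 n m (s.erase i)) m := by
      refine ((pdw_eventuallyEq hm w ?_).trans
        (pdw_const_mul hm w (smoothNear_mono hm (s.erase i)) (s.count i : 𝕜))).self_of_nhds
      filter_upwards [eventually_source hm] with z hz
      exact pd_mono hz i s
    rw [h1, mul_ne_zero_iff, Nat.cast_ne_zero, Multiset.count_ne_zero]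
    refine (and_congr_right' (ih (s.erase i))).trans ?_
    constructor
    · rintro ⟨h2, h3⟩
      rw [← Multiset.cons_erase h2, h3]
      rfl
    · rintro rfl
      exact ⟨by simp, by simp⟩

end Functions

/-! ### Jets of sections, Taylor functionals and frames of jet bundles. -/

section JetFrame

/-- The multiset of the entries different from `none`. -/
def symPart {α : Type*} {h : ℕ} (a : Sym (Option α) h) : Multiset α :=
  Multiset.filterMap id (a : Multiset (Option α))

theorem multiset_eq_map_some_add {α : Type*} [DecidableEq α] (s : Multiset (Option α)) :
    s = (s.filterMap id).map some + Multiset.replicate (s.count none) none := by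
  induction s using Multiset.induction with
  | empty => simp
  | cons a s ih =>
    cases a with
    | none =>
      rw [Multiset.filterMap_cons_none _ _ rfl, Multiset.count_cons_self,
        Multiset.replicate_succ, Multiset.add_cons, ← ih]
    | some a =>
      rw [Multiset.filterMap_cons_some id _ _ (b := a) rfl,
        Multiset.count_cons_of_ne (by simp), Multiset.map_cons, Multiset.cons_add, ← ih]

/-- The number of entries `none` is forced, since the total is `h`. By this homogenisation `Sym
(Option α) h` indexes the monomials of degree at most `h`, and counting it gives `c (n + 1) h` at
once. -/
theorem symPart_injective {α : Type*} {h : ℕ} :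
    Function.Injective (symPart (α := α) (h := h)) := by
  classical
  intro a b hab
  have ha := multiset_eq_map_some_add (a : Multiset (Option α))
  have hb := multiset_eq_map_some_add (b : Multiset (Option α))
  have hab' : Multiset.filterMap id (a : Multiset (Option α)) =
      Multiset.filterMap id (b : Multiset (Option α)) := hab
  have hca := congrArg Multiset.card ha
  have hcb := congrArg Multiset.card hb
  rw [Multiset.card_add, Multiset.card_map, Multiset.card_replicate] at hca hcb
  have e1 : Multiset.card (a : Multiset (Option α)) = h := a.2
  have e2 : Multiset.card (b : Multiset (Option α)) = h := b.2
  rw [e1, hab'] at hca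
  rw [e2] at hcb
  have : Multiset.count none (a : Multiset (Option α)) =
      Multiset.count none (b : Multiset (Option α)) := by omega
  refine Subtype.ext ?_
  change (a : Multiset (Option α)) = b
  rw [ha, hb, hab', this]

theorem exists_symPart_eq {α : Type*} {h : ℕ} (s : Multiset α) (hs : Multiset.card s ≤ h) :
    ∃ a : Sym (Option α) h, symPart a = s := by
  refine ⟨⟨s.map some + Multiset.replicate (h - Multiset.card s) none, by simp [hs]⟩, ?_⟩
  change Multiset.filterMap id (_ + _) = s
  rw [Multiset.filterMap_add, Multiset.filterMap_map]
  have : Multiset.filterMap (id : Option α → Option α)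
      (Multiset.replicate (h - Multiset.card s) none) = 0 := by
    generalize h - Multiset.card s = l
    induction l with
    | zero => simp
    | succ l ih => rw [Multiset.replicate_succ, Multiset.filterMap_cons_none _ _ rfl, ih]
  rw [this, add_zero]
  exact Multiset.filterMap_some s

theorem card_symPart_le {α : Type*} {h : ℕ} (a : Sym (Option α) h) :
    Multiset.card (symPart a) ≤ h := by
  classical
  have h1 := congrArg Multiset.card (multiset_eq_map_some_add (a : Multiset (Option α)))
  rw [Multiset.card_add, Multiset.card_map] at h1
  have h2 : Multiset.card (a : Multiset (Option α)) = h := a.2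
  change Multiset.card (Multiset.filterMap id (a : Multiset (Option α))) ≤ h
  omega

variable {𝕜 : Type*} [RCLike 𝕜] {n : ℕ} {V : Type*} [TopologicalSpace V]
  [ChartedSpace (EuclideanSpace 𝕜 (Fin n)) V]
  {W : V → Type*} [∀ y, AddCommGroup (W y)] [∀ y, Module 𝕜 (W y)]
  {S : SmoothStr 𝕜 n W}

theorem exists_jet_eq {h : ℕ} {y : V} (w : Jet S h y) : ∃ s ∈ S.sec y, jet S h s y = w := by
  obtain ⟨s, hs⟩ := jetMk_surjective S h y w
  exact ⟨s, s.2, by rw [jet_of_mem s.2, ← hs]⟩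

theorem jet_eq_zero_iff {h : ℕ} {y : V} {s : ∀ y, W y} (hs : s ∈ S.sec y) :
    jet S h s y = 0 ↔ s ∈ van S (h + 1) y := by
  rw [jet_of_mem hs, jetMk_eq_zero]

theorem jet_add {h : ℕ} {y : V} {s t : ∀ y, W y} (hs : s ∈ S.sec y) (ht : t ∈ S.sec y) :
    jet S h (s + t) y = jet S h s y + jet S h t y := by
  rw [jet_of_mem hs, jet_of_mem ht, jet_of_mem (Submodule.add_mem _ hs ht), ← map_add]
  rfl

theorem jet_sub {h : ℕ} {y : V} {s t : ∀ y, W y} (hs : s ∈ S.sec y) (ht : t ∈ S.sec y) :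
    jet S h (s - t) y = jet S h s y - jet S h t y := by
  rw [jet_of_mem hs, jet_of_mem ht, jet_of_mem (Submodule.sub_mem _ hs ht), ← map_sub]
  rfl

theorem jet_smul {h : ℕ} {y : V} {s : ∀ y, W y} (c : 𝕜) (hs : s ∈ S.sec y) :
    jet S h (c • s) y = c • jet S h s y := by
  rw [jet_of_mem hs, jet_of_mem (Submodule.smul_mem _ c hs), ← map_smul]
  rfl

theorem jet_eq_iff {h : ℕ} {y : V} {s t : ∀ y, W y} (hs : s ∈ S.sec y) (ht : t ∈ S.sec y) :
    jet S h s y = jet S h t y ↔ s - t ∈ van S (h + 1) y := by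
  rw [← sub_eq_zero, ← jet_sub hs ht, jet_eq_zero_iff (Submodule.sub_mem _ hs ht)]

theorem jet_congr {h : ℕ} {y : V} {s t : ∀ y, W y} (hs : s ∈ S.sec y)
    (hst : ∀ᶠ z in 𝓝 y, s z = t z) : jet S h s y = jet S h t y := by
  refine (jet_eq_iff hs (S.congr hs hst)).2 (mem_van_of_germ_zero S _ ?_)
  exact hst.mono fun z hz => by simp [hz]

theorem jet_mem_sec {h : ℕ} {y : V} {s : ∀ y, W y} (hs : s ∈ S.sec y) :
    jet S h s ∈ (jetStr S h).sec y :=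
  (jetOp S h).smooth y s hs

theorem jetProj_jet {l h : ℕ} (hl : l ≤ h) {y : V} {s : ∀ y, W y} (hs : s ∈ S.sec y) :
    jetProj S hl y (jet S h s y) = jet S l s y := by
  rw [jet_of_mem hs, jet_of_mem hs]
  rfl

theorem jetProj_surjective {l h : ℕ} (hl : l ≤ h) (y : V) :
    Function.Surjective (jetProj S hl y) := by
  intro w
  obtain ⟨s, hs, rfl⟩ := exists_jet_eq w
  exact ⟨_, jetProj_jet hl hs⟩

/-- Induction for the smooth sections of a jet bundle. -/
theorem jetStr_induction {h : ℕ} {y : V} {p : (∀ z, Jet S h z) → Prop}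
    (congr : ∀ σ τ : ∀ z, Jet S h z, (∀ᶠ z in 𝓝 y, σ z = τ z) → p σ → p τ)
    (jet : ∀ f s, SmoothNear 𝕜 n y f → s ∈ S.sec y → p fun z => f z • jet S h s z)
    (zero : p 0) (add : ∀ σ τ : ∀ z, Jet S h z, σ ∈ (jetStr S h).sec y →
      τ ∈ (jetStr S h).sec y → p σ → p τ → p (σ + τ))
    (smul : ∀ (c : 𝕜) (σ : ∀ z, Jet S h z), σ ∈ (jetStr S h).sec y → p σ → p (c • σ))
    {σ : ∀ z, Jet S h z} (hσ : σ ∈ (jetStr S h).sec y) : p σ := by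
  obtain ⟨τ, hτ, h'⟩ := hσ
  refine congr _ _ h' ?_
  have hsec : ∀ τ ∈ Submodule.span 𝕜 {t : ∀ z, Jet S h z | ∃ f : V → 𝕜, SmoothNear 𝕜 n y f ∧
      ∃ s ∈ S.sec y, t = fun z => f z • JetPDE.jet S h s z}, τ ∈ (jetStr S h).sec y :=
    fun τ hτ => ⟨τ, hτ, Eventually.of_forall fun _ => rfl⟩
  refine Submodule.span_induction (p := fun τ _ => p τ) ?_ zero ?_ ?_ hτ
  · rintro t ⟨f, hf, s, hs, rfl⟩
    exact jet f s hf hs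
  · exact fun σ τ h1 h2 => add σ τ (hsec σ h1) (hsec τ h2)
  · exact fun c σ h1 => smul c σ (hsec σ h1)

/-- A family of linear maps on a jet bundle is smooth if it is so on the jets of sections. -/
theorem jetStr_map_mem {W' : V → Type*} [∀ y, AddCommGroup (W' y)] [∀ y, Module 𝕜 (W' y)]
    {S' : SmoothStr 𝕜 n W'} {h : ℕ} {y : V} (L : ∀ z, Jet S h z →ₗ[𝕜] W' z)
    (hL : ∀ s ∈ S.sec y, (fun z => L z (jet S h s z)) ∈ S'.sec y) {σ : ∀ z, Jet S h z}
    (hσ : σ ∈ (jetStr S h).sec y) : (fun z => L z (σ z)) ∈ S'.sec y := by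
  refine jetStr_induction (p := fun σ => (fun z => L z (σ z)) ∈ S'.sec y) ?_ ?_ ?_ ?_ ?_ hσ
  · exact fun σ τ h1 h2 => S'.congr h2 (h1.mono fun z hz => by simp [hz])
  · intro f s hf hs
    exact S'.congr (S'.smul_mem hf (hL s hs)) (Eventually.of_forall fun z => by simp)
  · exact S'.congr (S'.sec y).zero_mem (Eventually.of_forall fun z => by simp)
  · intro σ τ _ _ h1 h2
    exact S'.congr ((S'.sec y).add_mem h1 h2) (Eventually.of_forall fun z => by simp)
  · intro c σ _ h1
    exact S'.congr ((S'.sec y).smul_mem c h1) (Eventually.of_forall fun z => by simp)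

variable [IsManifold 𝓘(𝕜, EuclideanSpace 𝕜 (Fin n)) ∞ V] {m y : V}

variable (S) in
open scoped Classical in
/-- The functional `j^h_y s ↦ ∂_w (μ s) (y)` on `J^h_y W`, for a word `w` of length at most `h`
and a smooth family `μ` of functionals on `W`. -/
def jetFun (μ : ∀ y, W y →ₗ[𝕜] 𝕜) (m : V) (w : List (Fin n)) (h : ℕ) (y : V) :
    Jet S h y →ₗ[𝕜] 𝕜 :=
  if H : ∃ T : Jet S h y →ₗ[𝕜] 𝕜, ∀ s ∈ S.sec y,
    T (jet S h s y) = pdw n m w (fun z => μ z (s z)) y then H.choose else 0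

/-- The functional is well defined because derivatives of order at most `h` annihilate sections that
vanish to order `h + 1`; the default value in `jetFun` is then not used. -/
theorem jetFun_jet {μ : ∀ y, W y →ₗ[𝕜] 𝕜} {w : List (Fin n)} {h : ℕ}
    (hy : y ∈ (chartAt (EuclideanSpace 𝕜 (Fin n)) m).source)
    (hμ : ∀ s ∈ S.sec y, SmoothNear 𝕜 n y fun z => μ z (s z)) (hw : w.length ≤ h)
    {s : ∀ y, W y} (hs : s ∈ S.sec y) :
    jetFun S μ m w h y (jet S h s y) = pdw n m w (fun z => μ z (s z)) y := by
  have H : ∃ T : Jet S h y →ₗ[𝕜] 𝕜, ∀ s ∈ S.sec y,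
      T (jet S h s y) = pdw n m w (fun z => μ z (s z)) y := by
    refine ⟨Submodule.liftQ _ ({
      toFun := fun s => pdw n m w (fun z => μ z ((s : ∀ y, W y) z)) y
      map_add' := fun s t => ?_
      map_smul' := fun c s => ?_ } : S.sec y →ₗ[𝕜] 𝕜) ?_, ?_⟩
    · refine Eq.trans ?_ (pdw_add hy w (hμ s s.2) (hμ t t.2)).self_of_nhds
      congr 1
      funext z
      exact map_add (μ z) _ _
    · refine Eq.trans ?_ (pdw_const_mul hy w (hμ s s.2) c).self_of_nhds
      congr 1
      funext z
      exact map_smul (μ z) c _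
    · intro s hs
      change pdw n m w (fun z => μ z ((s : ∀ y, W y) z)) y = 0
      have := map_mem_van (S' := fnStr 𝕜 n V) μ hμ (h + 1) s hs
      exact (mem_van_succ_iff hy (hμ s s.2)).1 this w hw
    · intro s hs
      rw [jet_of_mem hs]
      rfl
  rw [jetFun, dif_pos H]
  exact H.choose_spec s hs

theorem jetFun_smooth {μ : ∀ y, W y →ₗ[𝕜] 𝕜} {w : List (Fin n)} {h : ℕ}
    (hy : y ∈ (chartAt (EuclideanSpace 𝕜 (Fin n)) m).source)
    (hμ : ∀ᶠ z in 𝓝 y, ∀ s ∈ S.sec z, SmoothNear 𝕜 n z fun z => μ z (s z)) (hw : w.length ≤ h)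
    {σ : ∀ y, Jet S h y} (hσ : σ ∈ (jetStr S h).sec y) :
    SmoothNear 𝕜 n y fun z => jetFun S μ m w h z (σ z) := by
  refine jetStr_map_mem (S' := fnStr 𝕜 n V) _ (fun s hs => ?_) hσ
  refine ((hμ.self_of_nhds s hs).pdw hy w).congr ?_
  filter_upwards [hμ, eventually_source hy, S.eventually_mem hs] with z h1 h2 h3
  exact (jetFun_jet h2 h1 hw h3).symm

theorem pdw_append (u v : List (Fin n)) (f : V → 𝕜) :
    pdw n m (u ++ v) f = pdw n m v (pdw n m u f) := by
  induction u generalizing f with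
  | nil => rfl
  | cons i u ih => exact ih _

namespace IsFrame

variable {ι : Type*} [Fintype ι] {e : ι → ∀ y, W y} {lam : ι → ∀ y, W y →ₗ[𝕜] 𝕜}

theorem mem_van_succ_iff_pdw (H : IsFrame S e lam m) {h : ℕ} {s : ∀ y, W y} (hs : s ∈ S.sec m) :
    s ∈ van S (h + 1) m ↔ ∀ (w : List (Fin n)), w.length ≤ h → ∀ i,
      pdw n m w (fun z => lam i z (s z)) m = 0 := by
  rw [H.mem_van_iff]
  refine ⟨fun h1 w hw i => (mem_van_succ_iff (mem_chart_source _ m) (H.coeff_smooth hs i)).1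
    (h1 i) w hw, fun h1 i => ?_⟩
  exact (mem_van_succ_iff (mem_chart_source _ m) (H.coeff_smooth hs i)).2 fun w hw => h1 w hw i

/-- A section `t` with `j^h t` vanishing to the order `j + 1` vanishes to the order
`h + j + 1`. -/
theorem mem_van_of_jet_mem_van (H : IsFrame S e lam m) {h j : ℕ} {t : ∀ y, W y}
    (ht : t ∈ S.sec m) (hj : jet S h t ∈ van (jetStr S h) (j + 1) m) :
    t ∈ van S (h + j + 1) m := by
  have hm := mem_chart_source (EuclideanSpace 𝕜 (Fin n)) m
  refine (H.mem_van_succ_iff_pdw ht).2 fun w hw i => ?_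
  have hμ : ∀ᶠ z in 𝓝 m, ∀ s ∈ S.sec z, SmoothNear 𝕜 n z fun z => lam i z (s z) :=
    H.smooth.mono fun z hz s hs => hz s hs i
  -- A word of length at most `h + j` is cut into at most `h` letters, which are read off from `j^h
  -- t`, and at most `j` further ones, which are covered by the order of vanishing `j + 1`.
  have hl : (w.take h).length ≤ h := by simp
  have h1 := map_mem_van (S' := fnStr 𝕜 n V) (jetFun S (lam i) m (w.take h) h)
    (fun σ hσ => jetFun_smooth hm hμ hl hσ) (j + 1) _ hj
  have h2 : pdw n m (w.take h) (fun z => lam i z (t z)) ∈ van (fnStr 𝕜 n V) (j + 1) m := by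
    refine van_congr _ h1 ?_
    filter_upwards [hμ, eventually_source hm, S.eventually_mem ht] with z h3 h4 h5
    exact jetFun_jet h4 h3 hl h5
  have h3 := (mem_van_succ_iff hm (smoothNear_of_mem_van h2)).1 h2 (w.drop h)
    (by rw [List.length_drop]; omega)
  rwa [← pdw_append, List.take_append_drop] at h3

/-- The frame of the jet bundle attached to a frame of `W`: the jets of the products of the
monomials with the frame. -/
theorem jet [DecidableEq ι] (H : IsFrame S e lam m) (h : ℕ) :
    ∃ lam', IsFrame (jetStr S h) (fun (a : Sym (Option (Fin n)) h × ι) =>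
      JetPDE.jet S h fun z => mono 𝕜 n m (symPart a.1) z • e a.2 z) lam' m := by
  have hm := mem_chart_source (EuclideanSpace 𝕜 (Fin n)) m
  have hμ : ∀ i, ∀ᶠ z in 𝓝 m, ∀ s ∈ S.sec z, SmoothNear 𝕜 n z fun z => lam i z (s z) :=
    fun i => H.smooth.mono fun z hz s hs => hz s hs i
  have hl : ∀ a : Sym (Option (Fin n)) h, (symPart a).toList.length ≤ h := fun a => by
    rw [Multiset.length_toList]
    exact card_symPart_le a
  have hsec : ∀ (a : Sym (Option (Fin n)) h × ι),
      (fun z => mono 𝕜 n m (symPart a.1) z • e a.2 z) ∈ S.sec m :=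
    fun a => S.smul_mem (smoothNear_mono hm _) (H.mem _)
  refine of_functionals
    (T := fun a => jetFun S (lam a.2) m (symPart a.1).toList h)
    (fun a => jet_mem_sec (hsec a)) ?_ ?_ ?_
  · filter_upwards [eventually_source hm,
      eventually_all.2 fun i => eventually_eventually_nhds.2 (hμ i)] with y h1 h2 σ hσ a
    exact jetFun_smooth h1 (h2 a.2) (hl a.1) hσ
  · filter_upwards [eventually_source hm, H.eventually] with y h1 h2 w hw
    obtain ⟨s, hs, rfl⟩ := exists_jet_eq w
    refine (jet_eq_zero_iff hs).2 (h2.mem_van_iff.2 fun i => ?_)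
    refine (mem_van_succ_iff h1 (h2.coeff_smooth hs i)).2 fun w hlw => ?_
    obtain ⟨a, ha⟩ := exists_symPart_eq (h := h) (w : Multiset (Fin n)) (by simpa using hlw)
    have h3 := hw (a, i)
    rw [jetFun_jet h1 (fun s hs => h2.coeff_smooth hs i) (hl a) hs] at h3
    rw [← h3]
    refine pdw_perm ?_ h1 (h2.coeff_smooth hs i)
    rw [← Multiset.coe_eq_coe, Multiset.coe_toList, ha]
  · have key : ∀ a b : Sym (Option (Fin n)) h × ι,
        jetFun S (lam a.2) m (symPart a.1).toList h m
          (JetPDE.jet S h (fun z => mono 𝕜 n m (symPart b.1) z • e b.2 z) m) =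
        if a.2 = b.2 then pdw n m (symPart a.1).toList (mono 𝕜 n m (symPart b.1)) m else 0 := by
      intro a b
      rw [jetFun_jet hm (fun s hs => H.coeff_smooth hs a.2) (hl a.1) (hsec b)]
      have hd : ∀ᶠ z in 𝓝 m, lam a.2 z (e b.2 z) = if a.2 = b.2 then 1 else 0 := by
        filter_upwards [H.dual] with z hz
        have := hz (Pi.single b.2 1) a.2
        rw [Finset.sum_eq_single b.2 (fun j _ hj => by simp [hj]) (by simp)] at this
        rw [Pi.single_eq_same, one_smul] at this
        rw [this, Pi.single_apply]
      split_ifs with hab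
      · refine (pdw_eventuallyEq hm _ ?_).self_of_nhds
        filter_upwards [hd] with z hz
        rw [map_smul, hz, if_pos hab, smul_eq_mul, mul_one]
      · have h0 : (fun z => lam a.2 z (mono 𝕜 n m (symPart b.1) z • e b.2 z)) =ᶠ[𝓝 m]
            fun z => 0 * (fun _ => (0 : 𝕜)) z := by
          filter_upwards [hd] with z hz
          simp [hz, hab]
        rw [(pdw_eventuallyEq hm _ h0).self_of_nhds,
          (pdw_const_mul hm _ (SmoothNear.const m 0) 0).self_of_nhds]
        exact zero_mul _
    -- The Taylor functionals evaluated on the proposed frame form a diagonal matrix, so that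
    -- `of_functionals` applies.
    have hdiag : (Matrix.of fun a b : Sym (Option (Fin n)) h × ι =>
        jetFun S (lam a.2) m (symPart a.1).toList h m
          (JetPDE.jet S h (fun z => mono 𝕜 n m (symPart b.1) z • e b.2 z) m)) =
        Matrix.diagonal fun a => pdw n m (symPart a.1).toList (mono 𝕜 n m (symPart a.1)) m := by
      ext a b
      rw [Matrix.of_apply, key, Matrix.diagonal_apply]
      by_cases hab : a = b
      · subst hab
        simp
      · rw [if_neg hab]
        split_ifs with h2
        · by_contra h3
          have := (pdw_mono _ _).1 h3
          rw [Multiset.coe_toList] at this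
          exact hab (Prod.ext (symPart_injective this.symm) h2)
        · rfl
    rw [hdiag, Matrix.det_diagonal]
    exact Finset.prod_ne_zero_iff.2 fun a _ => (pdw_mono _ _).2 (by simp)

theorem finrank_jet [DecidableEq ι] (H : IsFrame S e lam m) (h : ℕ) :
    FiniteDimensional 𝕜 (Jet S h m) ∧
    Module.finrank 𝕜 (Jet S h m) = Fintype.card ι * c (n + 1) h := by
  obtain ⟨lam', H'⟩ := H.jet h
  refine ⟨H'.finiteDimensional, ?_⟩
  rw [H'.finrank_eq, Fintype.card_prod, mul_comm, Sym.card_sym_eq_multichoose,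
    Nat.multichoose_eq, Fintype.card_option, Fintype.card_fin, c]
  congr 2
  omega

end IsFrame

end JetFrame

/-! ### The numbers `c n h` and the order `h₀`. -/

section Combinatorics

theorem c_zero (n : ℕ) : c n 0 = 1 := by simp [c]

theorem c_pos (n h : ℕ) : 0 < c n h := Nat.choose_pos (by omega)

theorem c_succ_mul (n h : ℕ) : c n (h + 1) * (h + 1) = c n h * (n - 1 + h + 1) := by
  have h1 := Nat.add_one_mul_choose_eq (n - 1 + h) h
  simp only [c]
  rw [← add_assoc]
  linarith [h1]

theorem c_succ_eq_add {n : ℕ} (hn : 1 ≤ n) (h : ℕ) :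
    c (n + 1) (h + 1) = c (n + 1) h + c n (h + 1) := by
  obtain ⟨N, rfl⟩ : ∃ N, n = N + 1 := ⟨n - 1, by omega⟩
  simp only [c, Nat.add_sub_cancel]
  rw [show N + 1 + (h + 1) = (N + 1 + h) + 1 by omega, Nat.choose_succ_succ,
    show N + (h + 1) = N + 1 + h by omega]

/-- The quotient `c n (l + k) / c n l` does not increase with `l`, because the factor `(n - 1 + l +
1) / (l + 1)` from `c n l` to `c n (l + 1)` does not. Cross-multiplication keeps this in the natural
numbers. -/
theorem c_mul_succ_le (n k l : ℕ) : c n (l + 1 + k) * c n l ≤ c n (l + k) * c n (l + 1) := by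
  have h1 := c_succ_mul n l
  have h2 := c_succ_mul n (l + k)
  rw [show l + k + 1 = l + 1 + k by omega] at h2
  refine Nat.le_of_mul_le_mul_right ?_ (Nat.mul_pos (Nat.succ_pos l) (Nat.succ_pos (l + k)))
  calc c n (l + 1 + k) * c n l * ((l + 1) * (l + k + 1))
      = (c n (l + 1 + k) * (l + 1 + k)) * c n l * (l + 1) := by ring
    _ = c n (l + k) * c n l * ((n - 1 + (l + k) + 1) * (l + 1)) := by rw [h2]; ring
    _ ≤ c n (l + k) * c n l * ((n - 1 + l + 1) * (l + k + 1)) := by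
        refine Nat.mul_le_mul_left _ ?_
        nlinarith [Nat.zero_le ((n - 1) * k)]
    _ = c n (l + k) * (c n l * (n - 1 + l + 1)) * (l + k + 1) := by ring
    _ = c n (l + k) * c n (l + 1) * ((l + 1) * (l + k + 1)) := by rw [← h1]; ring

theorem mul_c_le_of_succ {n k p q l : ℕ} (h : q * c n (l + 1) ≤ p * c n (l + 1 + k)) :
    q * c n l ≤ p * c n (l + k) := by
  refine Nat.le_of_mul_le_mul_right ?_ (c_pos n (l + 1))
  calc q * c n l * c n (l + 1) = q * c n (l + 1) * c n l := by ring
    _ ≤ p * c n (l + 1 + k) * c n l := Nat.mul_le_mul_right _ h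
    _ = p * (c n (l + 1 + k) * c n l) := by ring
    _ ≤ p * (c n (l + k) * c n (l + 1)) := Nat.mul_le_mul_left _ (c_mul_succ_le n k l)
    _ = p * c n (l + k) * c n (l + 1) := by ring

/-- The inequality is inherited by smaller orders; for an ordinary operator this makes the symbols
of all orders from `k` to `h₀` surjective. -/
theorem mul_c_le_of_le {n k p q l L : ℕ} (hl : l ≤ L) (h : q * c n L ≤ p * c n (L + k)) :
    q * c n l ≤ p * c n (l + k) := by
  induction L, hl using Nat.le_induction with
  | base => exact h
  | succ L _ ih => exact ih (mul_c_le_of_succ h)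

/-- The quotient of consecutive terms is `1 + (n - 1) / (l + 1)`, and `k` of these are multiplied.
As `q / p > 1`, the set that defines `h₀` is bounded. -/
theorem tendsto_c_div (n k : ℕ) :
    Tendsto (fun l => (c n (l + k) : ℝ) / c n l) atTop (𝓝 1) := by
  have hpos : ∀ l, (c n l : ℝ) ≠ 0 := fun l => by exact_mod_cast (c_pos n l).ne'
  have h1 : Tendsto (fun l => (c n (l + 1) : ℝ) / c n l) atTop (𝓝 1) := by
    have e : ∀ l : ℕ, (c n (l + 1) : ℝ) / c n l = 1 + (n - 1 : ℕ) / ((l : ℝ) + 1) := by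
      intro l
      have h0 : ((l : ℝ) + 1) ≠ 0 := by positivity
      have h2 : (c n (l + 1) : ℝ) * (l + 1) = c n l * ((n - 1 : ℕ) + l + 1) := by
        exact_mod_cast c_succ_mul n l
      rw [div_eq_iff (hpos l)]
      field_simp
      linarith
    simp only [e]
    have h3 : Tendsto (fun l : ℕ => ((n - 1 : ℕ) : ℝ) / ((l : ℝ) + 1)) atTop (𝓝 0) :=
      tendsto_const_nhds.div_atTop (tendsto_natCast_atTop_atTop.atTop_add tendsto_const_nhds)
    simpa using h3.const_add 1
  induction k with
  | zero => simp [hpos]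
  | succ k ih =>
    have h2 := (h1.comp (tendsto_add_atTop_nat k)).mul ih
    rw [mul_one] at h2
    refine h2.congr fun l => ?_
    simp only [Function.comp]
    rw [add_assoc, div_mul_div_cancel₀ (hpos _)]

theorem isGreatest_hZero {n k p q : ℕ} (hpq : p < q) (hqp : q ≤ p * c n k) :
    IsGreatest {h | k ≤ h ∧ q * c n (h - k) ≤ p * c n h} (hZero n k p q) := by
  have hp : (0 : ℝ) < p := by
    have : 0 < p := by
      rcases Nat.eq_zero_or_pos p with rfl | h
      · omega
      · exact h
    exact_mod_cast this
  have hne : {h | k ≤ h ∧ q * c n (h - k) ≤ p * c n h}.Nonempty :=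
    ⟨k, le_rfl, by simpa [c_zero] using hqp⟩
  have hbdd : BddAbove {h | k ≤ h ∧ q * c n (h - k) ≤ p * c n h} := by
    have h1 : (1 : ℝ) < q / p := by
      rw [one_lt_div hp]
      exact_mod_cast hpq
    obtain ⟨L, hL⟩ := eventually_atTop.1 ((tendsto_c_div n k).eventually_lt_const h1)
    refine ⟨L + k, fun h hh => ?_⟩
    by_contra hlt
    have h2 := hL (h - k) (by omega)
    rw [Nat.sub_add_cancel hh.1, div_lt_div_iff₀ (by exact_mod_cast c_pos n (h - k)) hp] at h2
    have h3 : c n h * p < q * c n (h - k) := by exact_mod_cast h2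
    have := hh.2
    rw [mul_comm] at h3
    omega
  exact ⟨Nat.sSup_mem hne hbdd, fun h hh => le_csSup hbdd hh⟩

/-- With truncated subtraction `c 0 k = 1`, so `n = 0` would force `q ≤ p`. -/
theorem one_le_of_lt_of_le_mul_c {n k p q : ℕ} (hpq : p < q) (hqp : q ≤ p * c n k) : 1 ≤ n := by
  rcases Nat.eq_zero_or_pos n with rfl | h
  · simp [c] at hqp
    omega
  · exact h

end Combinatorics

/-! ### Subbundles, adapted frames and kernels of constant rank. -/

section Subbundles

variable {𝕜 : Type*} [RCLike 𝕜] {n : ℕ} {V : Type*} [TopologicalSpace V]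
  [ChartedSpace (EuclideanSpace 𝕜 (Fin n)) V]
  {W : V → Type*} [∀ y, AddCommGroup (W y)] [∀ y, Module 𝕜 (W y)]
  {W' : V → Type*} [∀ y, AddCommGroup (W' y)] [∀ y, Module 𝕜 (W' y)]

/-- `S` has local frames of `p` elements near every point. -/
def HasFrames (S : SmoothStr 𝕜 n W) (p : ℕ) : Prop :=
  ∀ x, ∃ (e : Fin p → ∀ y, W y) (lam : Fin p → ∀ y, W y →ₗ[𝕜] 𝕜), IsFrame S e lam x

theorem HasFrames.isVectorBundle {S : SmoothStr 𝕜 n W} {p : ℕ} (h : HasFrames S p) :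
    IsVectorBundle S p := by
  intro x
  obtain ⟨e, lam, H⟩ := h x
  refine ⟨e, H.eventually.mono fun y Hy => ⟨Hy.mem, Hy.linearIndependent, Hy.span_eq_top,
    fun σ hσ => ⟨fun i z => lam i z (σ z), fun i => Hy.coeff_smooth hσ i, ?_⟩⟩⟩
  exact Hy.repr.mono fun z hz => (hz (σ z)).symm

theorem HasFrames.finrank_eq {S : SmoothStr 𝕜 n W} {p : ℕ} (h : HasFrames S p) (x : V) :
    Module.finrank 𝕜 (W x) = p := by
  obtain ⟨e, lam, H⟩ := h x
  rw [H.finrank_eq, Fintype.card_fin]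

theorem HasFrames.finiteDimensional {S : SmoothStr 𝕜 n W} {p : ℕ} (h : HasFrames S p) (x : V) :
    FiniteDimensional 𝕜 (W x) := by
  obtain ⟨e, lam, H⟩ := h x
  exact H.finiteDimensional

theorem HasFrames.mem_van_one {S : SmoothStr 𝕜 n W} {p : ℕ} (h : HasFrames S p) {x : V}
    {σ : ∀ y, W y} (hσ : σ ∈ S.sec x) (h0 : σ x = 0) : σ ∈ van S 1 x := by
  obtain ⟨e, lam, H⟩ := h x
  exact H.mem_van_one hσ h0

theorem HasFrames.exists_section {S : SmoothStr 𝕜 n W} {p : ℕ} (h : HasFrames S p) {x : V}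
    (w : W x) : ∃ σ ∈ S.sec x, σ x = w := by
  obtain ⟨e, lam, H⟩ := h x
  exact H.exists_section w

theorem IsFrame.reindex {S : SmoothStr 𝕜 n W} {ι κ : Type*} [Fintype ι] [Fintype κ]
    {e : ι → ∀ y, W y} {lam : ι → ∀ y, W y →ₗ[𝕜] 𝕜} {m : V} (H : IsFrame S e lam m)
    (g : κ ≃ ι) : IsFrame S (fun a => e (g a)) (fun a => lam (g a)) m where
  mem a := H.mem _
  dual := H.dual.mono fun y hy c i => by
    have := hy (fun j => c (g.symm j)) (g i)
    rw [← g.sum_comp] at this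
    simpa using this
  repr := H.repr.mono fun y hy w => by
    rw [g.sum_comp (fun j => lam j y w • e j y)]
    exact hy w
  smooth := H.smooth.mono fun y hy σ hσ i => hy σ hσ (g i)

theorem IsFrame.exists_fin {S : SmoothStr 𝕜 n W} {ι : Type*} [Fintype ι]
    {e : ι → ∀ y, W y} {lam : ι → ∀ y, W y →ₗ[𝕜] 𝕜} {m : V} (H : IsFrame S e lam m) {p : ℕ}
    (hp : Fintype.card ι = p) : ∃ (e : Fin p → ∀ y, W y) (lam : Fin p → ∀ y, W y →ₗ[𝕜] 𝕜),
      IsFrame S e lam m :=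
  ⟨_, _, H.reindex (Fintype.equivFinOfCardEq hp).symm⟩

/-- A frame `e` of `S` near `m` is adapted to the subfamily `R` if `R` is spanned near `m` by the
first elements of `e`. -/
def IsAdapted (R : ∀ y, Submodule 𝕜 (W y)) {α β : Type*}
    (lam : α ⊕ β → ∀ y, W y →ₗ[𝕜] 𝕜) (m : V) : Prop :=
  ∀ᶠ y in 𝓝 m, ∀ w : W y, w ∈ R y ↔ ∀ b, lam (Sum.inr b) y w = 0

/-- A smooth family of linear maps that is surjective at `m` has a smooth kernel near `m`. -/
theorem exists_kernel_frame {S : SmoothStr 𝕜 n W} {S' : SmoothStr 𝕜 n W'} {m : V} {p q : ℕ}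
    (hS : HasFrames S p) (hS' : HasFrames S' q) (L : ∀ y, W y →ₗ[𝕜] W' y)
    (hL : ∀ᶠ y in 𝓝 m, ∀ s ∈ S.sec y, (fun z => L z (s z)) ∈ S'.sec y)
    (hsurj : Function.Surjective (L m)) {r : ℕ}
    (hr : Module.finrank 𝕜 (LinearMap.ker (L m)) = r) :
    ∃ (e : Fin r ⊕ Fin q → ∀ y, W y) (lam : Fin r ⊕ Fin q → ∀ y, W y →ₗ[𝕜] 𝕜)
      (μ : Fin q → ∀ y, W' y →ₗ[𝕜] 𝕜), IsFrame S e lam m ∧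
      IsAdapted (fun y => LinearMap.ker (L y)) lam m ∧
      (∀ᶠ y in 𝓝 m, ∀ b w, lam (Sum.inr b) y w = μ b y (L y w)) ∧
      ∀ᶠ y in 𝓝 m, ∀ s ∈ S'.sec y, ∀ b, SmoothNear 𝕜 n y (fun z => μ b z (s z)) := by
  have := hS.finiteDimensional m
  obtain ⟨e₁, lam₁, H₁⟩ := hS m
  obtain ⟨e₂, lam₂, H₂⟩ := hS' m
  -- `cc` lifts a frame of the target through `L m`, so its image is a frame near `m`, with coframe
  -- `μ`. The sections `bb` extend a basis of the kernel at `m`, and `ρ` is their projection to the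
  -- kernel of `L` along `cc`. Together `ρ` and `cc` form the adapted frame.
  choose v hv using fun j => hsurj (e₂ j m)
  choose cc hcc hccv using fun j => hS.exists_section (v j)
  obtain ⟨μ, Hμ⟩ := H₂.of_basis (e' := fun j z => L z (cc j z))
    (fun j => hL.self_of_nhds _ (hcc j))
    (by simpa only [hccv, hv] using H₂.linearIndependent) rfl
  let b := Module.finBasisOfFinrankEq 𝕜 (LinearMap.ker (L m)) hr
  choose bb hbb hbbv using fun a => hS.exists_section (b a : W m)
  let ρ : Fin r → ∀ y, W y := fun a y => bb a y - ∑ j, μ j y (L y (bb a y)) • cc j y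
  have hρ : ∀ a, ρ a ∈ S.sec m := fun a => by
    refine Submodule.sub_mem _ (hbb a) ?_
    have := Submodule.sum_mem (S.sec m) (t := Finset.univ)
      (f := fun j y => μ j y (L y (bb a y)) • cc j y) fun j _ =>
      S.smul_mem (Hμ.coeff_smooth (hL.self_of_nhds _ (hbb a)) j) (hcc j)
    convert this using 1
    funext y
    simp
  have hLρ : ∀ᶠ y in 𝓝 m, ∀ a, L y (ρ a y) = 0 := by
    filter_upwards [Hμ.repr] with y hy a
    simp only [ρ, map_sub, map_sum, map_smul, hy, sub_self]
  have hρm : ∀ a, ρ a m = b a := fun a => by simp [ρ, hbbv]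
  have hrank := LinearMap.finrank_range_add_finrank_ker (L m)
  rw [LinearMap.range_eq_top.2 hsurj, finrank_top, hS'.finrank_eq, hS.finrank_eq, hr] at hrank
  have hli : LinearIndependent 𝕜 fun a => Sum.elim ρ cc a m := by
    rw [Fintype.linearIndependent_iff]
    intro g hg
    rw [Fintype.sum_sum_type] at hg
    simp only [Sum.elim_inl, Sum.elim_inr, hρm, hccv] at hg
    have h1 : ∀ j, g (Sum.inr j) = 0 := by
      have h2 := congrArg (L m) hg
      rw [map_add, map_sum, map_sum, map_zero] at h2
      have h3 : ∀ a, L m (g (Sum.inl a) • (b a : W m)) = 0 := fun a => by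
        rw [map_smul, show L m (b a : W m) = 0 from (b a).2, smul_zero]
      simp only [h3, Finset.sum_const_zero, zero_add, map_smul, hv] at h2
      exact Fintype.linearIndependent_iff.1 H₂.linearIndependent _ h2
    have h4 : ∀ a, g (Sum.inl a) = 0 := by
      simp only [h1, zero_smul, Finset.sum_const_zero, add_zero] at hg
      refine Fintype.linearIndependent_iff.1 b.linearIndependent _ (Subtype.ext ?_)
      refine Eq.trans ?_ hg
      simp
    rintro (a | j)
    · exact h4 a
    · exact h1 j
  obtain ⟨lam, H⟩ := H₁.of_basis (e' := Sum.elim ρ cc)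
    (by rintro (a | j); exacts [hρ a, hcc j]) hli (by simp; omega)
  have hlam : ∀ᶠ y in 𝓝 m, ∀ j w, lam (Sum.inr j) y w = μ j y (L y w) := by
    filter_upwards [H.repr, Hμ.dual, hLρ] with y h1 h2 h3 j w
    conv_rhs => rw [← h1 w]
    rw [Fintype.sum_sum_type]
    simp only [Sum.elim_inl, Sum.elim_inr, map_add, map_sum, map_smul, h3, smul_zero,
      Finset.sum_const_zero, zero_add]
    have := h2 (fun j => lam (Sum.inr j) y w) j
    simp only [map_sum, map_smul] at this
    exact this.symm
  refine ⟨_, lam, μ, H, ?_, hlam, Hμ.smooth⟩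
  filter_upwards [hlam, Hμ.repr] with y h1 h2 w
  rw [LinearMap.mem_ker]
  refine ⟨fun h b => by rw [h1, h, map_zero], fun h => ?_⟩
  rw [← h2 (L y w)]
  exact Finset.sum_eq_zero fun j _ => by rw [← h1, h, zero_smul]

namespace IsFrame

variable {S : SmoothStr 𝕜 n W} {α β : Type*} [Fintype α] [Fintype β] {e : α ⊕ β → ∀ y, W y}
  {lam : α ⊕ β → ∀ y, W y →ₗ[𝕜] 𝕜} {m : V} {R : ∀ y, Submodule 𝕜 (W y)}

theorem eventually_mem_of_isAdapted (H : IsFrame S e lam m) (hR : IsAdapted R lam m) :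
    ∀ᶠ y in 𝓝 m, ∀ a, e (Sum.inl a) y ∈ R y := by
  classical
  filter_upwards [H.dual, hR] with y h1 h2 a
  refine (h2 _).2 fun b => ?_
  have := h1 (Pi.single (Sum.inl a) 1) (Sum.inr b)
  rw [Finset.sum_eq_single (Sum.inl a) (fun j _ hj => by simp [hj]) (by simp)] at this
  simpa using this

/-- The frame of the subfamily `R` given by an adapted frame. -/
theorem sub (H : IsFrame S e lam m) (hR : IsAdapted R lam m) {v : α → ∀ y, R y}
    (hv : ∀ᶠ y in 𝓝 m, ∀ a, (v a y : W y) = e (Sum.inl a) y) :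
    IsFrame (subStr S R) v (fun a y => (lam (Sum.inl a) y).comp (R y).subtype) m where
  mem a := S.congr (H.mem (Sum.inl a)) (hv.mono fun y hy => (hy a).symm)
  dual := by
    filter_upwards [H.dual, hv] with y h1 h2 c i
    have := h1 (Sum.elim c 0) (Sum.inl i)
    rw [Fintype.sum_sum_type] at this
    simpa [h2] using this
  repr := by
    filter_upwards [H.repr, hv, hR] with y h1 h2 h3 w
    refine Subtype.ext ?_
    have := h1 w
    rw [Fintype.sum_sum_type] at this
    simpa [h2, (h3 w).1 w.2] using this
  smooth := by
    filter_upwards [H.smooth] with y h1 σ hσ i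
    exact h1 _ hσ (Sum.inl i)

theorem exists_sub (H : IsFrame S e lam m) (hR : IsAdapted R lam m) :
    ∃ v : α → ∀ y, R y, IsFrame (subStr S R) v
      (fun a y => (lam (Sum.inl a) y).comp (R y).subtype) m := by
  classical
  refine ⟨fun a y => if h : e (Sum.inl a) y ∈ R y then ⟨_, h⟩ else 0, H.sub hR ?_⟩
  filter_upwards [H.eventually_mem_of_isAdapted hR] with y hy a
  simp [hy a]

end IsFrame

/-- The coefficients in the frame of `R` are restrictions of smooth functionals on the ambient
family, and these preserve orders of vanishing. -/
theorem mem_van_sub {S : SmoothStr 𝕜 n W} {R : ∀ y, Submodule 𝕜 (W y)} {j : ℕ} {x : V}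
    {ι : Type*} [Fintype ι] {v : ι → ∀ y, R y} {lam : ι → ∀ y, W y →ₗ[𝕜] 𝕜}
    (hlam : ∀ s ∈ S.sec x, ∀ i, SmoothNear 𝕜 n x fun z => lam i z (s z))
    (H : IsFrame (subStr S R) v (fun a y => (lam a y).comp (R y).subtype) x)
    {σ : ∀ y, R y} (hσ : (fun y => (σ y : W y)) ∈ van S j x) : σ ∈ van (subStr S R) j x :=
  H.mem_van_iff.2 fun i => map_mem_van (S' := fnStr 𝕜 n V) (lam i) (fun s hs => hlam s hs i) j _ hσ

theorem jetIncl_jet {S : SmoothStr 𝕜 n W} {R : ∀ y, Submodule 𝕜 (W y)} {h : ℕ} {x : V}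
    {σ : ∀ y, R y} (hσ : σ ∈ (subStr S R).sec x) :
    jetIncl S R h x (jet (subStr S R) h σ x) = jet S h (fun y => (σ y : W y)) x := by
  rw [jet_of_mem hσ, jet_of_mem (S := S) hσ]
  rfl

end Subbundles

/-! ### Prolongations of an ordinary operator and the splitting of `J^1 R_H → R_H`. -/

section Prolongation

/-- By Pascal's rule one adds up the inequalities in the degrees up to `L`. This makes the truncated
subtraction in the rank exact. -/
theorem mul_c_succ_le {n k p q L : ℕ} (hn : 1 ≤ n) (h : q * c n L ≤ p * c n (L + k)) :
    q * c (n + 1) L ≤ p * c (n + 1) (L + k) := by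
  have key : ∀ l ≤ L, q * c (n + 1) l ≤ p * c (n + 1) (l + k) := by
    intro l
    induction l with
    | zero =>
      intro _
      have h1 := mul_c_le_of_le (Nat.zero_le L) h
      rw [c_zero, zero_add] at h1 ⊢
      refine h1.trans (Nat.mul_le_mul_left _ ?_)
      cases k with
      | zero => simp [c_zero]
      | succ k =>
        rw [c_succ_eq_add hn]
        exact Nat.le_add_left _ _
    | succ l ih =>
      intro hl
      have h1 := mul_c_le_of_le hl h
      have h2 := ih (by omega)
      rw [show l + 1 + k = l + k + 1 by omega] at h1 ⊢
      rw [c_succ_eq_add hn, c_succ_eq_add hn, mul_add, mul_add]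
      exact Nat.add_le_add h2 h1
  exact key L le_rfl

variable {𝕜 : Type*} [RCLike 𝕜] {n : ℕ} {V : Type*} [TopologicalSpace V]
  [ChartedSpace (EuclideanSpace 𝕜 (Fin n)) V]
  {W : V → Type*} [∀ y, AddCommGroup (W y)] [∀ y, Module 𝕜 (W y)]
  {W' : V → Type*} [∀ y, AddCommGroup (W' y)] [∀ y, Module 𝕜 (W' y)]
  {S : SmoothStr 𝕜 n W} {S' : SmoothStr 𝕜 n W'} {k : ℕ} {D : DiffOp S S' k} {x : V}

theorem DiffOp.apply_mem_sec (D : DiffOp S S' k) {s : ∀ y, W y} (hs : s ∈ S.sec x) :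
    D.apply s ∈ S'.sec x :=
  D.smooth x s hs

theorem DiffOp.prolong_jet {h l : ℕ} (hl : k + l ≤ h) {s : ∀ y, W y} (hs : s ∈ S.sec x) :
    D.prolong hl x (jet S h s x) = jet S' l (D.apply s) x := by
  rw [jet_of_mem hs, jet_of_mem (D.apply_mem_sec hs)]
  rfl

/-- Trades the difference `h - k` for any `l` with `k + l = h`, which keeps subtraction out of the
types of jets. -/
theorem DiffOp.mem_formalSol {h l : ℕ} (hl : k + l = h) {w : Jet S h x} :
    w ∈ D.formalSol h x ↔ D.prolong hl.le x w = 0 := by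
  subst hl
  have hk : k ≤ k + l := Nat.le_add_right k l
  have key : ∀ l', l' = l → ∀ (hl' : k + l' ≤ k + l), D.prolong hl' x w = 0 ↔
      D.prolong (le_refl (k + l)) x w = 0 := by
    rintro l' rfl hl'
    rfl
  rw [DiffOp.formalSol, dif_pos hk, LinearMap.mem_ker]
  exact key _ (by omega) _

theorem DiffOp.jet_mem_formalSol {h l : ℕ} (hl : k + l = h) {s : ∀ y, W y} (hs : s ∈ S.sec x) :
    jet S h s x ∈ D.formalSol h x ↔ D.apply s ∈ van S' (l + 1) x := by
  rw [DiffOp.mem_formalSol hl, DiffOp.prolong_jet _ hs, jet_eq_zero_iff (D.apply_mem_sec hs)]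

theorem DiffOp.formalSol_of_lt {h : ℕ} (hl : h < k) : D.formalSol h x = ⊤ :=
  dif_neg (by omega)

theorem DiffOp.formalSol_eq_ker {h l : ℕ} (hl : k + l = h) :
    D.formalSol h x = LinearMap.ker (D.prolong hl.le x) :=
  Submodule.ext fun _ => DiffOp.mem_formalSol hl

theorem DiffOp.prolong_smooth {h l : ℕ} (hl : k + l ≤ h) {σ : ∀ y, Jet S h y}
    (hσ : σ ∈ (jetStr S h).sec x) : (fun z => D.prolong hl z (σ z)) ∈ (jetStr S' l).sec x := by
  refine jetStr_map_mem (S' := jetStr S' l) _ (fun s hs => ?_) hσ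
  refine (jetStr S' l).congr (jet_mem_sec (D.apply_mem_sec hs)) ?_
  filter_upwards [S.eventually_mem hs] with z hz
  exact (DiffOp.prolong_jet hl hz).symm

theorem DiffOp.jetProj_prolong {h l h' l' : ℕ} (hl : k + l ≤ h) (hl' : k + l' ≤ h') (hh : h' ≤ h)
    (hll : l' ≤ l) (w : Jet S h x) :
    jetProj S' hll x (D.prolong hl x w) = D.prolong hl' x (jetProj S hh x w) := by
  obtain ⟨s, hs, rfl⟩ := exists_jet_eq w
  rw [DiffOp.prolong_jet _ hs, jetProj_jet _ hs, DiffOp.prolong_jet _ hs,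
    jetProj_jet _ (D.apply_mem_sec hs)]

theorem DiffOp.jetProj_mem_formalSol {h : ℕ} {w : Jet S (h + 1) x}
    (hw : w ∈ D.formalSol (h + 1) x) : jetProj S (Nat.le_succ h) x w ∈ D.formalSol h x := by
  by_cases hk : k ≤ h
  · obtain ⟨l, rfl⟩ := Nat.exists_eq_add_of_le hk
    rw [DiffOp.mem_formalSol rfl, ← DiffOp.jetProj_prolong (l := l + 1) le_rfl _ _ (Nat.le_succ l),
      (DiffOp.mem_formalSol (l := l + 1) rfl).1 hw, map_zero]
  · rw [DiffOp.formalSol_of_lt (by omega)]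
    trivial

theorem DiffOp.IsOrdinary.finrank_range {p q : ℕ} (hD : D.IsOrdinary p q) {h l : ℕ}
    (hl : k + l = h + 1) (x : V) :
    Module.finrank 𝕜 (LinearMap.range ((D.prolong hl.le x).domRestrict
      (LinearMap.ker (jetProj S (Nat.le_succ h) x)))) = min (q * c n l) (p * c n (h + 1)) := by
  obtain rfl : l = h + 1 - k := by omega
  exact hD (h + 1) (by omega) x

variable [IsManifold 𝓘(𝕜, EuclideanSpace 𝕜 (Fin n)) ∞ V] {p q : ℕ}

theorem HasFrames.jet (hS : HasFrames S p) (h : ℕ) :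
    HasFrames (jetStr S h) (p * c (n + 1) h) := by
  intro x
  obtain ⟨e, lam, H⟩ := hS x
  obtain ⟨lam', H'⟩ := H.jet h
  refine H'.exists_fin ?_
  rw [← H'.finrank_eq, (H.finrank_jet h).2, Fintype.card_fin]

/-- The rank of `S^(l+1) T^*V ⊗ W`, as the difference of the ranks of two consecutive jet bundles,
by Pascal's rule. -/
theorem HasFrames.finrank_ker_jetProj (hS : HasFrames S p) (hn : 1 ≤ n) (l : ℕ) (x : V) :
    Module.finrank 𝕜 (LinearMap.ker (jetProj S (Nat.le_succ l) x)) = p * c n (l + 1) := by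
  have := (hS.jet (l + 1)).finiteDimensional x
  have h1 := LinearMap.finrank_range_add_finrank_ker (jetProj S (Nat.le_succ l) x)
  rw [LinearMap.range_eq_top.2 (jetProj_surjective _ x), finrank_top, (hS.jet l).finrank_eq,
    (hS.jet (l + 1)).finrank_eq, c_succ_eq_add hn, mul_add] at h1
  omega

/-- The symbol takes its values in the kernel of `J^(l+1) W' → J^l W'`. Under the inequality its
rank equals the dimension of this kernel, so it is onto. -/
theorem DiffOp.IsOrdinary.range_eq_ker (hD : D.IsOrdinary p q) (hS' : HasFrames S' q)
    (hn : 1 ≤ n) {l : ℕ} (hle : q * c n (l + 1) ≤ p * c n (k + l + 1)) (x : V) {w : Jet S' (l + 1) x}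
    (hw : jetProj S' (Nat.le_succ l) x w = 0) :
    ∃ v : Jet S (k + l + 1) x, jetProj S (Nat.le_succ (k + l)) x v = 0 ∧
      D.prolong (l := l + 1) le_rfl x v = w := by
  have := (hS'.jet (l + 1)).finiteDimensional x
  have h1 := hD.finrank_range (h := k + l) (l := l + 1) rfl x
  rw [min_eq_left hle, ← hS'.finrank_ker_jetProj hn l x] at h1
  have h2 : LinearMap.range ((D.prolong (h := k + l + 1) (l := l + 1) le_rfl x).domRestrict
      (LinearMap.ker (jetProj S (Nat.le_succ (k + l)) x))) ≤
      LinearMap.ker (jetProj S' (Nat.le_succ l) x) := by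
    rintro _ ⟨v, rfl⟩
    rw [LinearMap.mem_ker, LinearMap.domRestrict_apply,
      DiffOp.jetProj_prolong le_rfl le_rfl (Nat.le_succ (k + l)) (Nat.le_succ l),
      LinearMap.mem_ker.1 v.2, map_zero]
  have h3 := Submodule.eq_of_le_of_finrank_eq h2 h1
  obtain ⟨v, hv⟩ := h3.ge (LinearMap.mem_ker.2 hw)
  exact ⟨v, LinearMap.mem_ker.1 v.2, hv⟩

theorem DiffOp.prolong_zero_surjective (hS' : HasFrames S' q)
    (hD : Function.Surjective (D.toFun x)) :
    Function.Surjective (D.prolong (le_refl (k + 0)) x) := by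
  intro w
  obtain ⟨t, ht, rfl⟩ := exists_jet_eq w
  obtain ⟨v, hv⟩ := hD (t x)
  obtain ⟨s, hs, rfl⟩ := exists_jet_eq (h := k) v
  refine ⟨jet S k s x, ?_⟩
  refine (DiffOp.prolong_jet _ hs).trans ?_
  rw [jet_eq_iff (D.apply_mem_sec hs) ht]
  refine hS'.mem_van_one (Submodule.sub_mem _ (D.apply_mem_sec hs) ht) ?_
  rw [Pi.sub_apply, sub_eq_zero]
  exact hv

/-- Induction on `l`: lift the jet of lower order, then correct the remaining error, which lies in
the top degree and so in the range of the symbol. -/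
theorem DiffOp.IsOrdinary.prolong_surjective (hD : D.IsOrdinary p q) (hS' : HasFrames S' q)
    (hn : 1 ≤ n) (hsurj : ∀ x, Function.Surjective (D.toFun x)) {L : ℕ}
    (hle : q * c n L ≤ p * c n (L + k)) {l : ℕ} (hl : l ≤ L) (x : V) :
    Function.Surjective (D.prolong (le_refl (k + l)) x) := by
  induction l with
  | zero => exact DiffOp.prolong_zero_surjective hS' (hsurj x)
  | succ l ih =>
    intro w
    obtain ⟨v, hv⟩ := ih (by omega) (jetProj S' (Nat.le_succ l) x w)
    obtain ⟨v', rfl⟩ := jetProj_surjective (S := S) (Nat.le_succ (k + l)) x v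
    have h1 := mul_c_le_of_le hl hle
    rw [show l + 1 + k = k + l + 1 by omega] at h1
    obtain ⟨v'', -, hv''⟩ := hD.range_eq_ker hS' hn h1 x
      (w := w - D.prolong (h := k + l + 1) (l := l + 1) le_rfl x v') (by
        rw [map_sub, DiffOp.jetProj_prolong (l := l + 1) (l' := l) le_rfl le_rfl
          (Nat.le_succ (k + l)), hv, sub_self])
    refine ⟨v' + v'', ?_⟩
    rw [map_add]
    refine (congrArg _ hv'').trans ?_
    exact add_sub_cancel _ _

/-- The consequences of being calibrated that the tautological connection on `R_H` depends on. -/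
structure DiffOp.IsRigid (D : DiffOp S S' k) (p q H : ℕ) : Prop where
  frames : HasFrames S p
  frames' : HasFrames S' q
  le : k ≤ H + 1
  prolong_surjective : ∀ l, k + l ≤ H + 1 → ∀ x,
    Function.Surjective (D.prolong (le_refl (k + l)) x)
  bijOn : ∀ x, Set.BijOn (jetProj S (Nat.le_succ H) x) (D.formalSol (H + 1) x) (D.formalSol H x)

theorem DiffOp.IsOrdinary.isRigid (hD : D.IsOrdinary p q) (hS : HasFrames S p)
    (hS' : HasFrames S' q) (hn : 1 ≤ n)
    (hsurj : ∀ x, Function.Surjective (D.toFun x)) {H : ℕ} (hH : k ≤ H + 1)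
    (heq : p * c n (H + 1) = q * c n (H + 1 - k)) : D.IsRigid p q H := by
  have hle : q * c n (H + 1 - k) ≤ p * c n (H + 1 - k + k) := by
    rw [Nat.sub_add_cancel hH, heq]
  have hps : ∀ l, k + l ≤ H + 1 → ∀ x, Function.Surjective (D.prolong (le_refl (k + l)) x) :=
    fun l hl x => hD.prolong_surjective hS' hn hsurj hle (by omega) x
  refine ⟨hS, hS', hH, hps, fun x => ⟨fun w hw => DiffOp.jetProj_mem_formalSol hw, ?_, ?_⟩⟩
  -- Calibration makes the rank of the symbol of order `H + 1` equal to the dimension of its source,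
  -- so this symbol is injective. The difference of two formal solutions with the same projection
  -- lies in its kernel.
  · intro v hv v' hv' hvv'
    have := (hS.jet (H + 1)).finiteDimensional x
    have hl : k + (H + 1 - k) = H + 1 := by omega
    have h1 := hD.finrank_range hl x
    rw [← heq, min_self, ← hS.finrank_ker_jetProj hn H x] at h1
    have h2 := LinearMap.finrank_range_add_finrank_ker ((D.prolong hl.le x).domRestrict
      (LinearMap.ker (jetProj S (Nat.le_succ H) x)))
    have h3 : Module.finrank 𝕜 (LinearMap.ker ((D.prolong hl.le x).domRestrict
      (LinearMap.ker (jetProj S (Nat.le_succ H) x)))) = 0 :=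
      Nat.add_left_cancel (h2.trans h1.symm)
    rw [Submodule.finrank_eq_zero, LinearMap.ker_eq_bot] at h3
    have h4 := @h3 ⟨v - v', by rw [LinearMap.mem_ker, map_sub, hvv', sub_self]⟩ 0 (by
      rw [map_zero, LinearMap.domRestrict_apply, map_sub, (DiffOp.mem_formalSol hl).1 hv,
        (DiffOp.mem_formalSol hl).1 hv', sub_self])
    exact sub_eq_zero.1 (congrArg Subtype.val h4)
  -- An arbitrary lift of `w` fails to be a formal solution only by a jet in the top degree, which
  -- the symbol of order `H + 1` reaches.
  · intro w hw
    obtain ⟨v, rfl⟩ := jetProj_surjective (S := S) (Nat.le_succ H) x w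
    by_cases hk : k ≤ H
    · obtain ⟨l, rfl⟩ := Nat.exists_eq_add_of_le hk
      have hle' : q * c n (l + 1) ≤ p * c n (k + l + 1) := by
        rw [heq, show k + l + 1 - k = l + 1 by omega]
      obtain ⟨v', hv', hDv'⟩ := hD.range_eq_ker hS' hn hle' x
        (w := D.prolong (h := k + l + 1) (l := l + 1) le_rfl x v) (by
          rw [DiffOp.jetProj_prolong (l := l + 1) (l' := l) le_rfl le_rfl (Nat.le_succ (k + l))]
          exact (DiffOp.mem_formalSol rfl).1 hw)
      refine ⟨v - v', ?_, by rw [map_sub, hv', sub_zero]⟩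
      refine (DiffOp.mem_formalSol (l := l + 1) rfl).2 ?_
      rw [map_sub]
      exact sub_eq_zero.2 hDv'.symm
    -- Here `k = H + 1`, and `R_H` is all of `J^H W`. The symbol of order `k` has rank `q`, so it
    -- reaches all of `J^0 W'`.
    · have hl : k + 0 = H + 1 := by omega
      have := (hS'.jet 0).finiteDimensional x
      have h1 := hD.finrank_range hl x
      rw [heq, show H + 1 - k = 0 by omega, min_self] at h1
      have h2 : LinearMap.range ((D.prolong hl.le x).domRestrict
          (LinearMap.ker (jetProj S (Nat.le_succ H) x))) = ⊤ := by
        refine Submodule.eq_top_of_finrank_eq ?_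
        rw [h1, (hS'.jet 0).finrank_eq, c_zero, c_zero]
      obtain ⟨v', hv'⟩ := LinearMap.range_eq_top.1 h2 (D.prolong hl.le x v)
      refine ⟨v - v', ?_, by rw [map_sub, LinearMap.mem_ker.1 v'.2, sub_zero]⟩
      refine (DiffOp.mem_formalSol hl).2 ?_
      rw [map_sub, sub_eq_zero]
      exact hv'.symm

namespace DiffOp.IsRigid

variable {H : ℕ}

theorem finrank_formalSol_succ (hD : D.IsRigid p q H) (x : V) :
    Module.finrank 𝕜 (D.formalSol (H + 1) x) + q * c (n + 1) (H + 1 - k) =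
      p * c (n + 1) (H + 1) := by
  obtain ⟨l, hl⟩ := Nat.exists_eq_add_of_le hD.le
  have := (hD.frames.jet (H + 1)).finiteDimensional x
  have h1 := LinearMap.finrank_range_add_finrank_ker (D.prolong hl.symm.le x)
  have h2 : Function.Surjective (D.prolong hl.symm.le x) := by
    have h3 := hD.prolong_surjective l hl.symm.le x
    clear h1 this
    -- The order becomes a variable, so that `h = k + l` can be substituted in the types.
    generalize H + 1 = h at hl ⊢
    subst hl
    exact h3
  rw [LinearMap.range_eq_top.2 h2, finrank_top, (hD.frames'.jet l).finrank_eq,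
    (hD.frames.jet _).finrank_eq] at h1
  rw [DiffOp.formalSol_eq_ker hl.symm, show H + 1 - k = l by omega]
  omega

/-- The isomorphism `R_(H+1) → R_H`. -/
def projEquiv (hD : D.IsRigid p q H) (x : V) : D.formalSol (H + 1) x ≃ₗ[𝕜] D.formalSol H x :=
  LinearEquiv.ofBijective ((jetProj S (Nat.le_succ H) x).restrict
    fun _ hw => DiffOp.jetProj_mem_formalSol hw) (by
      constructor
      · intro v v' h
        exact Subtype.ext ((hD.bijOn x).injOn v.2 v'.2 (congrArg Subtype.val h))
      · intro w
        obtain ⟨v, hv, hvw⟩ := (hD.bijOn x).surjOn w.2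
        exact ⟨⟨v, hv⟩, Subtype.ext hvw⟩)

theorem projEquiv_coe (hD : D.IsRigid p q H) (x : V) (v : D.formalSol (H + 1) x) :
    (hD.projEquiv x v : Jet S H x) = jetProj S (Nat.le_succ H) x v := rfl

theorem finrank_formalSol (hD : D.IsRigid p q H) (x : V) :
    Module.finrank 𝕜 (D.formalSol H x) =
      p * c (n + 1) (H + 1) - q * c (n + 1) (H + 1 - k) := by
  rw [← (hD.projEquiv x).finrank_eq, ← hD.finrank_formalSol_succ x]
  omega

/-- For `k ≤ h` the frame comes from the kernel of the surjection `D_h`; for `h < k` there are no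
equations and `N = 0`. The last clause is what sends `R_(H+1)` into `J^1 (R_H)`: if `j^(h+1) s` is a
formal solution at `x`, then `D (j^k s)` vanishes to order `h - k + 2`, hence its `(h - k)`-jet,
which the functionals `lam (Sum.inr b)` read through `μ`, vanishes to order two. -/
theorem exists_adapted (hD : D.IsRigid p q H) {h : ℕ} (hh : h ≤ H + 1) (x : V) {r : ℕ}
    (hr : Module.finrank 𝕜 (D.formalSol h x) = r) :
    ∃ (N : ℕ) (e : Fin r ⊕ Fin N → ∀ y, Jet S h y)
      (lam : Fin r ⊕ Fin N → ∀ y, Jet S h y →ₗ[𝕜] 𝕜), IsFrame (jetStr S h) e lam x ∧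
      IsAdapted (D.formalSol h) lam x ∧ ∀ s ∈ S.sec x,
        jet S (h + 1) s x ∈ D.formalSol (h + 1) x →
        ∀ b, (fun z => lam (Sum.inr b) z (jet S h s z)) ∈ van (fnStr 𝕜 n V) 2 x := by
  by_cases hk : k ≤ h
  · obtain ⟨l, rfl⟩ := Nat.exists_eq_add_of_le hk
    have hker : ∀ y, D.formalSol (k + l) y = LinearMap.ker (D.prolong (le_refl (k + l)) y) :=
      fun y => DiffOp.formalSol_eq_ker rfl
    rw [hker] at hr
    obtain ⟨e, lam, μ, H1, H2, H3, H4⟩ := exists_kernel_frame (m := x) (hD.frames.jet (k + l))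
      (hD.frames'.jet l) (D.prolong (le_refl (k + l)))
      (Eventually.of_forall fun y s hs => DiffOp.prolong_smooth _ hs)
      (hD.prolong_surjective l hh x) hr
    refine ⟨_, e, lam, H1, ?_, fun s hs hjs b => ?_⟩
    · rwa [show D.formalSol (k + l) = fun y => LinearMap.ker (D.prolong (le_refl (k + l)) y) from
        funext hker]
    · have h1 := (DiffOp.jet_mem_formalSol (l := l + 1) rfl hs).1 hjs
      have h2 : jet S' l (D.apply s) ∈ van (jetStr S' l) 2 x := by
        have := (jetOp S' l).apply_mem_van h1
        rwa [show l + 1 + 1 - l = 2 by omega] at this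
      have h3 := map_mem_van (S' := fnStr 𝕜 n V) (μ b)
        (fun s hs => H4.self_of_nhds s hs b) 2 _ h2
      refine van_congr _ h3 ?_
      filter_upwards [H3, S.eventually_mem hs] with z hz hsz
      rw [hz, DiffOp.prolong_jet _ hsz]
  · obtain ⟨e, lam, H1⟩ := hD.frames.jet h x
    have htop : ∀ y, D.formalSol h y = ⊤ := fun y => DiffOp.formalSol_of_lt (by omega)
    have hcard : Fintype.card (Fin r ⊕ Fin 0) = p * c (n + 1) h := by
      rw [Fintype.card_sum, Fintype.card_fin, Fintype.card_fin, add_zero, ← hr, htop, finrank_top,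
        (hD.frames.jet h).finrank_eq]
    refine ⟨0, _, _, H1.reindex (Fintype.equivFinOfCardEq hcard), ?_, fun _ _ _ b => b.elim0⟩
    refine Eventually.of_forall fun y w => ?_
    rw [htop]
    simp

theorem hasFrames_of_finrank (hD : D.IsRigid p q H) {h : ℕ} (hh : h ≤ H + 1) {r : ℕ}
    (hr : ∀ x, Module.finrank 𝕜 (D.formalSol h x) = r) : HasFrames (D.solStr h) r := by
  intro x
  obtain ⟨N, e, lam, H1, H2, -⟩ := hD.exists_adapted hh x (hr x)
  obtain ⟨v, hv⟩ := H1.exists_sub H2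
  exact ⟨v, _, hv⟩

theorem hasFrames (hD : D.IsRigid p q H) :
    HasFrames (D.solStr H) (p * c (n + 1) (H + 1) - q * c (n + 1) (H + 1 - k)) :=
  hD.hasFrames_of_finrank (Nat.le_succ H) fun x => hD.finrank_formalSol x

theorem hasFrames_succ (hD : D.IsRigid p q H) :
    HasFrames (D.solStr (H + 1)) (p * c (n + 1) (H + 1) - q * c (n + 1) (H + 1 - k)) :=
  hD.hasFrames_of_finrank le_rfl fun x => by rw [← hD.finrank_formalSol_succ x]; omega

theorem mem_van_of_incl (hD : D.IsRigid p q H) {x : V} {j : ℕ} {σ : ∀ y, D.formalSol H y}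
    (hσ : (fun y => (σ y : Jet S H y)) ∈ van (jetStr S H) j x) : σ ∈ van (D.solStr H) j x := by
  obtain ⟨N, e, lam, H1, H2, -⟩ := hD.exists_adapted (Nat.le_succ H) x rfl
  obtain ⟨v, hv⟩ := H1.exists_sub H2
  exact mem_van_sub (lam := fun a => lam (Sum.inl a))
    (fun s hs i => H1.coeff_smooth hs (Sum.inl i)) hv hσ

theorem jetIncl_injective (hD : D.IsRigid p q H) (h : ℕ) (x : V) :
    Function.Injective (jetIncl (jetStr S H) (D.formalSol H) h x) := by
  rw [← LinearMap.ker_eq_bot, LinearMap.ker_eq_bot']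
  intro w hw
  obtain ⟨σ, hσ, rfl⟩ := exists_jet_eq w
  rw [jetIncl_jet hσ, jet_eq_zero_iff (S := jetStr S H) hσ] at hw
  exact (jet_eq_zero_iff hσ).2 (hD.mem_van_of_incl hw)

theorem jetJet_jet {s : ∀ y, W y} (hs : s ∈ S.sec x) :
    jetJet S H x (jet S (H + 1) s x) = jet (jetStr S H) 1 (jet S H s) x :=
  DiffOp.prolong_jet _ hs

/-- Keep only the components of `j^H s` along `R_H`. The omitted ones vanish to order two at `x` by
the last clause of `exists_adapted`, so the 1-jet does not change. -/
theorem exists_jetIncl_eq (hD : D.IsRigid p q H) {x : V} {r : Jet S (H + 1) x}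
    (hr : r ∈ D.formalSol (H + 1) x) :
    ∃ w, jetIncl (jetStr S H) (D.formalSol H) 1 x w = jetJet S H x r := by
  classical
  obtain ⟨s, hs, rfl⟩ := exists_jet_eq r
  obtain ⟨N, e, lam, H1, H2, H3⟩ := hD.exists_adapted (Nat.le_succ H) x rfl
  let τ : ∀ y, Jet S H y := fun y => ∑ a, lam (Sum.inl a) y (jet S H s y) • e (Sum.inl a) y
  have hsec := jet_mem_sec (h := H) hs
  have hτ : τ ∈ (jetStr S H).sec x := by
    have := Submodule.sum_mem ((jetStr S H).sec x) (t := Finset.univ)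
      (f := fun a y => lam (Sum.inl a) y (jet S H s y) • e (Sum.inl a) y) fun a _ =>
      (jetStr S H).smul_mem (H1.coeff_smooth hsec _) (H1.mem _)
    convert this using 1
    funext y
    simp [τ]
  have hτR : ∀ᶠ y in 𝓝 x, τ y ∈ D.formalSol H y := by
    filter_upwards [H1.eventually_mem_of_isAdapted H2] with y hy
    exact Submodule.sum_mem _ fun a _ => Submodule.smul_mem _ _ (hy a)
  let σ : ∀ y, D.formalSol H y := fun y => if h : τ y ∈ D.formalSol H y then ⟨τ y, h⟩ else 0
  have hστ : ∀ᶠ y in 𝓝 x, τ y = σ y := by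
    filter_upwards [hτR] with y hy
    simp [σ, hy]
  have hσ : (fun y => (σ y : Jet S H y)) ∈ (jetStr S H).sec x := (jetStr S H).congr hτ hστ
  refine ⟨jet (D.solStr H) 1 σ x, ?_⟩
  refine (jetIncl_jet (S := jetStr S H) hσ).trans ?_
  rw [jetJet_jet hs, jet_eq_iff hσ hsec]
  refine H1.mem_van_iff.2 ?_
  have key : ∀ᶠ y in 𝓝 x, (σ y : Jet S H y) - jet S H s y =
      -∑ b, lam (Sum.inr b) y (jet S H s y) • e (Sum.inr b) y := by
    filter_upwards [hστ, H1.repr] with y h1 h2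
    rw [← h1]
    conv_lhs => rw [← h2 (jet S H s y)]
    rw [Fintype.sum_sum_type]
    simp only [τ]
    abel
  have key2 : ∀ᶠ y in 𝓝 x, ∀ i, lam i y ((σ y : Jet S H y) - jet S H s y) =
      Sum.elim (fun _ => 0) (fun b => -lam (Sum.inr b) y (jet S H s y)) i := by
    filter_upwards [key, H1.dual] with y h1 h2 i
    rw [h1]
    have := h2 (Sum.elim (fun _ => 0) (fun b => -lam (Sum.inr b) y (jet S H s y))) i
    rw [← this, Fintype.sum_sum_type]
    simp
  intro i
  cases i with
  | inl a => exact mem_van_of_germ_zero _ _ (key2.mono fun y hy => hy (Sum.inl a))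
  | inr b =>
    refine van_congr _ (Submodule.neg_mem _ (H3 s hs hr b)) ?_
    exact key2.mono fun y hy => (hy (Sum.inr b)).symm

variable (D) in
/-- The map `J^h R_H → J^h (J^H W)`. -/
def _root_.JetPDE.DiffOp.solIncl (H h : ℕ) (x : V) :
    Jet (D.solStr H) h x →ₗ[𝕜] Jet (jetStr S H) h x :=
  jetIncl (jetStr S H) (D.formalSol H) h x

theorem solIncl_injective (hD : D.IsRigid p q H) (h : ℕ) (x : V) :
    Function.Injective (D.solIncl H h x) :=
  hD.jetIncl_injective h x

/-- The inclusion `R_(H+1) → J^1 (R_H)`. -/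
def inclJet (hD : D.IsRigid p q H) (x : V) :
    D.formalSol (H + 1) x →ₗ[𝕜] Jet (D.solStr H) 1 x :=
  (LinearEquiv.ofInjective _ (hD.solIncl_injective 1 x)).symm.toLinearMap ∘ₗ
    (jetJet S H x ∘ₗ (D.formalSol (H + 1) x).subtype).codRestrict
      (LinearMap.range (D.solIncl H 1 x)) (fun r => hD.exists_jetIncl_eq r.2)

theorem solIncl_inclJet (hD : D.IsRigid p q H) (x : V) (r : D.formalSol (H + 1) x) :
    D.solIncl H 1 x (hD.inclJet x r) = jetJet S H x r :=
  congrArg Subtype.val ((LinearEquiv.ofInjective _ (hD.solIncl_injective 1 x)).apply_symm_apply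
    ((jetJet S H x ∘ₗ (D.formalSol (H + 1) x).subtype).codRestrict
      (LinearMap.range (D.solIncl H 1 x)) (fun r => hD.exists_jetIncl_eq r.2) r))

/-- The tautological splitting. -/
def splitting (hD : D.IsRigid p q H) (x : V) :
    D.formalSol H x →ₗ[𝕜] Jet (D.solStr H) 1 x :=
  hD.inclJet x ∘ₗ (hD.projEquiv x).symm.toLinearMap

theorem jetIncl_splitting (hD : D.IsRigid p q H) {x : V} {r : Jet S (H + 1) x}
    (hr : r ∈ D.formalSol (H + 1) x) {e : D.formalSol H x}
    (he : jetProj S (Nat.le_succ H) x r = e) :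
    jetIncl (jetStr S H) (D.formalSol H) 1 x (hD.splitting x e) = jetJet S H x r := by
  have h1 : (hD.projEquiv x).symm e = ⟨r, hr⟩ := by
    rw [LinearEquiv.symm_apply_eq]
    exact Subtype.ext he.symm
  refine Eq.trans ?_ (hD.solIncl_inclJet x ⟨r, hr⟩)
  rw [← h1]
  rfl

theorem isTautologicalSplitting (hD : D.IsRigid p q H) :
    D.IsTautologicalSplitting H hD.splitting :=
  fun _ _ hr _ he => hD.jetIncl_splitting hr he

/-- Each element of `R_H` has a lift to `R_(H+1)`, which fixes its image in `J^1 (J^H W)`, and `J^1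
(R_H)` embeds there. -/
theorem splitting_unique (hD : D.IsRigid p q H)
    {u : ∀ x, D.formalSol H x →ₗ[𝕜] Jet (D.solStr H) 1 x}
    (hu : D.IsTautologicalSplitting H u) : u = hD.splitting := by
  funext x
  refine LinearMap.ext fun e => ?_
  obtain ⟨r, hr, hre⟩ := (hD.bijOn x).surjOn e.2
  refine hD.jetIncl_injective 1 x ?_
  rw [hu x r hr e hre, hD.jetIncl_splitting hr hre]

end DiffOp.IsRigid

end Prolongation

/-! ### The Lie bracket of vector fields in a chart. -/

section Bracket

variable {𝕜 : Type*} [RCLike 𝕜] {n : ℕ} {V : Type*} [TopologicalSpace V]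
  [ChartedSpace (EuclideanSpace 𝕜 (Fin n)) V]
  [IsManifold 𝓘(𝕜, EuclideanSpace 𝕜 (Fin n)) ∞ V] {x : V}
  {X Y : ∀ y : V, TangentSpace 𝓘(𝕜, EuclideanSpace 𝕜 (Fin n)) y}

variable (𝕜 n) in
/-- The components of a vector field in the chart at `x`. -/
def locField (x : V) (X : ∀ y : V, TangentSpace 𝓘(𝕜, EuclideanSpace 𝕜 (Fin n)) y)
    (z : EuclideanSpace 𝕜 (Fin n)) : EuclideanSpace 𝕜 (Fin n) :=
  WithLp.toLp 2 fun i => loc x (fun y => diff (crd 𝕜 n x i) y (X y)) z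

/-- The derivative of the chart inverts that of the inverse chart, so the pullback by which
`mlieBracket` is defined has the functions `dx_i (X)` as components. -/
theorem mpullbackWithin_eventuallyEq (x : V)
    (X : ∀ y : V, TangentSpace 𝓘(𝕜, EuclideanSpace 𝕜 (Fin n)) y) :
    (VectorField.mpullbackWithin 𝓘(𝕜, EuclideanSpace 𝕜 (Fin n)) 𝓘(𝕜, EuclideanSpace 𝕜 (Fin n))
      (extChartAt 𝓘(𝕜, EuclideanSpace 𝕜 (Fin n)) x).symm X
      (Set.range 𝓘(𝕜, EuclideanSpace 𝕜 (Fin n))) :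
        EuclideanSpace 𝕜 (Fin n) → EuclideanSpace 𝕜 (Fin n))
      =ᶠ[𝓝 (extChartAt 𝓘(𝕜, EuclideanSpace 𝕜 (Fin n)) x x)] locField 𝕜 n x X := by
  filter_upwards [extChartAt_target_mem_nhds (I := 𝓘(𝕜, EuclideanSpace 𝕜 (Fin n))) x] with z hz
  have hA := isInvertible_mfderivWithin_extChartAt_symm hz
  have hBA := mfderiv_extChartAt_comp_mfderivWithin_extChartAt_symm hz
  have hsrc : (extChartAt 𝓘(𝕜, EuclideanSpace 𝕜 (Fin n)) x).symm z ∈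
      (chartAt (EuclideanSpace 𝕜 (Fin n)) x).source := by
    have := (extChartAt 𝓘(𝕜, EuclideanSpace 𝕜 (Fin n)) x).map_target hz
    rwa [extChartAt_source] at this
  have h1 : ∀ v, (mfderivWithin 𝓘(𝕜, EuclideanSpace 𝕜 (Fin n)) 𝓘(𝕜, EuclideanSpace 𝕜 (Fin n))
      (extChartAt 𝓘(𝕜, EuclideanSpace 𝕜 (Fin n)) x).symm
      (Set.range 𝓘(𝕜, EuclideanSpace 𝕜 (Fin n))) z).inverse v =
      mfderiv 𝓘(𝕜, EuclideanSpace 𝕜 (Fin n)) 𝓘(𝕜, EuclideanSpace 𝕜 (Fin n))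
        (extChartAt 𝓘(𝕜, EuclideanSpace 𝕜 (Fin n)) x)
        ((extChartAt 𝓘(𝕜, EuclideanSpace 𝕜 (Fin n)) x).symm z) v := by
    intro v
    obtain ⟨w, rfl⟩ := hA.surjective v
    have h2 := DFunLike.congr_fun hBA w
    rw [hA.inverse_apply_self]
    exact h2.symm
  have h3 : ∀ i, (EuclideanSpace.proj i : EuclideanSpace 𝕜 (Fin n) →L[𝕜] 𝕜)
      ((mfderivWithin 𝓘(𝕜, EuclideanSpace 𝕜 (Fin n)) 𝓘(𝕜, EuclideanSpace 𝕜 (Fin n))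
      (extChartAt 𝓘(𝕜, EuclideanSpace 𝕜 (Fin n)) x).symm
      (Set.range 𝓘(𝕜, EuclideanSpace 𝕜 (Fin n))) z).inverse
        (X ((extChartAt 𝓘(𝕜, EuclideanSpace 𝕜 (Fin n)) x).symm z))) =
      locField 𝕜 n x X z i := by
    intro i
    rw [h1]
    exact (diff_crd hsrc i _).symm
  ext i
  exact h3 i

theorem lieBracketWithin_univ_congr {E : Type*} [NormedAddCommGroup E] [NormedSpace 𝕜 E]
    {F F' G G' : E → E} {z : E} (hF : F =ᶠ[𝓝 z] F') (hG : G =ᶠ[𝓝 z] G') :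
    VectorField.lieBracketWithin 𝕜 F G Set.univ z = fderiv 𝕜 G' z (F' z) - fderiv 𝕜 F' z (G' z) := by
  rw [VectorField.lieBracketWithin_univ, VectorField.lieBracket, hF.fderiv_eq, hG.fderiv_eq,
    hF.self_of_nhds, hG.self_of_nhds]

theorem diff_crd_mlieBracket (hX : X ∈ (vectorFields 𝕜 n V).sec x)
    (hY : Y ∈ (vectorFields 𝕜 n V).sec x) (i : Fin n) :
    diff (crd 𝕜 n x i) x (VectorField.mlieBracket 𝓘(𝕜, EuclideanSpace 𝕜 (Fin n)) X Y x) =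
      diff (fun y => diff (crd 𝕜 n x i) y (Y y)) x (X x) -
        diff (fun y => diff (crd 𝕜 n x i) y (X y)) x (Y x) := by
  have hx := mem_chart_source (EuclideanSpace 𝕜 (Fin n)) x
  have hinv := isInvertible_mfderiv_extChartAt
    (mem_extChartAt_source (I := 𝓘(𝕜, EuclideanSpace 𝕜 (Fin n))) x)
  have hval : ∀ X : ∀ y : V, TangentSpace 𝓘(𝕜, EuclideanSpace 𝕜 (Fin n)) y,
      locField 𝕜 n x X (extChartAt 𝓘(𝕜, EuclideanSpace 𝕜 (Fin n)) x x) =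
      mfderiv 𝓘(𝕜, EuclideanSpace 𝕜 (Fin n)) 𝓘(𝕜, EuclideanSpace 𝕜 (Fin n))
        (extChartAt 𝓘(𝕜, EuclideanSpace 𝕜 (Fin n)) x) x (X x) := by
    intro X
    ext i
    refine Eq.trans ?_ (diff_crd hx i (X x))
    change diff (crd 𝕜 n x i) ((extChartAt 𝓘(𝕜, EuclideanSpace 𝕜 (Fin n)) x).symm
      (extChartAt 𝓘(𝕜, EuclideanSpace 𝕜 (Fin n)) x x)) (X _) = _
    rw [extChartAt_to_inv]
  have hder : ∀ {X Y : ∀ y : V, TangentSpace 𝓘(𝕜, EuclideanSpace 𝕜 (Fin n)) y},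
      Y ∈ (vectorFields 𝕜 n V).sec x →
      (EuclideanSpace.proj i : EuclideanSpace 𝕜 (Fin n) →L[𝕜] 𝕜)
        (fderiv 𝕜 (locField 𝕜 n x Y) (extChartAt 𝓘(𝕜, EuclideanSpace 𝕜 (Fin n)) x x)
        (locField 𝕜 n x X (extChartAt 𝓘(𝕜, EuclideanSpace 𝕜 (Fin n)) x x))) =
      diff (fun y => diff (crd 𝕜 n x i) y (Y y)) x (X x) := by
    intro X Y hY
    have hd : DifferentiableAt 𝕜 (locField 𝕜 n x Y)
        (extChartAt 𝓘(𝕜, EuclideanSpace 𝕜 (Fin n)) x x) :=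
      (differentiableAt_piLp 2).2 fun j => (smoothNear_diff_crd hx j hY).differentiableAt_loc hx
    have h1 := ((EuclideanSpace.proj i :
      EuclideanSpace 𝕜 (Fin n) →L[𝕜] 𝕜).hasFDerivAt.comp _ hd.hasFDerivAt).fderiv
    rw [diff_eq_fderiv_loc hx (smoothNear_diff_crd hx i hY), ← hval]
    exact (DFunLike.congr_fun h1 _).symm
  have hbr : mfderiv 𝓘(𝕜, EuclideanSpace 𝕜 (Fin n)) 𝓘(𝕜, EuclideanSpace 𝕜 (Fin n))
        (extChartAt 𝓘(𝕜, EuclideanSpace 𝕜 (Fin n)) x) x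
        (VectorField.mlieBracket 𝓘(𝕜, EuclideanSpace 𝕜 (Fin n)) X Y x) =
      VectorField.lieBracketWithin 𝕜
        (VectorField.mpullbackWithin 𝓘(𝕜, EuclideanSpace 𝕜 (Fin n))
          𝓘(𝕜, EuclideanSpace 𝕜 (Fin n)) (extChartAt 𝓘(𝕜, EuclideanSpace 𝕜 (Fin n)) x).symm X
          (Set.range 𝓘(𝕜, EuclideanSpace 𝕜 (Fin n))) :
          EuclideanSpace 𝕜 (Fin n) → EuclideanSpace 𝕜 (Fin n))
        (VectorField.mpullbackWithin 𝓘(𝕜, EuclideanSpace 𝕜 (Fin n))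
          𝓘(𝕜, EuclideanSpace 𝕜 (Fin n)) (extChartAt 𝓘(𝕜, EuclideanSpace 𝕜 (Fin n)) x).symm Y
          (Set.range 𝓘(𝕜, EuclideanSpace 𝕜 (Fin n))) :
          EuclideanSpace 𝕜 (Fin n) → EuclideanSpace 𝕜 (Fin n))
        ((extChartAt 𝓘(𝕜, EuclideanSpace 𝕜 (Fin n)) x).symm ⁻¹' Set.univ ∩
          Set.range 𝓘(𝕜, EuclideanSpace 𝕜 (Fin n)))
        (extChartAt 𝓘(𝕜, EuclideanSpace 𝕜 (Fin n)) x x) := by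
    rw [VectorField.mlieBracket, VectorField.mlieBracketWithin_apply]
    exact hinv.self_apply_inverse _
  rw [diff_crd hx, hbr]
  have huniv : (extChartAt 𝓘(𝕜, EuclideanSpace 𝕜 (Fin n)) x).symm ⁻¹' Set.univ ∩
      Set.range 𝓘(𝕜, EuclideanSpace 𝕜 (Fin n)) = Set.univ := by simp
  rw [huniv]
  refine (congrArg (EuclideanSpace.proj i : EuclideanSpace 𝕜 (Fin n) →L[𝕜] 𝕜)
    (lieBracketWithin_univ_congr (mpullbackWithin_eventuallyEq x X)
      (mpullbackWithin_eventuallyEq x Y))).trans ?_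
  rw [map_sub, hder hX, hder hY]

/-- The bracket of vector fields is the commutator of the derivations they define. -/
theorem diff_mlieBracket (hX : X ∈ (vectorFields 𝕜 n V).sec x)
    (hY : Y ∈ (vectorFields 𝕜 n V).sec x) {f : V → 𝕜} (hf : SmoothNear 𝕜 n x f) :
    diff f x (VectorField.mlieBracket 𝓘(𝕜, EuclideanSpace 𝕜 (Fin n)) X Y x) =
      diff (fun y => diff f y (Y y)) x (X x) - diff (fun y => diff f y (X y)) x (Y x) := by
  have hx := mem_chart_source (EuclideanSpace 𝕜 (Fin n)) x
  -- In `X (Y f)` the terms with second derivatives of `f` are symmetric in `X` and `Y` by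
  -- `pd_comm`; they drop out of the commutator, and the first-order terms are those of the bracket.
  have key : ∀ {X Y : ∀ y : V, TangentSpace 𝓘(𝕜, EuclideanSpace 𝕜 (Fin n)) y},
      X ∈ (vectorFields 𝕜 n V).sec x → Y ∈ (vectorFields 𝕜 n V).sec x →
      diff (fun y => diff f y (Y y)) x (X x) =
        ∑ i, diff (fun y => diff (crd 𝕜 n x i) y (Y y)) x (X x) * pd n x i f x +
        ∑ i, ∑ j, diff (crd 𝕜 n x i) x (Y x) * diff (crd 𝕜 n x j) x (X x) *
          pd n x j (pd n x i f) x := by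
    intro X Y hX hY
    have h1 : (fun y => diff f y (Y y)) =ᶠ[𝓝 x]
        fun y => ∑ i, diff (crd 𝕜 n x i) y (Y y) * pd n x i f y := by
      filter_upwards [hf.eventually, eventually_source hx] with z h1 h2
      exact diff_eq_sum h2 h1 _
    have h2 : ∀ s : Finset (Fin n), SmoothNear 𝕜 n x
          (fun y => ∑ i ∈ s, diff (crd 𝕜 n x i) y (Y y) * pd n x i f y) ∧
        diff (fun y => ∑ i ∈ s, diff (crd 𝕜 n x i) y (Y y) * pd n x i f y) x (X x) =
        ∑ i ∈ s, (diff (fun y => diff (crd 𝕜 n x i) y (Y y)) x (X x) * pd n x i f x +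
          diff (crd 𝕜 n x i) x (Y x) * diff (pd n x i f) x (X x)) := by
      intro s
      induction s using Finset.cons_induction with
      | empty => exact ⟨by simpa using SmoothNear.const x 0, by simpa using diff_const 0 (X x)⟩
      | cons i s hi ih =>
        simp only [Finset.sum_cons]
        have h3 := smoothNear_diff_crd hx i hY
        refine ⟨(h3.mul (hf.pd hx i)).add ih.1, ?_⟩
        rw [diff_add (h3.mul (hf.pd hx i)) ih.1, ih.2, diff_mul h3 (hf.pd hx i)]
        ring
    rw [diff_congr h1, (h2 Finset.univ).2, Finset.sum_add_distrib]
    congr 1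
    refine Finset.sum_congr rfl fun i _ => ?_
    rw [diff_eq_sum hx (hf.pd hx i), Finset.mul_sum]
    exact Finset.sum_congr rfl fun j _ => by ring
  rw [key hX hY, key hY hX, diff_eq_sum hx hf]
  simp only [diff_crd_mlieBracket hX hY, sub_mul, Finset.sum_sub_distrib]
  have hsym : ∑ i, ∑ j, diff (crd 𝕜 n x i) x (X x) * diff (crd 𝕜 n x j) x (Y x) *
      pd n x j (pd n x i f) x = ∑ i, ∑ j, diff (crd 𝕜 n x i) x (Y x) *
        diff (crd 𝕜 n x j) x (X x) * pd n x j (pd n x i f) x := by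
    rw [Finset.sum_comm]
    refine Finset.sum_congr rfl fun i _ => Finset.sum_congr rfl fun j _ => ?_
    rw [pd_comm hx hf]
    ring
  rw [hsym]
  ring

end Bracket

/-! ### The connection defined by a splitting of `J^1 W → W`. -/

section SplittingConnection

variable {𝕜 : Type*} [RCLike 𝕜] {n : ℕ} {V : Type*} [TopologicalSpace V]
  [ChartedSpace (EuclideanSpace 𝕜 (Fin n)) V]
  [IsManifold 𝓘(𝕜, EuclideanSpace 𝕜 (Fin n)) ∞ V]
  {W : V → Type*} [∀ y, AddCommGroup (W y)] [∀ y, Module 𝕜 (W y)]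
  {S : SmoothStr 𝕜 n W} {x : V}

theorem diff_neg {f : V → 𝕜} (hf : SmoothNear 𝕜 n x f)
    (X : TangentSpace 𝓘(𝕜, EuclideanSpace 𝕜 (Fin n)) x) :
    diff (fun z => -f z) x X = -diff f x X := by
  have h1 := diff_mul (SmoothNear.const x (-1 : 𝕜)) hf X
  rw [diff_const, zero_mul, add_zero] at h1
  simpa using h1

theorem diff_sub {f g : V → 𝕜} (hf : SmoothNear 𝕜 n x f) (hg : SmoothNear 𝕜 n x g)
    (X : TangentSpace 𝓘(𝕜, EuclideanSpace 𝕜 (Fin n)) x) :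
    diff (fun z => f z - g z) x X = diff f x X - diff g x X := by
  have h1 := diff_add hf hg.neg X
  rw [diff_neg hg] at h1
  simpa only [sub_eq_add_neg] using h1

theorem smoothNear_sum_and_diff_sum {ι : Type*} (s : Finset ι) {f : ι → V → 𝕜}
    (hf : ∀ i, SmoothNear 𝕜 n x (f i)) (X : TangentSpace 𝓘(𝕜, EuclideanSpace 𝕜 (Fin n)) x) :
    diff (fun z => ∑ i ∈ s, f i z) x X = ∑ i ∈ s, diff (f i) x X := by
  induction s using Finset.cons_induction with
  | empty => simpa using diff_const 0 X
  | cons i s hi ih =>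
    simp only [Finset.sum_cons]
    rw [diff_add (hf i) (SmoothNear.sum s fun i _ => hf i), ih]

theorem diff_eq_zero_of_mem_van {f : V → 𝕜} (hf : f ∈ van (fnStr 𝕜 n V) 2 x)
    (X : TangentSpace 𝓘(𝕜, EuclideanSpace 𝕜 (Fin n)) x) : diff f x X = 0 := by
  have hx := mem_chart_source (EuclideanSpace 𝕜 (Fin n)) x
  rw [diff_eq_sum hx (smoothNear_of_mem_van hf)]
  exact Finset.sum_eq_zero fun i _ => by
    rw [eq_zero_of_mem_van_succ (pd_mem_van hx i hf), mul_zero]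

theorem mem_van_two_of_diff {f : V → 𝕜} (hf : SmoothNear 𝕜 n x f) (h0 : f x = 0)
    (h : ∀ X : TangentSpace 𝓘(𝕜, EuclideanSpace 𝕜 (Fin n)) x, diff f x X = 0) :
    f ∈ van (fnStr 𝕜 n V) 2 x := by
  have hx := mem_chart_source (EuclideanSpace 𝕜 (Fin n)) x
  refine mem_van_succ_of_pd hx hf h0 fun i => mem_van_one_fn (hf.pd hx i) ?_
  rw [← diff_coordField hx hf]
  exact h _

theorem sum_smul_mem_sec {ι : Type*} [Fintype ι] {f : ι → V → 𝕜} {τ : ι → ∀ y, W y}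
    (hf : ∀ i, SmoothNear 𝕜 n x (f i)) (hτ : ∀ i, τ i ∈ S.sec x) :
    (fun y => ∑ i, f i y • τ i y) ∈ S.sec x := by
  have := Submodule.sum_mem (S.sec x) (t := Finset.univ) (f := fun i y => f i y • τ i y)
    fun i _ => S.smul_mem (hf i) (hτ i)
  convert this using 1
  funext y
  simp

namespace IsFrame

variable {ι : Type*} [Fintype ι] {e : ι → ∀ y, W y} {lam : ι → ∀ y, W y →ₗ[𝕜] 𝕜}

theorem ext (H : IsFrame S e lam x) {v w : W x} (h : ∀ i, lam i x v = lam i x w) : v = w := by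
  rw [← H.repr.self_of_nhds v, ← H.repr.self_of_nhds w]
  simp [h]

/-- The differential of a coefficient sees `f τ`, where `f` vanishes at `x`, as `df` times the
coefficient of `τ`, and kills whatever vanishes to order two. So `α` can be read off from the jet,
which gives `hom_unique`. -/
theorem lam_hom (H : IsFrame S e lam x)
    {α : TangentSpace 𝓘(𝕜, EuclideanSpace 𝕜 (Fin n)) x →ₗ[𝕜] W x} {t : ∀ y, W y}
    (ht : t ∈ S.sec x) (h : IsImageOfHom S x α (JetPDE.jet S 1 t x)) (i : ι)
    (X : TangentSpace 𝓘(𝕜, EuclideanSpace 𝕜 (Fin n)) x) :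
    lam i x (α X) = diff (fun z => lam i z (t z)) x X := by
  obtain ⟨N, f, τ, hfτ, hα, hv⟩ := h
  have hsec : (fun y => ∑ l, f l y • τ l y) ∈ S.sec x :=
    sum_smul_mem_sec (fun l => (hfτ l).1) fun l => (hfτ l).2.2
  have h1 := map_mem_van (S' := fnStr 𝕜 n V) (lam i) (fun s hs => H.coeff_smooth hs i) 2 _
    ((jet_eq_iff ht hsec).1 hv)
  have h2 := diff_eq_zero_of_mem_van h1 X
  have h3 := fun l => H.coeff_smooth (hfτ l).2.2 i
  have h4 : (fun z => lam i z ((t - fun y => ∑ l, f l y • τ l y) z)) = fun z =>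
      lam i z (t z) - ∑ l, f l z * lam i z (τ l z) := by
    funext z
    simp
  rw [h4, diff_sub (H.coeff_smooth ht i) (SmoothNear.sum _ fun l _ => (hfτ l).1.mul (h3 l)),
    sub_eq_zero, smoothNear_sum_and_diff_sum _ fun l => (hfτ l).1.mul (h3 l)] at h2
  rw [h2, hα, map_sum]
  refine Finset.sum_congr rfl fun l _ => ?_
  rw [diff_mul (hfτ l).1 (h3 l), (hfτ l).2.1, map_smul, smul_eq_mul, zero_mul, zero_add]

theorem hom_unique (H : IsFrame S e lam x)
    {α β : TangentSpace 𝓘(𝕜, EuclideanSpace 𝕜 (Fin n)) x →ₗ[𝕜] W x} {v : Jet S 1 x}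
    (h : IsImageOfHom S x α v) (h' : IsImageOfHom S x β v) : α = β := by
  obtain ⟨t, ht, rfl⟩ := exists_jet_eq v
  refine LinearMap.ext fun X => H.ext fun i => ?_
  rw [H.lam_hom ht h, H.lam_hom ht h']

/-- The coefficients of `t` in the frame vanish at `x`, so the expansion of `t` is already of the
form that `IsImageOfHom` asks for. -/
theorem exists_hom (H : IsFrame S e lam x) {t : ∀ y, W y} (ht : t ∈ S.sec x) (h0 : t x = 0) :
    ∃ α, IsImageOfHom S x α (JetPDE.jet S 1 t x) := by
  let g := (Fintype.equivFin ι).symm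
  refine ⟨∑ l, (diff (fun z => lam (g l) z (t z)) x).smulRight (e (g l) x), Fintype.card ι,
    fun l z => lam (g l) z (t z), fun l => e (g l),
    fun l => ⟨H.coeff_smooth ht _, by simp [h0], H.mem _⟩, fun X => by simp, ?_⟩
  refine jet_congr ht ?_
  filter_upwards [H.repr] with y hy
  rw [g.sum_comp (fun i => lam i y (t y) • e i y), hy]

end IsFrame

variable (S) in
open scoped Classical in
/-- The covariant derivative `j^1 σ - u(σ)` of a splitting `u`. -/
def covDeriv (u : ∀ x, W x →ₗ[𝕜] Jet S 1 x) (σ : ∀ y, W y) (x : V) :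
    TangentSpace 𝓘(𝕜, EuclideanSpace 𝕜 (Fin n)) x →ₗ[𝕜] W x :=
  if h : ∃ α, IsImageOfHom S x α (jet S 1 σ x - u x (σ x)) then h.choose else 0

/-- `u` is a splitting of `J^1 W → W`. -/
def IsSplitting (S : SmoothStr 𝕜 n W) (u : ∀ x, W x →ₗ[𝕜] Jet S 1 x) : Prop :=
  ∀ x w, ∀ t ∈ S.sec x, jet S 1 t x = u x w → t x = w

section

variable {u : ∀ x, W x →ₗ[𝕜] Jet S 1 x} {r : ℕ} {σ : ∀ y, W y}

theorem IsSplitting.covDeriv_spec (hu : IsSplitting S u) (hS : HasFrames S r)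
    (hσ : σ ∈ S.sec x) : IsImageOfHom S x (covDeriv S u σ x) (jet S 1 σ x - u x (σ x)) := by
  have h : ∃ α, IsImageOfHom S x α (jet S 1 σ x - u x (σ x)) := by
    obtain ⟨t, ht, hjt⟩ := exists_jet_eq (u x (σ x))
    obtain ⟨e, lam, H⟩ := hS x
    rw [← hjt, ← jet_sub hσ ht]
    exact H.exists_hom (Submodule.sub_mem _ hσ ht) (sub_eq_zero.2 (hu x _ t ht hjt).symm)
  rw [covDeriv, dif_pos h]
  exact h.choose_spec

/-- Any section `t` that represents `u x (σ x)` may be used, which turns additivity and the Leibniz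
rule into identities between differentials. -/
theorem IsSplitting.lam_covDeriv (hu : IsSplitting S u) (hS : HasFrames S r) {ι : Type*}
    [Fintype ι] {e : ι → ∀ y, W y} {lam : ι → ∀ y, W y →ₗ[𝕜] 𝕜} (H : IsFrame S e lam x)
    (hσ : σ ∈ S.sec x) {t : ∀ y, W y} (ht : t ∈ S.sec x) (hjt : jet S 1 t x = u x (σ x)) (i : ι)
    (X : TangentSpace 𝓘(𝕜, EuclideanSpace 𝕜 (Fin n)) x) :
    lam i x (covDeriv S u σ x X) =
      diff (fun z => lam i z (σ z)) x X - diff (fun z => lam i z (t z)) x X := by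
  have h1 := hu.covDeriv_spec hS hσ
  rw [← hjt, ← jet_sub hσ ht] at h1
  rw [H.lam_hom (Submodule.sub_mem _ hσ ht) h1,
    ← diff_sub (H.coeff_smooth hσ i) (H.coeff_smooth ht i)]
  simp only [Pi.sub_apply, map_sub]

theorem IsSplitting.covDeriv_eq_zero_iff (hu : IsSplitting S u) (hS : HasFrames S r)
    (hσ : σ ∈ S.sec x) : covDeriv S u σ x = 0 ↔ jet S 1 σ x = u x (σ x) := by
  obtain ⟨e, lam, H⟩ := hS x
  obtain ⟨t, ht, hjt⟩ := exists_jet_eq (u x (σ x))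
  have htx := hu x _ t ht hjt
  constructor
  · intro h
    rw [← hjt, jet_eq_iff hσ ht]
    refine H.mem_van_iff.2 fun i => ?_
    refine mem_van_two_of_diff (H.coeff_smooth (Submodule.sub_mem _ hσ ht) i) (by simp [htx])
      fun X => ?_
    simp only [Pi.sub_apply, map_sub]
    rw [diff_sub (H.coeff_smooth hσ i) (H.coeff_smooth ht i),
      ← hu.lam_covDeriv hS H hσ ht hjt, h]
    simp
  · intro h
    refine LinearMap.ext fun X => H.ext fun i => ?_
    rw [hu.lam_covDeriv hS H hσ hσ h]
    simp

/-- The connection attached to a splitting with smooth covariant derivative. -/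
def IsSplitting.connection (hu : IsSplitting S u) (hS : HasFrames S r)
    (hsm : ∀ (x : V), ∀ σ ∈ S.sec x, ∀ X ∈ (vectorFields 𝕜 n V).sec x,
      (fun y => covDeriv S u σ y (X y)) ∈ S.sec x) : Connection S where
  toFun := covDeriv S u
  add x σ hσ τ hτ := by
    obtain ⟨e, lam, H⟩ := hS x
    obtain ⟨s, hs, hjs⟩ := exists_jet_eq (u x (σ x))
    obtain ⟨t, ht, hjt⟩ := exists_jet_eq (u x (τ x))
    refine LinearMap.ext fun X => H.ext fun i => ?_
    rw [LinearMap.add_apply, map_add, hu.lam_covDeriv hS H hσ hs hjs,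
      hu.lam_covDeriv hS H hτ ht hjt,
      hu.lam_covDeriv hS H (Submodule.add_mem _ hσ hτ) (Submodule.add_mem _ hs ht)
        (by rw [jet_add hs ht, hjs, hjt, Pi.add_apply, map_add])]
    simp only [Pi.add_apply, map_add]
    rw [diff_add (H.coeff_smooth hσ i) (H.coeff_smooth hτ i),
      diff_add (H.coeff_smooth hs i) (H.coeff_smooth ht i)]
    ring
  leibniz x f hf σ hσ X := by
    obtain ⟨e, lam, H⟩ := hS x
    obtain ⟨t, ht, hjt⟩ := exists_jet_eq (u x (σ x))
    refine H.ext fun i => ?_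
    rw [map_add, map_smul, map_smul, hu.lam_covDeriv hS H hσ ht hjt,
      -- The splitting sees only the value `f(x) σ(x)`, so it is represented by the constant
      -- multiple `f(x) t`.
      hu.lam_covDeriv hS H (S.smul_mem hf hσ) (Submodule.smul_mem _ (f x) ht)
        (by rw [jet_smul _ ht, hjt, map_smul])]
    simp only [Pi.smul_apply, map_smul, smul_eq_mul]
    rw [diff_mul hf (H.coeff_smooth hσ i),
      diff_mul (SmoothNear.const x (f x)) (H.coeff_smooth ht i), diff_const]
    ring
  smooth := hsm

end

end SplittingConnection

/-! ### The tautological connection on `R_H`. -/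

section Tautological

variable {𝕜 : Type*} [RCLike 𝕜] {n : ℕ} {V : Type*} [TopologicalSpace V]
  [ChartedSpace (EuclideanSpace 𝕜 (Fin n)) V]
  [IsManifold 𝓘(𝕜, EuclideanSpace 𝕜 (Fin n)) ∞ V]
  {W : V → Type*} [∀ y, AddCommGroup (W y)] [∀ y, Module 𝕜 (W y)]
  {W' : V → Type*} [∀ y, AddCommGroup (W' y)] [∀ y, Module 𝕜 (W' y)]
  {S : SmoothStr 𝕜 n W} {S' : SmoothStr 𝕜 n W'} {k : ℕ} {D : DiffOp S S' k} {x : V} {p q H : ℕ}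

namespace DiffOp.IsRigid

/-- A section `t` of `R_H` with `j^1_x t = u(e)` has the same `1`-jet at `x` as `j^H s` for a
section `s` with `j^(H+1)_x s ∈ R_(H+1)` lying over `e`. -/
theorem exists_lift (hD : D.IsRigid p q H) (e : D.formalSol H x) :
    ∃ s ∈ S.sec x, jet S (H + 1) s x ∈ D.formalSol (H + 1) x ∧ jet S H s x = e ∧
      ∀ t ∈ (D.solStr H).sec x, jet (D.solStr H) 1 t x = hD.splitting x e ↔
        (fun y => (t y : Jet S H y)) - jet S H s ∈ van (jetStr S H) 2 x := by
  obtain ⟨r, hr, hre⟩ := (hD.bijOn x).surjOn e.2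
  obtain ⟨s, hs, rfl⟩ := exists_jet_eq r
  rw [jetProj_jet _ hs] at hre
  refine ⟨s, hs, hr, hre, fun t ht => ?_⟩
  have h1 := hD.jetIncl_splitting hr (e := e) (by rw [jetProj_jet _ hs, hre])
  rw [jetJet_jet hs] at h1
  rw [← jet_eq_iff (S := jetStr S H) ht (jet_mem_sec hs), ← h1]
  constructor
  · intro h
    rw [← h]
    exact (jetIncl_jet (S := jetStr S H) ht).symm
  · intro h
    refine hD.jetIncl_injective 1 x ?_
    exact (jetIncl_jet (S := jetStr S H) ht).trans h

theorem isSplitting (hD : D.IsRigid p q H) : IsSplitting (D.solStr H) hD.splitting := by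
  intro x e t ht h
  obtain ⟨s, hs, -, hse, h1⟩ := hD.exists_lift e
  have h2 := eq_zero_of_mem_van_succ ((h1 t ht).1 h)
  rw [Pi.sub_apply, sub_eq_zero, hse] at h2
  exact Subtype.ext h2

/-- A section of `R_H` lifts to a section of `R_(H+1)`. -/
theorem exists_section_lift (hD : D.IsRigid p q H) {σ : ∀ y, D.formalSol H y}
    (hσ : σ ∈ (D.solStr H).sec x) : ∃ τ : ∀ y, Jet S (H + 1) y, τ ∈ (jetStr S (H + 1)).sec x ∧
      ∀ᶠ y in 𝓝 x, τ y ∈ D.formalSol (H + 1) y ∧ jetProj S (Nat.le_succ H) y (τ y) = σ y := by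
  -- The projection is an isomorphism on fibres, so it carries the frame `ρ` of `R_(H+1)` to a frame
  -- of `R_H`; the coefficients of `σ` in the latter define the lift.
  obtain ⟨ρ, μ, Hρ⟩ := hD.hasFrames_succ x
  obtain ⟨e, lam, He⟩ := hD.hasFrames x
  have hv : ∀ a, (fun y => hD.projEquiv y (ρ a y)) ∈ (D.solStr H).sec x := fun a =>
    jetStr_map_mem (S' := jetStr S H) (jetProj S (Nat.le_succ H))
      (fun s hs => (jetStr S H).congr (jet_mem_sec hs) (by
        filter_upwards [S.eventually_mem hs] with y hy
        exact (jetProj_jet _ hy).symm)) (Hρ.mem a)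
  obtain ⟨lam', H'⟩ := He.of_basis (e' := fun a y => hD.projEquiv y (ρ a y)) hv
    (Hρ.linearIndependent.map' (hD.projEquiv x).toLinearMap (LinearEquiv.ker _)) rfl
  refine ⟨fun y => ((∑ a, lam' a y (σ y) • ρ a y : D.formalSol (H + 1) y) : Jet S (H + 1) y),
    Hρ.combination_mem fun a => H'.coeff_smooth hσ a, ?_⟩
  filter_upwards [H'.repr] with y hy
  refine ⟨Subtype.prop _, ?_⟩
  rw [← hD.projEquiv_coe]
  congr 1
  simp only [map_sum, map_smul]
  exact hy (σ y)

/-- A section of a jet bundle is locally a finite combination of jets of sections. -/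
theorem _root_.JetPDE.HasFrames.exists_jet_sum (hS : HasFrames S p) {h : ℕ}
    {τ : ∀ y, Jet S h y} (hτ : τ ∈ (jetStr S h).sec x) :
    ∃ (N : ℕ) (f : Fin N → V → 𝕜) (s : Fin N → ∀ y, W y), (∀ i, SmoothNear 𝕜 n x (f i)) ∧
      (∀ i, s i ∈ S.sec x) ∧ ∀ᶠ y in 𝓝 x, τ y = ∑ i, f i y • jet S h (s i) y := by
  obtain ⟨e, lam, He⟩ := hS x
  obtain ⟨lam', H'⟩ := He.jet h
  let g := (Fintype.equivFin (Sym (Option (Fin n)) h × Fin p)).symm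
  refine ⟨_, fun a z => lam' (g a) z (τ z),
    fun a z => mono 𝕜 n x (symPart (g a).1) z • e (g a).2 z, fun a => H'.coeff_smooth hτ _,
    fun a => S.smul_mem (smoothNear_mono (mem_chart_source _ x) _) (He.mem _), ?_⟩
  filter_upwards [H'.repr] with y hy
  rw [g.sum_comp (fun a => lam' a y (τ y) •
    jet S h (fun z => mono 𝕜 n x (symPart a.1) z • e a.2 z) y)]
  exact (hy (τ y)).symm

/-- For a lift `τ = ∑ f_i j^(H+1) s_i` of `σ` one has `∇_X σ = ∑ X(f_i) j^H s_i`, a smooth section.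
Indeed `u (σ y)` is the 1-jet at `y` of `∑ f_i(y) j^H s_i`, and subtracting it from `j^1 σ` leaves
the 1-jet of `∑ (f_i - f_i(y)) j^H s_i`. -/
theorem covDeriv_smooth (hD : D.IsRigid p q H) {σ : ∀ y, D.formalSol H y}
    (hσ : σ ∈ (D.solStr H).sec x)
    {X : ∀ y : V, TangentSpace 𝓘(𝕜, EuclideanSpace 𝕜 (Fin n)) y}
    (hX : X ∈ (vectorFields 𝕜 n V).sec x) :
    (fun y => covDeriv (D.solStr H) hD.splitting σ y (X y)) ∈ (D.solStr H).sec x := by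
  obtain ⟨τ, hτ, hτσ⟩ := hD.exists_section_lift hσ
  obtain ⟨N, f, s, hf, hs, hτs⟩ := hD.frames.exists_jet_sum hτ
  have hsum : (fun y => ∑ i, diff (f i) y (X y) • jet S H (s i) y) ∈ (jetStr S H).sec x :=
    sum_smul_mem_sec (fun i => (hf i).diff hX) fun i => jet_mem_sec (hs i)
  refine (jetStr S H).congr hsum ?_
  filter_upwards [eventually_eventually_nhds.2 (hτs.and hτσ), (D.solStr H).eventually_mem hσ,
    eventually_all.2 fun i => (hf i).eventually, eventually_all.2 fun i => S.eventually_mem (hs i)]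
    with y h1 hσy hfy hsy
  obtain ⟨h2, h3, h4⟩ := h1.self_of_nhds
  obtain ⟨e, lam, He⟩ := hD.frames.jet H y
  have hσsum : ∀ᶠ z in 𝓝 y, (σ z : Jet S H z) = ∑ i, f i z • jet S H (s i) z := by
    filter_upwards [h1, eventually_all.2 fun i => S.eventually_mem (hsy i)] with z h5 h6
    rw [← h5.2.2, h5.1, map_sum]
    exact Finset.sum_congr rfl fun i _ => by rw [map_smul, jetProj_jet _ (h6 i)]
  -- The comparison is made in `J^1 (J^H W)`, since the single sections `j^H s_i` need not lie in
  -- `R_H`.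
  have hincl : ∀ (α : TangentSpace 𝓘(𝕜, EuclideanSpace 𝕜 (Fin n)) y →ₗ[𝕜] D.formalSol H y)
      (v : Jet (D.solStr H) 1 y), IsImageOfHom (D.solStr H) y α v →
      IsImageOfHom (jetStr S H) y ((D.formalSol H y).subtype ∘ₗ α)
        (jetIncl (jetStr S H) (D.formalSol H) 1 y v) := by
    rintro α v ⟨M, g, θ, hg, hα, rfl⟩
    refine ⟨M, g, fun i z => θ i z, hg, fun X => by simp [hα], ?_⟩
    refine (jetIncl_jet (S := jetStr S H) ?_).trans ?_
    · exact sum_smul_mem_sec (S := D.solStr H) (fun i => (hg i).1) fun i => (hg i).2.2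
    · congr 1
      funext z
      simp
  have h5 := hincl _ _ (hD.isSplitting.covDeriv_spec hD.hasFrames hσy)
  have h6 : IsImageOfHom (jetStr S H) y (∑ i, (diff (f i) y).smulRight (jet S H (s i) y))
      (jetIncl (jetStr S H) (D.formalSol H) 1 y
        (jet (D.solStr H) 1 σ y - hD.splitting y (σ y))) := by
    refine ⟨N, fun i z => f i z - f i y, fun i => jet S H (s i),
      fun i => ⟨(hfy i).sub (SmoothNear.const y _), sub_self _, jet_mem_sec (hsy i)⟩,
      fun X => ?_, ?_⟩
    · rw [LinearMap.sum_apply]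
      refine Finset.sum_congr rfl fun i _ => ?_
      rw [diff_sub (hfy i) (SmoothNear.const y _), diff_const, sub_zero]
      rfl
    · have hjl : jet (jetStr S H) 1 (fun z => (σ z : Jet S H z)) y =
          jet (jetStr S H) 1 (fun z => ∑ i, f i z • jet S H (s i) z) y :=
        jet_congr hσy hσsum
      have hsec1 : (fun z => ∑ i, f i z • jet S H (s i) z) ∈ (jetStr S H).sec y :=
        (jetStr S H).congr hσy hσsum
      have hsec2 : (∑ i, f i y • jet S H (s i)) ∈ (jetStr S H).sec y :=
        Submodule.sum_mem _ fun i _ => Submodule.smul_mem _ _ (jet_mem_sec (hsy i))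
      have hu : jetIncl (jetStr S H) (D.formalSol H) 1 y (hD.splitting y (σ y)) =
          jet (jetStr S H) 1 (∑ i, f i y • jet S H (s i)) y := by
        rw [hD.jetIncl_splitting h3 h4, h2, map_sum]
        have : ∀ F : Finset (Fin N), jet (jetStr S H) 1 (∑ i ∈ F, f i y • jet S H (s i)) y =
            ∑ i ∈ F, f i y • jet (jetStr S H) 1 (jet S H (s i)) y := by
          intro F
          induction F using Finset.cons_induction with
          | empty =>
            simp only [Finset.sum_empty]
            exact (jet_eq_zero_iff (Submodule.zero_mem _)).2 (Submodule.zero_mem _)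
          | cons i F hi ih =>
            rw [Finset.sum_cons, Finset.sum_cons, jet_add
              (Submodule.smul_mem _ _ (jet_mem_sec (hsy i)))
              (Submodule.sum_mem _ fun i _ => Submodule.smul_mem _ _ (jet_mem_sec (hsy i))),
              ih, jet_smul _ (jet_mem_sec (hsy i))]
        rw [this]
        exact Finset.sum_congr rfl fun i _ => by rw [map_smul, jetJet_jet (hsy i)]
      refine (map_sub (D.solIncl H 1 y) _ _).trans ?_
      refine (congrArg (_ - ·) hu).trans ?_
      refine (congrArg (· - _) ((jetIncl_jet (S := jetStr S H) hσy).trans hjl)).trans ?_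
      refine (jet_sub hsec1 hsec2).symm.trans ?_
      congr 1
      funext z
      simp [sub_smul]
  have h7 := DFunLike.congr_fun (He.hom_unique h5 h6) (X y)
  simpa using h7.symm

/-- The tautological connection. -/
def nabla (hD : D.IsRigid p q H) : Connection (D.solStr H) :=
  hD.isSplitting.connection hD.hasFrames fun _ _ hσ _ hX => hD.covDeriv_smooth hσ hX

theorem nabla_isInducedBy (hD : D.IsRigid p q H) : hD.nabla.IsInducedBy hD.splitting :=
  fun _ _ hσ => hD.isSplitting.covDeriv_spec hD.hasFrames hσ

theorem nabla_unique (hD : D.IsRigid p q H) {nabla' : Connection (D.solStr H)}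
    (h : nabla'.IsInducedBy hD.splitting) (x : V) {σ : ∀ y, D.formalSol H y}
    (hσ : σ ∈ (D.solStr H).sec x) : nabla'.toFun σ x = hD.nabla.toFun σ x := by
  obtain ⟨e, lam, He⟩ := hD.hasFrames x
  exact He.hom_unique (h x σ hσ) (hD.nabla_isInducedBy x σ hσ)

theorem nabla_eq_zero_iff (hD : D.IsRigid p q H) {σ : ∀ y, D.formalSol H y}
    (hσ : σ ∈ (D.solStr H).sec x) :
    hD.nabla.toFun σ x = 0 ↔ jet (D.solStr H) 1 σ x = hD.splitting x (σ x) :=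
  hD.isSplitting.covDeriv_eq_zero_iff hD.hasFrames hσ

end DiffOp.IsRigid

end Tautological

/-! ### Solutions of the equation and flat sections. -/

section Solutions

variable {𝕜 : Type*} [RCLike 𝕜] {n : ℕ} {V : Type*} [TopologicalSpace V]
  [ChartedSpace (EuclideanSpace 𝕜 (Fin n)) V]
  {W : V → Type*} [∀ y, AddCommGroup (W y)] [∀ y, Module 𝕜 (W y)]
  {W' : V → Type*} [∀ y, AddCommGroup (W' y)] [∀ y, Module 𝕜 (W' y)]
  {S : SmoothStr 𝕜 n W} {S' : SmoothStr 𝕜 n W'} {k : ℕ} {D : DiffOp S S' k} {x : V} {p q H : ℕ}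

variable (S) in
/-- The value of a jet at its source. -/
def jetEval (h : ℕ) (x : V) : Jet S h x →ₗ[𝕜] W x :=
  Submodule.liftQ _ ((LinearMap.proj x : (∀ y, W y) →ₗ[𝕜] W x) ∘ₗ (S.sec x).subtype)
    fun _ hs => eq_zero_of_mem_van_succ (S := S) hs

theorem jetEval_jet {h : ℕ} {s : ∀ y, W y} (hs : s ∈ S.sec x) :
    jetEval S h x (jet S h s x) = s x := by
  rw [jet_of_mem hs]
  rfl

theorem jetEval_smooth {h : ℕ} {σ : ∀ y, Jet S h y} (hσ : σ ∈ (jetStr S h).sec x) :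
    (fun y => jetEval S h y (σ y)) ∈ S.sec x :=
  jetStr_map_mem (S' := S) _ (fun s hs => S.congr hs (by
    filter_upwards [S.eventually_mem hs] with y hy
    exact (jetEval_jet hy).symm)) hσ

theorem DiffOp.jet_mem_formalSol_of_solution {s : ∀ y, W y} (hs : s ∈ S.sec x)
    (h0 : ∀ᶠ y in 𝓝 x, D.apply s y = 0) (h : ℕ) : jet S h s x ∈ D.formalSol h x := by
  by_cases hk : k ≤ h
  · obtain ⟨l, rfl⟩ := Nat.exists_eq_add_of_le hk
    exact (DiffOp.jet_mem_formalSol rfl hs).2 (mem_van_of_germ_zero _ _ h0)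
  · rw [DiffOp.formalSol_of_lt (by omega)]
    trivial

variable [IsManifold 𝓘(𝕜, EuclideanSpace 𝕜 (Fin n)) ∞ V]

theorem HasFrames.mem_van_of_jet_mem_van (hS : HasFrames S p) {h j : ℕ} {t : ∀ y, W y}
    (ht : t ∈ S.sec x) (hj : JetPDE.jet S h t ∈ van (jetStr S h) (j + 1) x) : t ∈ van S (h + j + 1) x := by
  obtain ⟨e, lam, He⟩ := hS x
  exact He.mem_van_of_jet_mem_van ht hj

theorem jet_sub_eventuallyEq {h : ℕ} {s t : ∀ y, W y} (hs : s ∈ S.sec x) (ht : t ∈ S.sec x) :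
    ∀ᶠ y in 𝓝 x, (jet S h s - jet S h t) y = jet S h (s - t) y := by
  filter_upwards [S.eventually_mem hs, S.eventually_mem ht] with y h1 h2
  rw [jet_sub h1 h2, Pi.sub_apply]

namespace DiffOp.IsRigid

theorem apply_eq_zero_of_jet_mem (hD : D.IsRigid p q H) {s : ∀ y, W y} (hs : s ∈ S.sec x)
    (h : jet S (H + 1) s x ∈ D.formalSol (H + 1) x) : D.apply s x = 0 := by
  obtain ⟨l, hl⟩ := Nat.exists_eq_add_of_le hD.le
  exact eq_zero_of_mem_van_succ ((DiffOp.jet_mem_formalSol hl.symm hs).1 h)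

/-- The section `j^H s` of `R_H` is flat at `x` if and only if `j^(H+1)_x s ∈ R_(H+1)`. -/
theorem nabla_eq_zero_iff_jet_mem (hD : D.IsRigid p q H) {s : ∀ y, W y} (hs : s ∈ S.sec x)
    {σ : ∀ y, D.formalSol H y} (hσ : ∀ᶠ y in 𝓝 x, (σ y : Jet S H y) = jet S H s y) :
    hD.nabla.toFun σ x = 0 ↔ jet S (H + 1) s x ∈ D.formalSol (H + 1) x := by
  have hσsec : σ ∈ (D.solStr H).sec x :=
    (jetStr S H).congr (jet_mem_sec hs) (hσ.mono fun y hy => hy.symm)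
  obtain ⟨t, ht, htR, htσ, hiff⟩ := hD.exists_lift (σ x)
  rw [hD.nabla_eq_zero_iff hσsec, hiff σ hσsec]
  have hst := Submodule.sub_mem _ hs ht
  have hloc : ∀ᶠ y in 𝓝 x, ((fun y => (σ y : Jet S H y)) - jet S H t) y = jet S H (s - t) y := by
    filter_upwards [hσ, jet_sub_eventuallyEq (h := H) hs ht] with y h1 h2
    rw [← h2, Pi.sub_apply, Pi.sub_apply, h1]
  -- If `σ` is flat at `x`, then `j^H (s - t)` vanishes to order two, so `s` and `t` have the same
  -- `(H+1)`-jet. Conversely, two formal solutions of order `H + 1` with the same projection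
  -- coincide.
  constructor
  · intro h
    have h1 := hD.frames.mem_van_of_jet_mem_van hst (van_congr _ h hloc)
    rwa [(jet_eq_iff hs ht).2 h1]
  · intro h
    have h1 : jet S (H + 1) s x = jet S (H + 1) t x :=
      (hD.bijOn x).injOn h htR (by
        rw [jetProj_jet _ hs, jetProj_jet _ ht, htσ, hσ.self_of_nhds])
    have h2 := (jetOp S H).apply_mem_van ((jet_eq_iff hs ht).1 h1)
    rw [show H + 1 + 1 - H = 2 by omega] at h2
    exact van_congr _ h2 (hloc.mono fun y hy => hy.symm)

/-- A flat section of `R_H` consists of the jets of its values. -/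
theorem jet_eval_eq (hD : D.IsRigid p q H) {U : Set V} (hU : IsOpen U)
    {σ : ∀ y, D.formalSol H y} (hσ : ∀ x ∈ U, σ ∈ (D.solStr H).sec x)
    (h0 : ∀ x ∈ U, hD.nabla.toFun σ x = 0) :
    ∀ x ∈ U, jet S H (fun y => jetEval S H y (σ y)) x = σ x := by
  set s : ∀ y, W y := fun y => jetEval S H y (σ y) with hs_def
  have hs : ∀ x ∈ U, s ∈ S.sec x := fun x hx => jetEval_smooth (hσ x hx)
  -- Flatness says that `σ` agrees with `j^H t` to first order at `x`. In `J^l W`, where `σ`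
  -- projects to `j^l s` by induction, this makes `j^l (s - t)` vanish to order two, so `s` and `t`
  -- have the same `(l+1)`-jet at `x`.
  have key : ∀ l (hl : l ≤ H), ∀ x ∈ U, jet S l s x = jetProj S hl x (σ x) := by
    intro l
    induction l with
    | zero =>
      intro hl x hx
      obtain ⟨t, ht, hjt⟩ := exists_jet_eq (σ x : Jet S H x)
      rw [← hjt, jetProj_jet _ ht, jet_eq_iff (hs x hx) ht]
      refine hD.frames.mem_van_one (Submodule.sub_mem _ (hs x hx) ht) ?_
      rw [Pi.sub_apply, sub_eq_zero, hs_def]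
      simp only [← hjt, jetEval_jet ht]
    | succ l ih =>
      intro hl x hx
      obtain ⟨t, ht, htR, htσ, hiff⟩ := hD.exists_lift (σ x)
      have h1 := (hiff σ (hσ x hx)).1 ((hD.nabla_eq_zero_iff (hσ x hx)).1 (h0 x hx))
      have h2 := map_mem_van (S' := jetStr S l) (jetProj S (show l ≤ H by omega))
        (fun τ hτ => jetStr_map_mem (S' := jetStr S l) _ (fun s hs => (jetStr S l).congr
          (jet_mem_sec hs) (by
            filter_upwards [S.eventually_mem hs] with y hy
            exact (jetProj_jet _ hy).symm)) hτ) 2 _ h1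
      have h3 : jet S l (s - t) ∈ van (jetStr S l) 2 x := by
        refine van_congr _ h2 ?_
        filter_upwards [hU.mem_nhds hx, S.eventually_mem ht] with y hy hty
        rw [jet_sub (hs y hy) hty, ih (by omega) y hy, Pi.sub_apply, map_sub, jetProj_jet _ hty]
      have h4 := hD.frames.mem_van_of_jet_mem_van (Submodule.sub_mem _ (hs x hx) ht) h3
      rw [(jet_eq_iff (hs x hx) ht).2 h4, ← htσ, jetProj_jet _ ht]
  intro x hx
  rw [key H le_rfl x hx]
  obtain ⟨t, ht, hjt⟩ := exists_jet_eq (σ x : Jet S H x)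
  rw [← hjt, jetProj_jet _ ht]

theorem solution_iff (hD : D.IsRigid p q H) {U : Set V} (hU : IsOpen U) {s : ∀ y, W y}
    (hs : ∀ x ∈ U, s ∈ S.sec x) : (∀ x ∈ U, D.toFun x (jet S k s x) = 0) ↔
      ∃ σ : ∀ y, D.formalSol H y, (∀ x ∈ U, (σ x : Jet S H x) = jet S H s x) ∧
        ∀ x ∈ U, hD.nabla.toFun σ x = 0 := by
  classical
  constructor
  · intro h
    have h1 : ∀ l, ∀ x ∈ U, jet S l s x ∈ D.formalSol l x := fun l x hx =>
      DiffOp.jet_mem_formalSol_of_solution (hs x hx)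
        ((hU.eventually_mem hx).mono fun y hy => h y hy) l
    let σ : ∀ y, D.formalSol H y := fun y =>
      if hy : jet S H s y ∈ D.formalSol H y then ⟨_, hy⟩ else 0
    have hσ : ∀ x ∈ U, (σ x : Jet S H x) = jet S H s x := fun x hx => by
      simp [σ, h1 H x hx]
    exact ⟨σ, hσ, fun x hx => (hD.nabla_eq_zero_iff_jet_mem (hs x hx)
      ((hU.eventually_mem hx).mono hσ)).2 (h1 _ x hx)⟩
  · rintro ⟨σ, hσ, h0⟩ x hx
    exact hD.apply_eq_zero_of_jet_mem (hs x hx) ((hD.nabla_eq_zero_iff_jet_mem (hs x hx)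
      ((hU.eventually_mem hx).mono hσ)).1 (h0 x hx))

theorem exists_solution (hD : D.IsRigid p q H) {U : Set V} (hU : IsOpen U)
    {σ : ∀ y, D.formalSol H y} (hσ : ∀ x ∈ U, σ ∈ (D.solStr H).sec x)
    (h0 : ∀ x ∈ U, hD.nabla.toFun σ x = 0) :
    ∃ s : ∀ y, W y, ((∀ x ∈ U, s ∈ S.sec x) ∧ (∀ x ∈ U, D.toFun x (jet S k s x) = 0) ∧
      ∀ x ∈ U, jet S H s x = σ x) ∧ ∀ t : ∀ y, W y, (∀ x ∈ U, t ∈ S.sec x) →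
        (∀ x ∈ U, jet S H t x = σ x) → ∀ x ∈ U, t x = s x := by
  have hs : ∀ x ∈ U, (fun y => jetEval S H y (σ y)) ∈ S.sec x :=
    fun x hx => jetEval_smooth (hσ x hx)
  have hj := hD.jet_eval_eq hU hσ h0
  refine ⟨_, ⟨hs, (hD.solution_iff hU hs).2 ⟨σ, fun x hx => (hj x hx).symm, h0⟩, hj⟩, ?_⟩
  intro t ht htσ x hx
  rw [← jetEval_jet (h := H) (ht x hx), htσ x hx]

end DiffOp.IsRigid

end Solutions

/-! ### Connection coefficients and curvature in coordinates. -/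

section Flat

variable {𝕜 : Type*} [RCLike 𝕜] {n : ℕ} {V : Type*} [TopologicalSpace V]
  [ChartedSpace (EuclideanSpace 𝕜 (Fin n)) V]
  [IsManifold 𝓘(𝕜, EuclideanSpace 𝕜 (Fin n)) ∞ V]
  {W : V → Type*} [∀ y, AddCommGroup (W y)] [∀ y, Module 𝕜 (W y)]
  {S : SmoothStr 𝕜 n W} {m y : V}

theorem eq_zero_of_diff_crd_eq_zero (hy : y ∈ (chartAt (EuclideanSpace 𝕜 (Fin n)) m).source)
    {X : TangentSpace 𝓘(𝕜, EuclideanSpace 𝕜 (Fin n)) y}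
    (h : ∀ i, diff (crd 𝕜 n m i) y X = 0) : X = 0 := by
  have hinv := isInvertible_mfderiv_extChartAt (I := 𝓘(𝕜, EuclideanSpace 𝕜 (Fin n)))
    (x := m) (y := y) (by rwa [extChartAt_source])
  have h1 : mfderiv 𝓘(𝕜, EuclideanSpace 𝕜 (Fin n)) 𝓘(𝕜, EuclideanSpace 𝕜 (Fin n))
      (extChartAt 𝓘(𝕜, EuclideanSpace 𝕜 (Fin n)) m) y X = 0 := by
    have key : ∀ w : EuclideanSpace 𝕜 (Fin n),
        (∀ i, (EuclideanSpace.proj i : EuclideanSpace 𝕜 (Fin n) →L[𝕜] 𝕜) w = 0) → w = 0 :=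
      fun w hw => PiLp.ext hw
    exact key _ fun i => (diff_crd hy i X).symm.trans (h i)
  rw [← hinv.inverse_apply_self X, h1, map_zero]

theorem sum_diff_crd_smul_coordField (hy : y ∈ (chartAt (EuclideanSpace 𝕜 (Fin n)) m).source)
    (X : TangentSpace 𝓘(𝕜, EuclideanSpace 𝕜 (Fin n)) y) :
    ∑ i, diff (crd 𝕜 n m i) y X • coordField 𝕜 n m i y = X := by
  rw [← sub_eq_zero]
  refine eq_zero_of_diff_crd_eq_zero hy fun j => ?_
  rw [map_sub, map_sum]
  simp [diff_crd_coordField hy]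

theorem mlieBracket_coordField (hy : y ∈ (chartAt (EuclideanSpace 𝕜 (Fin n)) m).source)
    (i j : Fin n) : VectorField.mlieBracket 𝓘(𝕜, EuclideanSpace 𝕜 (Fin n))
      (coordField 𝕜 n m i) (coordField 𝕜 n m j) y = 0 := by
  refine eq_zero_of_diff_crd_eq_zero hy fun l => ?_
  rw [diff_mlieBracket (coordField_mem hy i) (coordField_mem hy j) (smoothNear_crd hy l)]
  have h : ∀ j (X : TangentSpace 𝓘(𝕜, EuclideanSpace 𝕜 (Fin n)) y),
      diff (fun y => diff (crd 𝕜 n m l) y (coordField 𝕜 n m j y)) y X = 0 := by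
    intro j X
    rw [← diff_const (n := n) (if l = j then 1 else 0 : 𝕜) X]
    refine congrFun (congrArg _ (diff_congr ?_)) X
    filter_upwards [eventually_source hy] with z hz
    exact diff_crd_coordField hz l j
  rw [h, h, sub_zero]

namespace Connection

variable (nabla : Connection S)

/-- The function that is 0 where `σ = τ` and 1 elsewhere is smooth near `y`, where it vanishes
identically, and it reproduces `σ - τ` by multiplication; the Leibniz rule does the rest. Bump
functions are avoided, so the argument also covers the holomorphic case. -/
theorem congr {σ τ : ∀ y, W y} (hσ : σ ∈ S.sec y) (h : ∀ᶠ z in 𝓝 y, σ z = τ z) :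
    nabla.toFun σ y = nabla.toFun τ y := by
  classical
  have hτ := S.congr hσ h
  have hδ := Submodule.sub_mem _ hσ hτ
  have hf : SmoothNear 𝕜 n y fun z => if (σ - τ) z = 0 then (0 : 𝕜) else 1 := by
    refine (SmoothNear.const y 0).congr ?_
    filter_upwards [h] with z hz
    simp [hz]
  have e : (fun z => (if (σ - τ) z = 0 then (0 : 𝕜) else 1) • (σ - τ) z) = σ - τ := by
    funext z
    split_ifs with hz <;> simp [hz]
  have h1 : nabla.toFun (σ - τ) y = 0 := by
    refine LinearMap.ext fun X => ?_
    have := nabla.leibniz y _ hf _ hδ X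
    rw [e] at this
    rw [this]
    simp [h.self_of_nhds]
  have h2 := nabla.add y _ hδ _ hτ
  rwa [sub_add_cancel, h1, zero_add] at h2

theorem zero : nabla.toFun 0 y = 0 := by
  have := nabla.add y 0 (S.sec y).zero_mem 0 (S.sec y).zero_mem
  simpa using this

theorem sum {ι : Type*} [Fintype ι] {f : ι → V → 𝕜} {e : ι → ∀ y, W y}
    (hf : ∀ i, SmoothNear 𝕜 n y (f i)) (he : ∀ i, e i ∈ S.sec y)
    (X : TangentSpace 𝓘(𝕜, EuclideanSpace 𝕜 (Fin n)) y) :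
    nabla.toFun (fun z => ∑ i, f i z • e i z) y X =
      ∑ i, (f i y • nabla.toFun (e i) y X + diff (f i) y X • e i y) := by
  have key : ∀ s : Finset ι, (fun z => ∑ i ∈ s, f i z • e i z) ∈ S.sec y ∧
      nabla.toFun (fun z => ∑ i ∈ s, f i z • e i z) y X =
        ∑ i ∈ s, (f i y • nabla.toFun (e i) y X + diff (f i) y X • e i y) := by
    intro s
    induction s using Finset.cons_induction with
    | empty =>
      simp only [Finset.sum_empty]
      exact ⟨(S.sec y).zero_mem, by rw [show (fun _ => 0 : ∀ y, W y) = 0 from rfl, zero]; rfl⟩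
    | cons i s hi ih =>
      have h1 := S.smul_mem (hf i) (he i)
      have h2 : (fun z => ∑ j ∈ Finset.cons i s hi, f j z • e j z) =
          (fun z => f i z • e i z) + fun z => ∑ j ∈ s, f j z • e j z := by
        funext z
        rw [Finset.sum_cons, Pi.add_apply]
      rw [h2, Finset.sum_cons, nabla.add y _ h1 _ ih.1, LinearMap.add_apply, ih.2,
        nabla.leibniz y _ (hf i) _ (he i)]
      exact ⟨Submodule.add_mem _ h1 ih.1, rfl⟩
  exact (key Finset.univ).2

variable {ι : Type*} [Fintype ι] {e : ι → ∀ y, W y} {lam : ι → ∀ y, W y →ₗ[𝕜] 𝕜}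

theorem apply_eq (He : IsFrame S e lam y) {σ : ∀ y, W y} (hσ : σ ∈ S.sec y)
    (X : TangentSpace 𝓘(𝕜, EuclideanSpace 𝕜 (Fin n)) y) :
    nabla.toFun σ y X = ∑ i, (lam i y (σ y) • nabla.toFun (e i) y X +
      diff (fun z => lam i z (σ z)) y X • e i y) := by
  rw [nabla.congr hσ (He.repr.mono fun z hz => (hz (σ z)).symm)]
  exact nabla.sum (fun i => He.coeff_smooth hσ i) He.mem X

/-- A connection with a flat frame has no curvature. -/
theorem curvatureVanishesAt_of_flat (He : IsFrame S e lam m)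
    (hflat : ∀ᶠ y in 𝓝 m, ∀ i, nabla.toFun (e i) y = 0) : nabla.CurvatureVanishesAt m := by
  intro X hX Y hY σ hσ
  -- In a flat frame the connection differentiates the coefficients, so the curvature is the defect
  -- in the commutator formula `diff_mlieBracket`.
  have h1 : ∀ {σ : ∀ y, W y}, σ ∈ S.sec m → ∀ᶠ y in 𝓝 m,
      ∀ X, nabla.toFun σ y X = ∑ i, diff (fun z => lam i z (σ z)) y X • e i y := by
    intro σ hσ
    filter_upwards [hflat, He.eventually, S.eventually_mem hσ] with y h2 h3 h4 X
    rw [nabla.apply_eq h3 h4]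
    simp [h2]
  have h2 : ∀ {X Y : ∀ y : V, TangentSpace 𝓘(𝕜, EuclideanSpace 𝕜 (Fin n)) y},
      X ∈ (vectorFields 𝕜 n V).sec m → Y ∈ (vectorFields 𝕜 n V).sec m →
      nabla.toFun (fun y => nabla.toFun σ y (Y y)) m (X m) =
        ∑ i, diff (fun y => diff (fun z => lam i z (σ z)) y (Y y)) m (X m) • e i m := by
    intro X Y _ hY
    have hd : ∀ i, SmoothNear 𝕜 n m fun y => diff (fun z => lam i z (σ z)) y (Y y) :=
      fun i => (He.coeff_smooth hσ i).diff hY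
    rw [nabla.congr (nabla.smooth m σ hσ Y hY) ((h1 hσ).mono fun z hz => hz (Y z)),
      nabla.sum hd He.mem]
    simp [hflat.self_of_nhds]
  rw [Connection.curvature, h2 hX hY, h2 hY hX, (h1 hσ).self_of_nhds, ← Finset.sum_sub_distrib,
    ← Finset.sum_sub_distrib]
  refine Finset.sum_eq_zero fun i _ => ?_
  rw [diff_mlieBracket hX hY (He.coeff_smooth hσ i), ← sub_smul, ← sub_smul, sub_self, zero_smul]

/-- The connection coefficients in the frame `e` and the chart at `m`. -/
def coeff (e : ι → ∀ y, W y) (lam : ι → ∀ y, W y →ₗ[𝕜] 𝕜) (m : V) (i : Fin n) (a b : ι) (y : V) :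
    𝕜 :=
  lam b y (nabla.toFun (e a) y (coordField 𝕜 n m i y))

theorem coeff_smooth (hy : y ∈ (chartAt (EuclideanSpace 𝕜 (Fin n)) m).source)
    (He : IsFrame S e lam y) (i : Fin n) (a b : ι) :
    SmoothNear 𝕜 n y (nabla.coeff e lam m i a b) :=
  He.coeff_smooth (nabla.smooth y _ (He.mem a) _ (coordField_mem hy i)) b

theorem lam_apply_coordField (hy : y ∈ (chartAt (EuclideanSpace 𝕜 (Fin n)) m).source)
    (He : IsFrame S e lam y) {σ : ∀ y, W y} (hσ : σ ∈ S.sec y) (i : Fin n) (b : ι) :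
    lam b y (nabla.toFun σ y (coordField 𝕜 n m i y)) = pd n m i (fun z => lam b z (σ z)) y +
      ∑ a, lam a y (σ y) * nabla.coeff e lam m i a b y := by
  rw [nabla.apply_eq He hσ, Finset.sum_add_distrib, map_add, map_sum, add_comm]
  congr 1
  · rw [He.dual.self_of_nhds, diff_coordField hy (He.coeff_smooth hσ b)]
  · exact Finset.sum_congr rfl fun a _ => by rw [map_smul, smul_eq_mul, coeff]

/-- Tangent vectors are combinations of coordinate fields, so flatness becomes the linear system to
which `exists_parallel_coord` and `eq_zero_of_parallel_coord` apply. -/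
theorem eq_zero_iff_coordField (hy : y ∈ (chartAt (EuclideanSpace 𝕜 (Fin n)) m).source)
    (He : IsFrame S e lam y) {σ : ∀ y, W y} (hσ : σ ∈ S.sec y) :
    nabla.toFun σ y = 0 ↔ ∀ i b, pd n m i (fun z => lam b z (σ z)) y =
      -∑ a, lam a y (σ y) * nabla.coeff e lam m i a b y := by
  simp only [eq_neg_iff_add_eq_zero, ← nabla.lam_apply_coordField hy He hσ]
  refine ⟨fun h i b => by simp [h], fun h => LinearMap.ext fun X => He.ext fun b => ?_⟩
  rw [← sum_diff_crd_smul_coordField hy X]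
  simp [h]

/-- Coordinate fields commute, so evaluating the curvature on two of them and a frame element leaves
the integrability condition of that system. -/
theorem coeff_curvature [DecidableEq ι] (hy : y ∈ (chartAt (EuclideanSpace 𝕜 (Fin n)) m).source)
    (He : IsFrame S e lam y) (hcurv : nabla.CurvatureVanishesAt y) (i j : Fin n) (a b : ι) :
    pd n m i (nabla.coeff e lam m j a b) y +
        ∑ c, nabla.coeff e lam m j a c y * nabla.coeff e lam m i c b y =
      pd n m j (nabla.coeff e lam m i a b) y +
        ∑ c, nabla.coeff e lam m i a c y * nabla.coeff e lam m j c b y := by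
  have h1 := hcurv _ (coordField_mem hy i) _ (coordField_mem hy j) _ (He.mem a)
  rw [Connection.curvature, mlieBracket_coordField hy, map_zero, sub_zero, sub_eq_zero] at h1
  have h2 := congrArg (lam b y) h1
  rwa [nabla.lam_apply_coordField hy He (nabla.smooth y _ (He.mem a) _ (coordField_mem hy j)),
    nabla.lam_apply_coordField hy He (nabla.smooth y _ (He.mem a) _ (coordField_mem hy i))] at h2

end Connection

end Flat

section

set_option synthInstance.maxHeartbeats 200000

/-! ### First-order linear systems in coordinates. -/

section LinearSystem

variable {𝕜 : Type*} [RCLike 𝕜] {n r : ℕ}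

theorem contDiffOn_sum_smul_const {X Z κ : Type*} [NormedAddCommGroup X] [NormedSpace 𝕜 X]
    [NormedAddCommGroup Z] [NormedSpace 𝕜 Z] [Fintype κ] {g : κ → X → 𝕜} {s : Set X}
    (hg : ∀ x, ContDiffOn 𝕜 ∞ (g x) s) (T : κ → Z) :
    ContDiffOn 𝕜 ∞ (fun z => ∑ x, g x z • T x) s :=
  ContDiffOn.sum fun x _ => (hg x).smul contDiffOn_const

theorem fderiv_sum_smul_const {X Z κ : Type*} [NormedAddCommGroup X] [NormedSpace 𝕜 X]
    [NormedAddCommGroup Z] [NormedSpace 𝕜 Z] [Fintype κ] {g : κ → X → 𝕜} {z : X}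
    (hg : ∀ x, DifferentiableAt 𝕜 (g x) z) (T : κ → Z) (u : X) :
    fderiv 𝕜 (fun z => ∑ x, g x z • T x) z u = ∑ x, fderiv 𝕜 (g x) z u • T x := by
  have h : HasFDerivAt (fun z => ∑ x, g x z • T x)
      (∑ x, (fderiv 𝕜 (g x) z).smulRight (T x)) z :=
    HasFDerivAt.fun_sum fun x _ => (hg x).hasFDerivAt.smul_const _
  rw [h.fderiv, _root_.sum_apply]
  rfl

theorem fderiv_sum_smul_const_apply {X Y κ : Type*} [NormedAddCommGroup X] [NormedSpace 𝕜 X]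
    [NormedAddCommGroup Y] [NormedSpace 𝕜 Y] [Fintype κ] {g : κ → X → 𝕜} {z : X}
    (hg : ∀ x, DifferentiableAt 𝕜 (g x) z) (T : κ → X →L[𝕜] Y →L[𝕜] Y) (u v : X) (c : Y) :
    fderiv 𝕜 (fun z => ∑ x, g x z • T x) z u v c = (∑ x, fderiv 𝕜 (g x) z u • T x) v c :=
  congrArg (fun L : X →L[𝕜] Y →L[𝕜] Y => L v c) (fderiv_sum_smul_const hg T u)

/-- The matrix unit `v ↦ c ↦ v_i c_a e_b`. -/
def systemUnit (i : Fin n) (a b : Fin r) :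
    EuclideanSpace 𝕜 (Fin n) →L[𝕜] (Fin r → 𝕜) →L[𝕜] (Fin r → 𝕜) :=
  (EuclideanSpace.proj i : EuclideanSpace 𝕜 (Fin n) →L[𝕜] 𝕜).smulRight
    ((ContinuousLinearMap.proj (R := 𝕜) (φ := fun _ : Fin r => 𝕜) a).smulRight (Pi.single b 1))

/-- The linear system `∂_i f_b = -∑ a, f_a Γ_iab`, as `f' = A f`. -/
def systemMap (G : Fin n → Fin r → Fin r → EuclideanSpace 𝕜 (Fin n) → 𝕜)
    (z : EuclideanSpace 𝕜 (Fin n)) :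
    EuclideanSpace 𝕜 (Fin n) →L[𝕜] (Fin r → 𝕜) →L[𝕜] (Fin r → 𝕜) :=
  ∑ x : Fin n × Fin r × Fin r, G x.1 x.2.1 x.2.2 z • -systemUnit x.1 x.2.1 x.2.2

theorem sum_systemUnit (g : Fin n × Fin r × Fin r → 𝕜) (v : EuclideanSpace 𝕜 (Fin n))
    (c : Fin r → 𝕜) (b : Fin r) :
    (∑ x : Fin n × Fin r × Fin r, g x • -systemUnit (𝕜 := 𝕜) x.1 x.2.1 x.2.2) v c b =
      -∑ i, ∑ a, v i * c a * g (i, a, b) := by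
  rw [← Finset.sum_neg_distrib, _root_.sum_apply, _root_.sum_apply,
    Finset.sum_apply, Fintype.sum_prod_type]
  refine Finset.sum_congr rfl fun i _ => ?_
  rw [← Finset.sum_neg_distrib, Fintype.sum_prod_type]
  refine Finset.sum_congr rfl fun a _ => ?_
  rw [Finset.sum_eq_single b]
  · simp [systemUnit]
    ring
  · intro b' _ hb'
    simp [systemUnit, hb'.symm]
  · simp

variable {G : Fin n → Fin r → Fin r → EuclideanSpace 𝕜 (Fin n) → 𝕜}
  {z : EuclideanSpace 𝕜 (Fin n)} {δ : ℝ}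

theorem systemMap_apply (v : EuclideanSpace 𝕜 (Fin n)) (c : Fin r → 𝕜) (b : Fin r) :
    systemMap G z v c b = -∑ i, ∑ a, v i * c a * G i a b z :=
  sum_systemUnit (fun x => G x.1 x.2.1 x.2.2 z) v c b

theorem contDiffOn_systemMap {s : Set (EuclideanSpace 𝕜 (Fin n))}
    (hG : ∀ i a b, ContDiffOn 𝕜 ∞ (G i a b) s) : ContDiffOn 𝕜 ∞ (systemMap G) s :=
  contDiffOn_sum_smul_const (g := fun x : Fin n × Fin r × Fin r => G x.1 x.2.1 x.2.2)
    (fun x => hG x.1 x.2.1 x.2.2) _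

theorem fderiv_systemMap (hG : ∀ i a b, DifferentiableAt 𝕜 (G i a b) z)
    (u v : EuclideanSpace 𝕜 (Fin n)) (c : Fin r → 𝕜) (b : Fin r) :
    fderiv 𝕜 (systemMap G) z u v c b = -∑ i, ∑ a, v i * c a * fderiv 𝕜 (G i a b) z u := by
  have h := fderiv_sum_smul_const_apply (g := fun x : Fin n × Fin r × Fin r => G x.1 x.2.1 x.2.2)
    (fun x => hG x.1 x.2.1 x.2.2) (fun x => -systemUnit x.1 x.2.1 x.2.2) u v c
  exact (congrFun h b).trans
    (sum_systemUnit (fun x => fderiv 𝕜 (G x.1 x.2.1 x.2.2) z u) v c b)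

theorem apply_eq_sum_single {Y : Type*} [AddCommGroup Y] [Module 𝕜 Y] [TopologicalSpace Y]
    (L : EuclideanSpace 𝕜 (Fin n) →L[𝕜] Y) (v : EuclideanSpace 𝕜 (Fin n)) :
    L v = ∑ i, v i • L (EuclideanSpace.single i 1) := by
  conv_lhs => rw [← (EuclideanSpace.basisFun (Fin n) 𝕜).sum_repr v]
  simp

/-- Both sides are bilinear in `u` and `v`, and expansion in basis vectors reduces the symmetry to
`hflat`. The minus sign of `systemMap` survives in the derivative and cancels in the quadratic term.
-/
theorem fderiv_systemMap_add_comm (hG : ∀ i a b, DifferentiableAt 𝕜 (G i a b) z)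
    (hflat : ∀ i j a b, fderiv 𝕜 (G j a b) z (EuclideanSpace.single i 1) +
        ∑ c, G j a c z * G i c b z =
      fderiv 𝕜 (G i a b) z (EuclideanSpace.single j 1) + ∑ c, G i a c z * G j c b z)
    (u v : EuclideanSpace 𝕜 (Fin n)) (y : Fin r → 𝕜) :
    fderiv 𝕜 (systemMap G) z u v y + systemMap G z v (systemMap G z u y) =
      fderiv 𝕜 (systemMap G) z v u y + systemMap G z u (systemMap G z v y) := by
  have key : ∀ (u v : EuclideanSpace 𝕜 (Fin n)) (b : Fin r),
      (fderiv 𝕜 (systemMap G) z u v y + systemMap G z v (systemMap G z u y)) b =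
        ∑ i, ∑ j, u i * v j * ∑ a, y a * (∑ c, G i a c z * G j c b z -
          fderiv 𝕜 (G j a b) z (EuclideanSpace.single i 1)) := by
    intro u v b
    have h1 : ∑ j, ∑ a, v j * y a * fderiv 𝕜 (G j a b) z u =
        ∑ i, ∑ j, ∑ a, u i * v j * (y a * fderiv 𝕜 (G j a b) z (EuclideanSpace.single i 1)) := by
      rw [Finset.sum_comm]
      conv_rhs => rw [Finset.sum_comm]
      rw [Finset.sum_comm]
      refine Finset.sum_congr rfl fun j _ => ?_
      rw [Finset.sum_comm]
      refine Finset.sum_congr rfl fun a _ => ?_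
      rw [apply_eq_sum_single (fderiv 𝕜 (G j a b) z) u, Finset.mul_sum]
      refine Finset.sum_congr rfl fun i _ => ?_
      rw [smul_eq_mul]
      ring
    have h2 : ∑ j, ∑ c, v j * (∑ i, ∑ a, u i * y a * G i a c z) * G j c b z =
        ∑ i, ∑ j, ∑ a, ∑ c, u i * v j * (y a * (G i a c z * G j c b z)) := by
      conv_rhs => rw [Finset.sum_comm]
      refine Finset.sum_congr rfl fun j _ => ?_
      simp only [Finset.mul_sum, Finset.sum_mul]
      rw [Finset.sum_comm]
      refine Finset.sum_congr rfl fun i _ => ?_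
      rw [Finset.sum_comm]
      refine Finset.sum_congr rfl fun a _ => Finset.sum_congr rfl fun c _ => ?_
      ring
    rw [Pi.add_apply, fderiv_systemMap hG, systemMap_apply]
    simp only [systemMap_apply, mul_neg, neg_mul, Finset.sum_neg_distrib, neg_neg]
    rw [h1, h2, ← sub_eq_neg_add]
    simp only [Finset.mul_sum, mul_sub, Finset.sum_sub_distrib]
  funext b
  rw [key u v b, key v u b, Finset.sum_comm]
  refine Finset.sum_congr rfl fun j _ => Finset.sum_congr rfl fun i _ => ?_
  rw [mul_comm (u i)]
  refine congrArg _ (Finset.sum_congr rfl fun a _ => congrArg _ ?_)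
  linear_combination -(hflat i j a b)

/-- Frobenius integrability, in coordinates. -/
theorem exists_parallel_coord (hδ : 0 < δ)
    (hG : ∀ i a b, ContDiffOn 𝕜 ∞ (G i a b) (Metric.ball z δ))
    (hflat : ∀ x ∈ Metric.ball z δ, ∀ i j a b,
      fderiv 𝕜 (G j a b) x (EuclideanSpace.single i 1) + ∑ c, G j a c x * G i c b x =
        fderiv 𝕜 (G i a b) x (EuclideanSpace.single j 1) + ∑ c, G i a c x * G j c b x)
    (y : Fin r → 𝕜) : ∃ ε > 0, ∃ f : Fin r → EuclideanSpace 𝕜 (Fin n) → 𝕜,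
      (∀ b, ContDiffOn 𝕜 ∞ (f b) (Metric.ball z ε)) ∧ (∀ b, f b z = y b) ∧
      ∀ x ∈ Metric.ball z ε, ∀ i b,
        fderiv 𝕜 (f b) x (EuclideanSpace.single i 1) = -∑ a, f a x * G i a b x := by
  have hd : ∀ x ∈ Metric.ball z δ, ∀ i a b, DifferentiableAt 𝕜 (G i a b) x := fun x hx i a b =>
    ((hG i a b).contDiffAt (Metric.isOpen_ball.mem_nhds hx)).differentiableAt (by simp)
  obtain ⟨ε, hε, f, hf, hfz, hfd⟩ := exists_parallel hδ (contDiffOn_systemMap hG)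
    (fun x hx u v y => fderiv_systemMap_add_comm (hd x hx) (hflat x hx) u v y) y
  refine ⟨ε, hε, fun b x => f x b, fun b => contDiffOn_pi.1 hf b, fun b => congrFun hfz b,
    fun x hx i b => ?_⟩
  have h1 : DifferentiableAt 𝕜 f x :=
    (hf.contDiffAt (Metric.isOpen_ball.mem_nhds hx)).differentiableAt (by simp)
  have h2 := congrFun (hfd x hx (EuclideanSpace.single i 1)) b
  rw [systemMap_apply, Finset.sum_eq_single i (fun j _ hj => by simp [hj]) (by simp)] at h2
  rw [((hasFDerivAt_pi'.1 h1.hasFDerivAt) b).fderiv]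
  simpa using h2

theorem eq_zero_of_parallel_coord
    (hG : ∀ i a b, ContDiffOn 𝕜 ∞ (G i a b) (Metric.ball z δ))
    {f : Fin r → EuclideanSpace 𝕜 (Fin n) → 𝕜}
    (hf : ∀ b, DifferentiableOn 𝕜 (f b) (Metric.ball z δ)) (h0 : ∀ b, f b z = 0)
    (hfG : ∀ x ∈ Metric.ball z δ, ∀ i b,
      fderiv 𝕜 (f b) x (EuclideanSpace.single i 1) = -∑ a, f a x * G i a b x) :
    ∀ x ∈ Metric.ball z δ, ∀ b, f b x = 0 := by
  have hd : DifferentiableOn 𝕜 (fun x b => f b x) (Metric.ball z δ) := differentiableOn_pi.2 hf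
  have key := eq_zero_of_fderiv_eq (contDiffOn_systemMap hG) hd (fun x hx v => ?_) (funext h0)
  · exact fun x hx b => congrFun (key x hx) b
  · funext b
    have h1 := hd.differentiableAt (Metric.isOpen_ball.mem_nhds hx)
    rw [fderiv_pi fun b => (hf b).differentiableAt (Metric.isOpen_ball.mem_nhds hx),
      ContinuousLinearMap.pi_apply, systemMap_apply, apply_eq_sum_single (fderiv 𝕜 _ x) v,
      ← Finset.sum_neg_distrib]
    refine Finset.sum_congr rfl fun i _ => ?_
    rw [hfG x hx i b, smul_eq_mul, mul_neg, Finset.mul_sum]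
    simp only [mul_assoc]

end LinearSystem

/-! ### Existence and uniqueness of flat sections. -/

section FlatSections

variable {𝕜 : Type*} [RCLike 𝕜] {n : ℕ} {V : Type*} [TopologicalSpace V]
  [ChartedSpace (EuclideanSpace 𝕜 (Fin n)) V]
  [IsManifold 𝓘(𝕜, EuclideanSpace 𝕜 (Fin n)) ∞ V]
  {W : V → Type*} [∀ y, AddCommGroup (W y)] [∀ y, Module 𝕜 (W y)]
  {S : SmoothStr 𝕜 n W} {m : V} {r : ℕ}

namespace Connection

variable (nabla : Connection S) {e : Fin r → ∀ y, W y} {lam : Fin r → ∀ y, W y →ₗ[𝕜] 𝕜}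

theorem eventually_loc_coeff (He : IsFrame S e lam m) :
    ∀ᶠ z in 𝓝 (chartAt (EuclideanSpace 𝕜 (Fin n)) m m), ∀ i a b,
      ContDiffAt 𝕜 ∞ (loc m (nabla.coeff e lam m i a b)) z :=
  eventually_all.2 fun i => eventually_all.2 fun a => eventually_all.2 fun b =>
    (smoothNear_iff_loc (mem_chart_source _ m)).1
      (nabla.coeff_smooth (mem_chart_source _ m) He i a b)

theorem eventually_chart {P : V → Prop} (h : ∀ᶠ y in 𝓝 m, P y) :
    ∀ᶠ z in 𝓝 (chartAt (EuclideanSpace 𝕜 (Fin n)) m m),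
      ∃ y, y ∈ (chartAt (EuclideanSpace 𝕜 (Fin n)) m).source ∧
        chartAt (EuclideanSpace 𝕜 (Fin n)) m y = z ∧
        (chartAt (EuclideanSpace 𝕜 (Fin n)) m).symm z = y ∧ P y := by
  have hm := mem_chart_source (EuclideanSpace 𝕜 (Fin n)) m
  rw [(chartAt (EuclideanSpace 𝕜 (Fin n)) m).eventually_nhds _ hm]
  filter_upwards [h, eventually_source hm] with y hy hys
  exact ⟨y, hys, rfl, (chartAt (EuclideanSpace 𝕜 (Fin n)) m).left_inv hys, hy⟩

theorem eventually_comp_chart {P : EuclideanSpace 𝕜 (Fin n) → Prop}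
    (h : ∀ᶠ z in 𝓝 (chartAt (EuclideanSpace 𝕜 (Fin n)) m m), P z) :
    ∀ᶠ y in 𝓝 m, P (chartAt (EuclideanSpace 𝕜 (Fin n)) m y) :=
  ((chartAt (EuclideanSpace 𝕜 (Fin n)) m).continuousAt (mem_chart_source _ m)).eventually h

/-- A flat section is determined by its value at a point. -/
theorem eventually_eq_zero_of_flat (He : IsFrame S e lam m) {σ : ∀ y, W y} (hσ : σ ∈ S.sec m)
    (hflat : ∀ᶠ y in 𝓝 m, nabla.toFun σ y = 0) (h0 : σ m = 0) : ∀ᶠ y in 𝓝 m, σ y = 0 := by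
  have hm := mem_chart_source (EuclideanSpace 𝕜 (Fin n)) m
  -- A ball in the chart on which the coefficients are smooth and each point comes from a point of
  -- `V` where the hypotheses hold.
  obtain ⟨δ, hδ, hball⟩ := Metric.eventually_nhds_iff_ball.1
    ((nabla.eventually_loc_coeff He).and (eventually_chart (n := n) (𝕜 := 𝕜)
      (hflat.and (He.eventually.and (S.eventually_mem hσ)))))
  have key := eq_zero_of_parallel_coord (z := chartAt (EuclideanSpace 𝕜 (Fin n)) m m) (δ := δ)
    (G := fun i a b => loc m (nabla.coeff e lam m i a b))
    (f := fun b => loc m fun z => lam b z (σ z))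
    (fun i a b z hz => ((hball z hz).1 i a b).contDiffWithinAt)
    (fun b z hz => ?_) (fun b => ?_) (fun z hz i b => ?_)
  · have h1 : ∀ᶠ z in 𝓝 (chartAt (EuclideanSpace 𝕜 (Fin n)) m m),
        ∀ b, loc m (fun z => lam b z (σ z)) z = 0 :=
      Metric.eventually_nhds_iff_ball.2 ⟨δ, hδ, key⟩
    filter_upwards [eventually_comp_chart h1, eventually_source hm, He.repr] with y h2 h3 h4
    rw [← h4 (σ y)]
    refine Finset.sum_eq_zero fun b _ => ?_
    have h5 := h2 b
    rw [loc, Function.comp_apply, (chartAt (EuclideanSpace 𝕜 (Fin n)) m).left_inv h3] at h5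
    rw [h5, zero_smul]
  · obtain ⟨-, y, hy, rfl, -, -, h1, h2⟩ := hball z hz
    exact ((h1.coeff_smooth h2 b).differentiableAt_loc hy).differentiableWithinAt
  · rw [loc, Function.comp_apply, (chartAt (EuclideanSpace 𝕜 (Fin n)) m).left_inv hm, h0, map_zero]
  · obtain ⟨-, y, hy, rfl, hinv, h1, h2, h3⟩ := hball z hz
    have := (nabla.eq_zero_iff_coordField hy h2 h3).1 h1 i b
    rw [pd] at this
    rw [this]
    simp only [loc, Function.comp_apply]
    rw [hinv]

/-- Through every vector there is a flat section, if the curvature vanishes. -/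
theorem exists_flat (He : IsFrame S e lam m)
    (hcurv : ∀ᶠ y in 𝓝 m, nabla.CurvatureVanishesAt y) (w : W m) :
    ∃ σ ∈ S.sec m, σ m = w ∧ ∀ᶠ y in 𝓝 m, nabla.toFun σ y = 0 := by
  have hm := mem_chart_source (EuclideanSpace 𝕜 (Fin n)) m
  obtain ⟨δ, hδ, hball⟩ := Metric.eventually_nhds_iff_ball.1
    ((nabla.eventually_loc_coeff He).and (eventually_chart (n := n) (𝕜 := 𝕜)
      (hcurv.and He.eventually)))
  obtain ⟨ε, hε, f, hf, hfm, hfG⟩ := exists_parallel_coord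
    (z := chartAt (EuclideanSpace 𝕜 (Fin n)) m m)
    (G := fun i a b => loc m (nabla.coeff e lam m i a b)) hδ
    (fun i a b z hz => ((hball z hz).1 i a b).contDiffWithinAt)
    (fun z hz i j a b => by
      obtain ⟨-, y, hy, rfl, hinv, h1, h2⟩ := hball z hz
      have := nabla.coeff_curvature hy h2 h1 i j a b
      simp only [pd] at this
      simpa only [loc, Function.comp_apply, hinv] using this) (fun b => lam b m w)
  have hsm : ∀ᶠ y in 𝓝 m, ∀ b, SmoothNear 𝕜 n y
      fun y => f b (chartAt (EuclideanSpace 𝕜 (Fin n)) m y) := by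
    have h1 : ∀ᶠ z in 𝓝 (chartAt (EuclideanSpace 𝕜 (Fin n)) m m), ∀ᶠ z' in 𝓝 z, ∀ b,
        ContDiffAt 𝕜 ∞ (f b) z' := eventually_eventually_nhds.2
      (Metric.eventually_nhds_iff_ball.2 ⟨ε, hε, fun z hz b =>
        (hf b).contDiffAt (Metric.isOpen_ball.mem_nhds hz)⟩)
    filter_upwards [eventually_comp_chart h1, eventually_source hm] with y h2 h3 b
    exact smoothNear_comp_chart h3 (h2.mono fun z hz => hz b)
  refine ⟨fun y => ∑ b, f b (chartAt (EuclideanSpace 𝕜 (Fin n)) m y) • e b y,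
    He.combination_mem hsm.self_of_nhds, ?_, ?_⟩
  · simp only [hfm]
    exact He.repr.self_of_nhds w
  · have h1 : ∀ᶠ z in 𝓝 (chartAt (EuclideanSpace 𝕜 (Fin n)) m m), ∀ i b,
        fderiv 𝕜 (f b) z (EuclideanSpace.single i 1) =
          -∑ a, f a z * loc m (nabla.coeff e lam m i a b) z :=
      Metric.eventually_nhds_iff_ball.2 ⟨ε, hε, hfG⟩
    filter_upwards [eventually_comp_chart h1, eventually_source hm, hsm, He.eventually]
      with y h2 h3 h4 h5
    refine (nabla.eq_zero_iff_coordField h3 h5 (h5.combination_mem h4)).2 fun i b => ?_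
    rw [pd_congr h3 (g := fun y => f b (chartAt (EuclideanSpace 𝕜 (Fin n)) m y))
      (h5.dual.mono fun y hy => hy _ b), pd, (loc_comp_chart m y h3 (f b)).fderiv_eq, h2]
    simp only [h5.dual.self_of_nhds, loc, Function.comp_apply,
      (chartAt (EuclideanSpace 𝕜 (Fin n)) m).left_inv h3]

end Connection

end FlatSections

end

/-! ### The space of germs of solutions. -/

section Germs

variable {𝕜 : Type*} [RCLike 𝕜] {n : ℕ} {V : Type*} [TopologicalSpace V]
  [ChartedSpace (EuclideanSpace 𝕜 (Fin n)) V]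
  {W : V → Type*} [∀ y, AddCommGroup (W y)] [∀ y, Module 𝕜 (W y)]
  {W' : V → Type*} [∀ y, AddCommGroup (W' y)] [∀ y, Module 𝕜 (W' y)]
  {S : SmoothStr 𝕜 n W} {S' : SmoothStr 𝕜 n W'} {k : ℕ} {D : DiffOp S S' k} {m : V} {p q H : ℕ}

variable (D H m) in
/-- The jet of a germ of solutions at its source. -/
def DiffOp.germJet : D.SolGerm m →ₗ[𝕜] D.formalSol H m :=
  Submodule.liftQ _
    ((jetMk S H m ∘ₗ Submodule.inclusion (fun _ hs => hs.1 : D.solNear m ≤ S.sec m)).codRestrict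
      (D.formalSol H m) fun s => by
        have := DiffOp.jet_mem_formalSol_of_solution s.2.1 s.2.2 H
        rwa [jet_of_mem s.2.1] at this)
    fun _ hs => Subtype.ext ((jetMk_eq_zero _).2 (mem_van_of_germ_zero S _ hs))

theorem DiffOp.coe_germJet (s : D.solNear m) :
    (D.germJet m H (Submodule.Quotient.mk s) : Jet S H m) = jet S H (s : ∀ y, W y) m :=
  (jet_of_mem s.2.1).symm

variable [IsManifold 𝓘(𝕜, EuclideanSpace 𝕜 (Fin n)) ∞ V]

namespace DiffOp.IsRigid

theorem exists_flat_of_solution (hD : D.IsRigid p q H) {s : ∀ y, W y} (hs : s ∈ D.solNear m) :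
    ∃ σ ∈ (D.solStr H).sec m, (∀ᶠ y in 𝓝 m, (σ y : Jet S H y) = jet S H s y) ∧
      ∀ᶠ y in 𝓝 m, hD.nabla.toFun σ y = 0 := by
  classical
  -- Outside a neighbourhood of `m` the jets of `s` may leave `R_H`; the value chosen there does not
  -- affect the germ.
  let σ : ∀ y, D.formalSol H y := fun y =>
    if hy : jet S H s y ∈ D.formalSol H y then ⟨_, hy⟩ else 0
  have hsol := (S.eventually_mem hs.1).and (eventually_eventually_nhds.2 hs.2)
  have hσ : ∀ᶠ y in 𝓝 m, (σ y : Jet S H y) = jet S H s y := hsol.mono fun y hy => by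
    simp [σ, DiffOp.jet_mem_formalSol_of_solution hy.1 hy.2 H]
  refine ⟨σ, (jetStr S H).congr (jet_mem_sec hs.1) (hσ.mono fun y hy => hy.symm), hσ, ?_⟩
  filter_upwards [hsol, eventually_eventually_nhds.2 hσ] with y h1 h2
  exact (hD.nabla_eq_zero_iff_jet_mem h1.1 h2).2
    (DiffOp.jet_mem_formalSol_of_solution h1.1 h1.2 _)

/-- If the `H`-jet of a solution is zero at `m`, the flat section `j^H s` vanishes at `m`, hence
near `m`, and the values of `s` with it. -/
theorem germJet_injective (hD : D.IsRigid p q H) (m : V) :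
    Function.Injective (D.germJet m H) := by
  refine (injective_iff_map_eq_zero _).2 fun g => ?_
  refine Submodule.Quotient.induction_on _ g fun s hs => ?_
  refine (Submodule.Quotient.mk_eq_zero _).2 ?_
  obtain ⟨σ, hσ, hσs, hflat⟩ := hD.exists_flat_of_solution s.2
  obtain ⟨e, lam, He⟩ := hD.hasFrames m
  have h0 : σ m = 0 := by
    refine Subtype.ext (hσs.self_of_nhds.trans ?_)
    rw [← DiffOp.coe_germJet, hs]
  change ∀ᶠ y in 𝓝 m, (s : ∀ y, W y) y = 0
  filter_upwards [hD.nabla.eventually_eq_zero_of_flat He hσ hflat h0, hσs, S.eventually_mem s.2.1]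
    with y h1 h2 h3
  rw [← jetEval_jet (h := H) h3, ← h2, h1]
  exact map_zero _

theorem germJet_surjective (hD : D.IsRigid p q H)
    (hcurv : ∀ᶠ y in 𝓝 m, hD.nabla.CurvatureVanishesAt y) :
    Function.Surjective (D.germJet m H) := by
  intro w
  obtain ⟨e, lam, He⟩ := hD.hasFrames m
  obtain ⟨σ, hσ, rfl, hflat⟩ := hD.nabla.exists_flat He hcurv w
  obtain ⟨U, hUsub, hU, hm⟩ := mem_nhds_iff.1 (((D.solStr H).eventually_mem hσ).and hflat)
  obtain ⟨s, ⟨hs, h0, hj⟩, -⟩ := hD.exists_solution hU (fun x hx => (hUsub hx).1)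
    fun x hx => (hUsub hx).2
  refine ⟨Submodule.Quotient.mk ⟨s, hs m hm, (hU.eventually_mem hm).mono h0⟩, Subtype.ext ?_⟩
  rw [DiffOp.coe_germJet]
  exact hj m hm

/-- Solutions through the vectors of a frame at `m` have flat `H`-jets that are independent at `m`.
These form a flat frame on a whole neighbourhood of `m`. -/
theorem curvatureVanishesAt_of_germJet_surjective (hD : D.IsRigid p q H)
    (hsurj : Function.Surjective (D.germJet m H)) :
    ∀ᶠ y in 𝓝 m, hD.nabla.CurvatureVanishesAt y := by
  obtain ⟨e, lam, He⟩ := hD.hasFrames m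
  have key : ∀ i, ∃ σ ∈ (D.solStr H).sec m, σ m = e i m ∧
      ∀ᶠ y in 𝓝 m, hD.nabla.toFun σ y = 0 := by
    intro i
    obtain ⟨g, hg⟩ := hsurj (e i m)
    obtain ⟨s, rfl⟩ := Submodule.Quotient.mk_surjective _ g
    obtain ⟨σ, hσ, hσs, hflat⟩ := hD.exists_flat_of_solution s.2
    refine ⟨σ, hσ, Subtype.ext ?_, hflat⟩
    rw [hσs.self_of_nhds, ← DiffOp.coe_germJet, hg]
  choose σ hσ hσe hflat using key
  have hli : LinearIndependent 𝕜 fun i => σ i m := by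
    simp only [hσe]
    exact He.linearIndependent
  obtain ⟨lam', He'⟩ := He.of_basis hσ hli rfl
  filter_upwards [He'.eventually, eventually_eventually_nhds.2 (eventually_all.2 hflat)]
    with y h1 h2
  exact hD.nabla.curvatureVanishesAt_of_flat h1 h2

theorem germJet_surjective_iff (hD : D.IsRigid p q H) :
    Function.Surjective (D.germJet m H) ↔
      ∀ᶠ y in 𝓝 m, hD.nabla.CurvatureVanishesAt y :=
  ⟨hD.curvatureVanishesAt_of_germJet_surjective, hD.germJet_surjective⟩

theorem finiteDimensional_solGerm (hD : D.IsRigid p q H) (m : V) :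
    FiniteDimensional 𝕜 (D.SolGerm m) :=
  have := hD.hasFrames.finiteDimensional m
  Module.Finite.of_injective _ (hD.germJet_injective m)

theorem finrank_solGerm_le (hD : D.IsRigid p q H) (m : V) :
    Module.finrank 𝕜 (D.SolGerm m) ≤ p * c (n + 1) (H + 1) - q * c (n + 1) (H + 1 - k) := by
  have := hD.hasFrames.finiteDimensional m
  rw [← hD.finrank_formalSol m]
  exact LinearMap.finrank_le_finrank_of_injective (hD.germJet_injective m)

theorem finrank_solGerm_eq_iff (hD : D.IsRigid p q H) :
    Module.finrank 𝕜 (D.SolGerm m) = p * c (n + 1) (H + 1) - q * c (n + 1) (H + 1 - k) ↔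
      ∀ᶠ y in 𝓝 m, hD.nabla.CurvatureVanishesAt y := by
  have := hD.hasFrames.finiteDimensional m
  have := hD.finiteDimensional_solGerm m
  rw [← hD.germJet_surjective_iff, ← hD.finrank_formalSol m]
  refine ⟨fun h => ?_, fun h => ?_⟩
  · exact (LinearMap.injective_iff_surjective_of_finrank_eq_finrank h).1 (hD.germJet_injective m)
  · exact (LinearEquiv.ofBijective _ ⟨hD.germJet_injective m, h⟩).finrank_eq

end DiffOp.IsRigid

end Germs

/-! ### Local frames of a smooth vector bundle, and the theorem. -/

/-- The sections of a vector bundle of rank `p` have local frames of length `p`. -/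
theorem hasFrames_bundleStr {𝕜 : Type*} [RCLike 𝕜] {n p : ℕ} {V : Type*} [TopologicalSpace V]
    [ChartedSpace (EuclideanSpace 𝕜 (Fin n)) V]
    [IsManifold 𝓘(𝕜, EuclideanSpace 𝕜 (Fin n)) ∞ V]
    {A : Type*} [NormedAddCommGroup A] [NormedSpace 𝕜 A] [FiniteDimensional 𝕜 A]
    {E : V → Type*} [TopologicalSpace (TotalSpace A E)]
    [∀ y, AddCommGroup (E y)] [∀ y, Module 𝕜 (E y)] [∀ y, TopologicalSpace (E y)]
    [FiberBundle A E] [VectorBundle 𝕜 A E]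
    [ContMDiffVectorBundle ∞ A E 𝓘(𝕜, EuclideanSpace 𝕜 (Fin n))]
    (hp : Module.finrank 𝕜 A = p) : HasFrames (bundleStr 𝕜 n A E) p := by
  intro x
  have : ContMDiffVectorBundle 1 A E 𝓘(𝕜, EuclideanSpace 𝕜 (Fin n)) :=
    ContMDiffVectorBundle.of_le (n := ∞) (by simp)
  have hx := mem_baseSet_trivializationAt A E x
  set T := trivializationAt A E x
  have hT : ∀ᶠ y in 𝓝 x, y ∈ T.baseSet := T.open_baseSet.eventually_mem hx
  let b := Module.finBasisOfFinrankEq 𝕜 A hp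
  refine ⟨T.localFrame b, T.localFrameCoeff 𝓘(𝕜, EuclideanSpace 𝕜 (Fin n)) b, ?_, ?_, ?_, ?_⟩
  · exact fun i => hT.mono fun y hy => contMDiffAt_localFrame_of_mem ∞ T b i hy
  · filter_upwards [hT] with y hy c i
    refine (T.localFrameCoeff_apply_of_mem_baseSet b hy
      (fun z => ∑ j, c j • T.localFrame b j z) i).trans ?_
    simp [hy, Finsupp.single_apply]
  · filter_upwards [hT] with y hy w
    classical
    have := T.eq_sum_localFrameCoeff_smul (I := 𝓘(𝕜, EuclideanSpace 𝕜 (Fin n))) (b := b)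
      (s := Function.update 0 y w) hy
    rw [Function.update_self] at this
    exact this.symm
  · filter_upwards [eventually_eventually_nhds.2 hT] with y hy σ hσ i
    filter_upwards [hy, hσ] with z h1 h2
    exact contMDiffAt_localFrameCoeff b h1 h2 i

end JetPDE

end

theorem theorem2 {𝕜 : Type*} [RCLike 𝕜] {n k p q : ℕ}
    -- the `n`-dimensional manifold `V`
    {V : Type*} [TopologicalSpace V] [ChartedSpace (EuclideanSpace 𝕜 (Fin n)) V]
    [IsManifold 𝓘(𝕜, EuclideanSpace 𝕜 (Fin n)) ∞ V]
    -- the vector bundle `E`, of rank `p`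
    {A : Type*} [NormedAddCommGroup A] [NormedSpace 𝕜 A] [FiniteDimensional 𝕜 A]
    {E : V → Type*} [TopologicalSpace (TotalSpace A E)]
    [∀ y, AddCommGroup (E y)] [∀ y, Module 𝕜 (E y)] [∀ y, TopologicalSpace (E y)]
    [FiberBundle A E] [VectorBundle 𝕜 A E]
    [ContMDiffVectorBundle ∞ A E 𝓘(𝕜, EuclideanSpace 𝕜 (Fin n))]
    -- the vector bundle `F`, of rank `q`
    {B : Type*} [NormedAddCommGroup B] [NormedSpace 𝕜 B] [FiniteDimensional 𝕜 B]
    {F : V → Type*} [TopologicalSpace (TotalSpace B F)]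
    [∀ y, AddCommGroup (F y)] [∀ y, Module 𝕜 (F y)] [∀ y, TopologicalSpace (F y)]
    [FiberBundle B F] [VectorBundle 𝕜 B F]
    [ContMDiffVectorBundle ∞ B F 𝓘(𝕜, EuclideanSpace 𝕜 (Fin n))]
    (hp : Module.finrank 𝕜 A = p) (hq : Module.finrank 𝕜 B = q)
    -- the operator `D : J^k E → F`
    (hk : 1 ≤ k)
    (D : JetPDE.DiffOp (JetPDE.bundleStr 𝕜 n A E) (JetPDE.bundleStr 𝕜 n B F) k)
    (hD : ∀ x, Function.Surjective (D.toFun x))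
    (hpq : p < q) (hqp : q ≤ p * JetPDE.c n k) (hcal : D.IsCalibrated p q)
    -- the order `H = h₀ - 1` of the jets in the bundle `𝓔 = R_H`
    (H : ℕ) (hH : H = JetPDE.hZero n k p q - 1) :
    -- `h₀` is indeed the greatest element of the set that defines it
    IsGreatest {h | k ≤ h ∧ q * JetPDE.c n (h - k) ≤ p * JetPDE.c n h} (JetPDE.hZero n k p q) ∧
    -- `𝓔` is a vector bundle of rank `π(n, k, p, q)`
    (∃ r : ℕ, (r : ℤ) = JetPDE.rankBound n k p q ∧ JetPDE.IsVectorBundle (D.solStr H) r) ∧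
    -- the projection `J^h₀ E → J^(h₀ - 1) E` maps `R_h₀` bijectively to `R_(h₀ - 1)`
    (∀ x, Set.BijOn (JetPDE.jetProj (JetPDE.bundleStr 𝕜 n A E) (Nat.le_succ H) x)
      (D.formalSol (H + 1) x) (D.formalSol H x)) ∧
    -- the tautological splitting `u` exists and is unique
    ∃ u : ∀ x, D.formalSol H x →ₗ[𝕜] JetPDE.Jet (D.solStr H) 1 x,
      D.IsTautologicalSplitting H u ∧ (∀ u', D.IsTautologicalSplitting H u' → u' = u) ∧
    -- the tautological connection `∇ σ = j^1 σ - u(σ)` exists and is unique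
    ∃ nabla : JetPDE.Connection (D.solStr H),
      nabla.IsInducedBy u ∧
      (∀ nabla' : JetPDE.Connection (D.solStr H), nabla'.IsInducedBy u →
        ∀ x, ∀ σ ∈ (D.solStr H).sec x, nabla'.toFun σ x = nabla.toFun σ x) ∧
      -- (i) a smooth section `s` over `U` is a solution iff `j^(h₀ - 1) s` lies in `𝓔` and is flat
      (∀ (U : Set V), IsOpen U → ∀ s : ∀ y, E y,
        (∀ x ∈ U, s ∈ (JetPDE.bundleStr 𝕜 n A E).sec x) →
        ((∀ x ∈ U, D.toFun x (JetPDE.jet (JetPDE.bundleStr 𝕜 n A E) k s x) = 0) ↔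
          ∃ σ : ∀ y, D.formalSol H y,
            (∀ x ∈ U, (σ x : JetPDE.Jet (JetPDE.bundleStr 𝕜 n A E) H x) =
              JetPDE.jet (JetPDE.bundleStr 𝕜 n A E) H s x) ∧
            ∀ x ∈ U, nabla.toFun σ x = 0)) ∧
      -- (i), continued: every flat section of `𝓔` over `U` is `j^(h₀ - 1) s` for exactly one
      -- solution `s` over `U`
      (∀ (U : Set V), IsOpen U → ∀ σ : ∀ y, D.formalSol H y,
        (∀ x ∈ U, σ ∈ (D.solStr H).sec x) → (∀ x ∈ U, nabla.toFun σ x = 0) →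
        ∃ s : ∀ y, E y,
          ((∀ x ∈ U, s ∈ (JetPDE.bundleStr 𝕜 n A E).sec x) ∧
            (∀ x ∈ U, D.toFun x (JetPDE.jet (JetPDE.bundleStr 𝕜 n A E) k s x) = 0) ∧
            ∀ x ∈ U, JetPDE.jet (JetPDE.bundleStr 𝕜 n A E) H s x =
              (σ x : JetPDE.Jet (JetPDE.bundleStr 𝕜 n A E) H x)) ∧
          ∀ t : ∀ y, E y, (∀ x ∈ U, t ∈ (JetPDE.bundleStr 𝕜 n A E).sec x) →
            (∀ x ∈ U, JetPDE.jet (JetPDE.bundleStr 𝕜 n A E) H t x =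
              (σ x : JetPDE.Jet (JetPDE.bundleStr 𝕜 n A E) H x)) →
            ∀ x ∈ U, t x = s x) ∧
      -- (ii) the bound for the dimension of the space of germs of solutions
      (∀ m, FiniteDimensional 𝕜 (D.SolGerm m) ∧
        (Module.finrank 𝕜 (D.SolGerm m) : ℤ) ≤ JetPDE.rankBound n k p q) ∧
      -- (ii) equality at `m` iff the curvature vanishes near `m`
      (∀ m, (Module.finrank 𝕜 (D.SolGerm m) : ℤ) = JetPDE.rankBound n k p q ↔
        ∀ᶠ x in 𝓝 m, nabla.CurvatureVanishesAt x) ∧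
      -- (ii) equality everywhere iff the curvature vanishes identically
      ((∀ m, (Module.finrank 𝕜 (D.SolGerm m) : ℤ) = JetPDE.rankBound n k p q) ↔
        ∀ x, nabla.CurvatureVanishesAt x) := by
  have hgr := JetPDE.isGreatest_hZero (n := n) hpq hqp
  have hn := JetPDE.one_le_of_lt_of_le_mul_c hpq hqp
  -- Since `1 ≤ k ≤ h₀`, the truncated subtraction in `H = h₀ - 1` is exact.
  have hH1 : JetPDE.hZero n k p q = H + 1 := by
    have := hgr.1.1
    omega
  obtain ⟨hord, heq⟩ := hcal
  rw [hH1] at heq hgr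
  have hR := hord.isRigid (JetPDE.hasFrames_bundleStr hp) (JetPDE.hasFrames_bundleStr hq) hn hD
    hgr.1.1 heq
  -- The natural-number rank agrees with the integer `rankBound`, because the subtraction is not
  -- truncated.
  have hπ : ((p * JetPDE.c (n + 1) (H + 1) - q * JetPDE.c (n + 1) (H + 1 - k) : ℕ) : ℤ) =
      JetPDE.rankBound n k p q := by
    have hle := JetPDE.mul_c_succ_le (k := k) (p := p) (q := q) (L := H + 1 - k) hn
      (by rw [Nat.sub_add_cancel hgr.1.1]; exact hgr.1.2)
    rw [Nat.sub_add_cancel hgr.1.1] at hle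
    rw [JetPDE.rankBound, hH1, Nat.cast_sub hle]
    push_cast
    ring
  have heq_iff : ∀ m, (Module.finrank 𝕜 (D.SolGerm m) : ℤ) = JetPDE.rankBound n k p q ↔
      ∀ᶠ x in 𝓝 m, hR.nabla.CurvatureVanishesAt x := fun m => by
    rw [← hR.finrank_solGerm_eq_iff, ← hπ, Nat.cast_inj]
  refine ⟨hH1 ▸ hgr, ⟨_, hπ, hR.hasFrames.isVectorBundle⟩, hR.bijOn, hR.splitting,
    hR.isTautologicalSplitting, fun u' hu' => hR.splitting_unique hu', hR.nabla,
    hR.nabla_isInducedBy, fun nabla' h x σ hσ => hR.nabla_unique h x hσ,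
    fun U hU s hs => hR.solution_iff hU hs, fun U hU σ hσ h0 => hR.exists_solution hU hσ h0,
    fun m => ⟨hR.finiteDimensional_solGerm m, ?_⟩, heq_iff, ?_⟩
  · rw [← hπ]
    exact_mod_cast hR.finrank_solGerm_le m
  · simp only [heq_iff]
    exact ⟨fun h x => (h x).self_of_nhds, fun h m => Eventually.of_forall h⟩
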